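/- Let $n\ge 0$ be an integer and $p\in\mathbb C$. Let $\mathfrak{so}(2n+1)$ be the complex Lie algebra of matrices $\begin{pmatrix} a&b&c\\ d&-a^t&e\\ -e^t&-c^t&0\end{pmatrix}$ with $b,d$ antisymmetric $n\times n$ matrices, and put $f_k^+=\sqrt2(e_{k,2n+1}-e_{2n+1,n+k})$, $f_k^-=\sqrt2(e_{2n+1,k}-e_{n+k,2n+1})$ for $1\le k\le n$. Let $\mathcal P$ be the span of all $[f_j^+,f_k^-]$, $f_j^-$, $[f_j^-,f_k^-]$; it is a subalgebra, with the one-dimensional module $\mathbb C|0\rangle$ determined by $f_j^-|0\rangle=0$, $[f_j^-,f_k^-]|0\rangle=0$ and $[f_j^-,f_k^+]|0\rangle=p\,\delta_{jk}|0\rangle$. Let $\overline W(p)=\mathrm{Ind}_{\mathcal P}^{\mathfrak{so}(2n+1)}\mathbb C|0\rangle$. A pattern $m$ is an array of integers $m_{ij}\ge 0$, $1\le i\le j\le n$, with $m_{i,j+1}\ge m_{ij}\ge m_{i+1,j+1}$ for $1\le i\le j<n$. Put $l_{ij}=m_{ij}-i$, and $S(k,l)=1$ if $k\le l$, $S(k,l)=-1$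 if $k>l$. For $1\le j\le n$ and indices $i_r\in\{1,\dots,r\}$ ($j\le r\le n$), write $i=(i_j,\dots,i_n)$, let $m\pm i$ be the array $m$ with $m_{i_r,r}$ replaced by $m_{i_r,r}\pm1$ for $r=j,\dots,n$, and let $$C_j(m,i)=\prod_{t=j+1}^{n}S(i_t,i_{t-1})\left(\frac{\prod_{k\ne i_{t-1},\,k=1}^{t-1}(l_{k,t-1}-l_{i_t,t}-1)\prod_{k\ne i_t,\,k=1}^{t}(l_{kt}-l_{i_{t-1},t-1})}{\prod_{k\ne i_t,\,k=1}^{t}(l_{kt}-l_{i_t,t})\prod_{k\ne i_{t-1},\,k=1}^{t-1}(l_{k,t-1}-l_{i_{t-1},t-1}-1)}\right)^{1/2}\cdot\left(\frac{\prod_{k=1}^{j-1}(l_{k,j-1}-l_{i_j,j}-1)}{\prod_{k\ne i_j,\,k=1}^{j}(l_{kj}-l_{i_j,j})}\right)^{1/2}$$ be the $\mathfrak u(n)$ Clebsch–Gordan coefficient for $m\to m+i$. Let $\mathcal E_n=1$ for $n$ even and $0$ otherwise, $\mathcal O_n=1-\mathcal E_n$. For $\mu=(\mu_1\ge\dots\ge\mu_n\ge0)$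 and $1\le k\le n$ let, for $k$ even, $$G_k(\mu)=R_k(\mu)^{1/2},\qquad R_k(\mu)=-\frac{(\mathcal E_n\cdot(\mu_k+n-k)+1)\prod_{j\ne k,\,j=1}^{n}(\mu_k-\mu_j-k+j)}{\prod_{j\ne k/2,\,j=1}^{\lfloor n/2\rfloor}(\mu_k-\mu_{2j}-k+2j)(\mu_k-\mu_{2j}-k+2j+1)},$$ and, for $k$ odd, $$G_k(\mu)=\big((p-\mu_k+k-1)R_k(\mu)\big)^{1/2},\qquad R_k(\mu)=\frac{(\mathcal O_n\cdot(\mu_k+n-k)+1)\prod_{j\ne k,\,j=1}^{n}(\mu_k-\mu_j-k+j)}{\prod_{j\ne (k+1)/2,\,j=1}^{\lceil n/2\rceil}(\mu_k-\mu_{2j-1}-k+2j-1)(\mu_k-\mu_{2j-1}-k+2j)},$$ with the principal square root. Let $G_k^{*}(\mu)=G_k(\mu)$, except that $G_k^{*}(\mu)=R_k(\mu)^{1/2}$ if $k$ is odd and $p-\mu_k+k-1=0$. Write $[m]$ for the top row $(m_{1n},\dots,m_{nn})$. Vectors $|e)$ for arrays $e$ that are not patterns are read as $0$, and so are the terms of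 a sum in which they occur. Then: (1) $R_k(\mu)>0$ for all $\mu$ and $k$. (2) On the vector space with basis all $|m)$, the operators $$f_j^+|m)=\sum_{i}C_j(m,i)\,G_{i_n}([m])\,|m+i),\qquad f_j^-|m)=\sum_{i}C_j(m-i,i)\,G_{i_n}([m-i])\,|m-i)$$ satisfy all the parafermion triple relations $$[[f_j^\xi,f_k^\eta],f_l^\epsilon]=\tfrac12(\epsilon-\eta)^2\delta_{kl}f_j^\xi-\tfrac12(\epsilon-\xi)^2\delta_{jl}f_k^\eta\qquad(\xi,\eta,\epsilon=\pm1);$$ the zero pattern $|0)$ satisfies $f_j^-|0)=0$ and $[f_j^-,f_k^+]|0)=p\,\delta_{jk}|0)$; and (with $E_{jk}=\frac12[f_j^+,f_k^-]$) the vectors $|m)$ form a Gelfand–Zetlin basis for $\mathfrak u(n)$: $E_{kk}|m)=\big(-\frac p2+\sum_{i=1}^{k}m_{ik}-\sum_{i=1}^{k-1}m_{i,k-1}\big)|m)$, and $E_{k,k+1}$, $E_{k+1,k}$ act by $$E_{k,k+1}|m)=\sum_{i=1}^{k}A_{ik}(m)\,|m+\delta_{ik}),\qquad E_{k+1,k}|m)=\sum_{i=1}^{k}A_{ik}(m-\delta_{ik})\,|m-\delta_{ik}),$$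 $$A_{ik}(m)=\left(-\frac{\prod_{a=1}^{k+1}(l_{a,k+1}-l_{ik})\prod_{a=1}^{k-1}(l_{a,k-1}-l_{ik}-1)}{\prod_{a\ne i,\,a=1}^{k}(l_{ak}-l_{ik})(l_{ak}-l_{ik}-1)}\right)^{1/2},$$ where $m\pm\delta_{ik}$ is $m$ with $m_{ik}$ replaced by $m_{ik}\pm1$. (3) The induced module $\overline W(p)$ has a basis $|m)$, indexed by all patterns, whose vector for the zero pattern is $|0\rangle$, which is a Gelfand–Zetlin basis for $\mathfrak u(n)$ in the sense of (2), and on which $$f_j^+|m)=\sum_{i}C_j(m,i)\,G^{*}_{i_n}([m])\,|m+i),\qquad f_j^-|m)=\sum_{i}C_j(m-i,i)\,G_{i_n}([m-i])\,|m-i).$$ In particular, if $p\ne\mu_k-k+1$ for all partitions $\mu$ and all odd $k\le n$, then both $f_j^+$ and $f_j^-$ act on $\overline W(p)$ through the reduced matrix elements $G_k$. -/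

import Mathlib

open scoped Matrix

noncomputable section

namespace Parafermion

attribute [local instance 100] LieRing.ofAssociativeRing

/-! ## The Lie algebra `so(2n+1)` and its parafermion generators -/

/-- Row and column labels `1, …, n`, `n+1, …, 2n`, `2n+1`. -/
abbrev Idx (n : ℕ) : Type := (Fin n ⊕ Fin n) ⊕ Unit

/-- The symmetric bilinear form with matrix `[[0,1,0],[1,0,0],[0,0,1]]`. -/
def soForm (n : ℕ) : Matrix (Idx n) (Idx n) ℂ :=
  Matrix.fromBlocks (Matrix.fromBlocks 0 1 1 0) 0 0 1

/-- The complex Lie algebra `so(2n+1)`: all matrices `[[a,b,c],[d,-aᵗ,e],[-eᵗ,-cᵗ,0]]` with `b`, `d`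
antisymmetric, that is, all `X` with `Xᵗ J + J X = 0` for the form `J` above. -/
def so (n : ℕ) : LieSubalgebra ℂ (Matrix (Idx n) (Idx n) ℂ) :=
  skewAdjointMatricesLieSubalgebra (soForm n)

/-- `√2 (e_{k,2n+1} - e_{2n+1,n+k})`. -/
def fPlusMat (n : ℕ) (k : Fin n) : Matrix (Idx n) (Idx n) ℂ :=
  (Real.sqrt 2 : ℂ) • (Matrix.single (Sum.inl (Sum.inl k)) (Sum.inr ()) 1
    - Matrix.single (Sum.inr ()) (Sum.inl (Sum.inr k)) 1)

/-- `√2 (e_{2n+1,k} - e_{n+k,2n+1})`. -/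
def fMinusMat (n : ℕ) (k : Fin n) : Matrix (Idx n) (Idx n) ℂ :=
  (Real.sqrt 2 : ℂ) • (Matrix.single (Sum.inr ()) (Sum.inl (Sum.inl k)) 1
    - Matrix.single (Sum.inl (Sum.inr k)) (Sum.inr ()) 1)

/-- Membership in `so n`, in terms of the block form. -/
theorem mem_so_iff (n : ℕ) (X : Matrix (Idx n) (Idx n) ℂ) :
    X ∈ so n ↔
      (∀ i j, X (.inl (.inr i)) (.inl (.inr j)) = - X (.inl (.inl j)) (.inl (.inl i))) ∧
      (∀ i j, X (.inl (.inl i)) (.inl (.inr j)) = - X (.inl (.inl j)) (.inl (.inr i))) ∧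
      (∀ i j, X (.inl (.inr i)) (.inl (.inl j)) = - X (.inl (.inr j)) (.inl (.inl i))) ∧
      (∀ i, X (.inr ()) (.inl (.inl i)) = - X (.inl (.inr i)) (.inr ())) ∧
      (∀ i, X (.inr ()) (.inl (.inr i)) = - X (.inl (.inl i)) (.inr ())) ∧
      X (.inr ()) (.inr ()) = 0 := by
  have key : X ∈ so n ↔ Xᵀ * soForm n = soForm n * (-X) := by
    unfold so
    rw [mem_skewAdjointMatricesLieSubalgebra, mem_skewAdjointMatricesSubmodule]
    rfl
  have hL : ∀ x y, (Xᵀ * soForm n) x y =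
      X (Equiv.sumCongr (Equiv.sumComm _ _) (Equiv.refl _) y) x := by
    rintro x ((y | y) | y) <;>
      simp [Matrix.mul_apply, soForm, Fintype.sum_sum_type, Matrix.one_apply]
  have hR : ∀ x y, (soForm n * (-X)) x y =
      - X (Equiv.sumCongr (Equiv.sumComm _ _) (Equiv.refl _) x) y := by
    rintro ((x | x) | x) y <;>
      simp [Matrix.mul_apply, soForm, Fintype.sum_sum_type, Matrix.one_apply]
  rw [key, ← Matrix.ext_iff]
  simp only [hL, hR, Sum.forall, Equiv.sumCongr_apply, Sum.map_inl, Sum.map_inr,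
    Equiv.sumComm_apply, Sum.swap_inl, Sum.swap_inr, Equiv.refl_apply]
  constructor
  · intro h
    refine ⟨fun i j => ((h.1.2 j).1.1 i), fun i j => ((h.1.2 j).1.2 i),
      fun i j => ((h.1.1 j).1.1 i), fun i => (h.1.1 i).2 (), fun i => (h.1.2 i).2 (), ?_⟩
    exact self_eq_neg.1 ((h.2 ()).2 ())
  · rintro ⟨h1, h2, h3, h4, h5, h6⟩
    refine ⟨⟨fun i => ⟨⟨fun j => h3 j i, fun j => ?_⟩, fun _ => h4 i⟩,
      fun i => ⟨⟨fun j => h1 j i, fun j => h2 j i⟩, fun _ => h5 i⟩⟩,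
      fun _ => ⟨⟨fun j => ?_, fun j => ?_⟩, fun _ => ?_⟩⟩
    · rw [h1 i j, neg_neg]
    · rw [h4 j, neg_neg]
    · rw [h5 j, neg_neg]
    · rw [h6, neg_zero]

theorem fPlusMat_mem (n : ℕ) (k : Fin n) : fPlusMat n k ∈ so n := by
  rw [mem_so_iff]
  simp [fPlusMat, Matrix.single_apply]

theorem fMinusMat_mem (n : ℕ) (k : Fin n) : fMinusMat n k ∈ so n := by
  rw [mem_so_iff]
  simp [fMinusMat, Matrix.single_apply]

/-- The parafermion generators `f_k^σ` of `so(2n+1)`, where `σ = 1` is `+` and `σ = -1` is `-`. -/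
def soGen (n : ℕ) (σ : ℤˣ) (k : Fin n) : so n :=
  if σ = 1 then ⟨fPlusMat n k, fPlusMat_mem n k⟩ else ⟨fMinusMat n k, fMinusMat_mem n k⟩

/-! ## The parabolic subalgebra, its character, and the induced module -/

/-- The elements `[f_j^+, f_k^-]`, `f_j^-`, `[f_j^-, f_k^-]`. -/
def parabolicSet (n : ℕ) : Set (so n) :=
  {X | ∃ j k, X = ⁅soGen n 1 j, soGen n (-1) k⁆} ∪ {X | ∃ j, X = soGen n (-1) j} ∪
    {X | ∃ j k, X = ⁅soGen n (-1) j, soGen n (-1) k⁆}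

theorem sqrt_two_mul_sqrt_two : (Real.sqrt 2 : ℂ) * (Real.sqrt 2 : ℂ) = 2 := by
  rw [← Complex.ofReal_mul, Real.mul_self_sqrt (by norm_num)]
  norm_num

/-- `[f_j^+, f_k^-] = 2 (e_{jk} - e_{n+k,n+j})`. -/
theorem lie_plus_minus (n : ℕ) (j k : Fin n) : (⁅soGen n 1 j, soGen n (-1) k⁆ : so n).1 =
    (2 : ℂ) • (Matrix.single (.inl (.inl j)) (.inl (.inl k)) 1
      - Matrix.single (.inl (.inr k)) (.inl (.inr j)) 1) := by
  have hs := sqrt_two_mul_sqrt_two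
  have e : (⁅soGen n 1 j, soGen n (-1) k⁆ : so n).1 = ⁅fPlusMat n j, fMinusMat n k⁆ := by
    simp [soGen]
  rw [e, LieRing.of_associative_ring_bracket]
  simp only [fPlusMat, fMinusMat, Matrix.smul_mul, Matrix.mul_smul, smul_smul, hs]
  rw [← smul_sub]
  congr 1
  rcases eq_or_ne j k with rfl | hjk
  · simp [mul_sub, sub_mul]
    abel
  · simp [mul_sub, sub_mul, Matrix.single_mul_single_of_ne, hjk, hjk.symm]

/-- The span of `parabolicSet` consists of the block lower triangular matrices in `so(2n+1)`:
those with `b = 0` and `c = 0`. -/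
theorem mem_span_parabolicSet (n : ℕ) (X : so n) :
    X ∈ Submodule.span ℂ (parabolicSet n) ↔
      (∀ i j, X.1 (.inl (.inl i)) (.inl (.inr j)) = 0) ∧
      (∀ i, X.1 (.inl (.inl i)) (.inr ()) = 0) := by
  have hs := sqrt_two_mul_sqrt_two
  have hs0 : (Real.sqrt 2 : ℂ) ≠ 0 := by
    intro h
    simp [h] at hs
  have hpp := lie_plus_minus n
  have hmm : ∀ j k : Fin n, (⁅soGen n (-1) j, soGen n (-1) k⁆ : so n).1 =
      (-2 : ℂ) • (Matrix.single (.inl (.inr j)) (.inl (.inl k)) 1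
        - Matrix.single (.inl (.inr k)) (.inl (.inl j)) 1) := by
    intro j k
    have e : (⁅soGen n (-1) j, soGen n (-1) k⁆ : so n).1 = ⁅fMinusMat n j, fMinusMat n k⁆ := by
      simp [soGen]
    rw [e, LieRing.of_associative_ring_bracket]
    simp only [fMinusMat, Matrix.smul_mul, Matrix.mul_smul, smul_smul, hs]
    rw [← smul_sub, neg_smul, ← smul_neg]
    congr 1
    simp [mul_sub, sub_mul]
    abel
  have hm : ∀ j : Fin n, (soGen n (-1) j).1 = fMinusMat n j := by
    intro j
    simp [soGen]
  constructor
  · intro h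
    induction h using Submodule.span_induction with
    | mem x hx =>
      rcases hx with (⟨j, k, rfl⟩ | ⟨j, rfl⟩) | ⟨j, k, rfl⟩
      · rw [hpp]; simp
      · rw [hm]; simp [fMinusMat]
      · rw [hmm]; simp
    | zero => simp
    | add x y _ _ hx hy => simp [hx.1, hx.2, hy.1, hy.2]
    | smul c x _ hx => simp [hx.1, hx.2]
  · rintro ⟨hb, hc⟩
    obtain ⟨h1, h2, h3, h4, h5, h6⟩ := (mem_so_iff n X.1).1 X.2
    have hX : X = (∑ j, ∑ k, (X.1 (.inl (.inl j)) (.inl (.inl k)) / 2) •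
          ⁅soGen n 1 j, soGen n (-1) k⁆)
        + (∑ j, (X.1 (.inr ()) (.inl (.inl j)) / (Real.sqrt 2 : ℂ)) • soGen n (-1) j)
        + (∑ j, ∑ k, (-X.1 (.inl (.inr j)) (.inl (.inl k)) / 4) •
          ⁅soGen n (-1) j, soGen n (-1) k⁆) := by
      apply Subtype.ext
      have hsub : ∀ Y : so n, ((so n).incl : so n →ₗ[ℂ] Matrix (Idx n) (Idx n) ℂ) Y = Y.1 :=
        fun _ => rfl
      rw [← hsub, ← hsub]
      simp only [map_add, map_sum, map_smul]
      simp only [hsub, hpp, hmm, hm]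
      ext x y
      rcases x with (x | x) | x <;> rcases y with (y | y) | y <;>
        simp [Matrix.add_apply, Matrix.sum_apply, Matrix.single_apply, fMinusMat, ite_and]
      · exact hb x y
      · exact hc x
      · have h3' := h3 y x
        simp only [mul_sub, Finset.sum_sub_distrib, mul_ite, mul_one, mul_zero,
          Finset.sum_ite_irrel, Finset.sum_const_zero, Finset.sum_ite_eq', Finset.mem_univ,
          if_true]
        linear_combination (1 / 2 : ℂ) * h3'
      · exact h1 x y
      · rw [h4 x, neg_neg]
      · rw [h5 y, hc y, neg_zero]
      · exact h6
    rw [hX]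
    refine Submodule.add_mem _ (Submodule.add_mem _ ?_ ?_) ?_
    · exact Submodule.sum_mem _ fun j _ => Submodule.sum_mem _ fun k _ =>
        Submodule.smul_mem _ _ (Submodule.subset_span (Or.inl (Or.inl ⟨j, k, rfl⟩)))
    · exact Submodule.sum_mem _ fun j _ =>
        Submodule.smul_mem _ _ (Submodule.subset_span (Or.inl (Or.inr ⟨j, rfl⟩)))
    · exact Submodule.sum_mem _ fun j _ => Submodule.sum_mem _ fun k _ =>
        Submodule.smul_mem _ _ (Submodule.subset_span (Or.inr ⟨j, k, rfl⟩))

/-- The parabolic subalgebra: the linear span of the elements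
`[f_j^+, f_k^-]`, `f_j^-`, `[f_j^-, f_k^-]`. -/
def parabolic (n : ℕ) : LieSubalgebra ℂ (so n) :=
  { Submodule.span ℂ (parabolicSet n) with
    lie_mem' := by
      intro X Y hX hY
      have hX' := (mem_span_parabolicSet n X).1 hX
      have hY' := (mem_span_parabolicSet n Y).1 hY
      refine (mem_span_parabolicSet n ⁅X, Y⁆).2 ⟨fun i j => ?_, fun i => ?_⟩ <;>
        simp [LieRing.of_associative_ring_bracket, Matrix.mul_apply, Fintype.sum_sum_type,
          hX'.1, hX'.2, hY'.1, hY'.2, ((mem_so_iff n X.1).1 X.2).2.2.2.2.1,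
          ((mem_so_iff n Y.1).1 Y.2).2.2.2.2.1, ((mem_so_iff n X.1).1 X.2).2.2.2.2.2,
          ((mem_so_iff n Y.1).1 Y.2).2.2.2.2.2] }

/-- The one-dimensional representation `ℂ|0⟩` of the parabolic subalgebra: `X` acts by
`-(p/2) tr a`, where `a` is the upper left block of `X`. -/
def vacuumChar (n : ℕ) (p : ℂ) : LieAlgebra.LieCharacter ℂ (parabolic n) :=
  { toFun := fun X => -(p / 2) * ∑ j : Fin n, X.1.1 (.inl (.inl j)) (.inl (.inl j))
    map_add' := by
      intro X Y
      simp [Finset.sum_add_distrib, mul_add]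
    map_smul' := by
      intro c X
      simp [← Finset.mul_sum]
      ring
    map_lie' := by
      intro X Y
      have hX' := (mem_span_parabolicSet n X.1).1 X.2
      have hY' := (mem_span_parabolicSet n Y.1).1 Y.2
      rw [LieRing.of_associative_ring_bracket, mul_comm (- (p / 2) * _), sub_self]
      have : ∑ j : Fin n, (⁅X, Y⁆ : parabolic n).1.1 (.inl (.inl j)) (.inl (.inl j)) = 0 := by
        simp [LieRing.of_associative_ring_bracket, Matrix.mul_apply, Fintype.sum_sum_type,
          hX'.1, hX'.2, hY'.1, hY'.2]
        rw [Finset.sum_comm]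
        simp [mul_comm]
      rw [this, mul_zero] }

theorem soGen_minus_mem (n : ℕ) (j : Fin n) : soGen n (-1) j ∈ parabolic n :=
  Submodule.subset_span (Or.inl (Or.inr ⟨j, rfl⟩))

theorem lie_mem_parabolic (n : ℕ) (j k : Fin n) :
    ⁅soGen n (-1) j, soGen n 1 k⁆ ∈ parabolic n := by
  rw [← lie_skew]
  exact (parabolic n).toSubmodule.neg_mem
    (Submodule.subset_span (Or.inl (Or.inl ⟨k, j, rfl⟩)))

/-- `f_j^- |0⟩ = 0`. -/
theorem vacuumChar_minus (n : ℕ) (p : ℂ) (j : Fin n) :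
    vacuumChar n p ⟨soGen n (-1) j, soGen_minus_mem n j⟩ = 0 := by
  simp [vacuumChar, soGen, fMinusMat]

/-- `[f_j^-, f_k^+] |0⟩ = p δ_{jk} |0⟩`. -/
theorem vacuumChar_lie (n : ℕ) (p : ℂ) (j k : Fin n) :
    vacuumChar n p ⟨⁅soGen n (-1) j, soGen n 1 k⁆, lie_mem_parabolic n j k⟩ =
      if j = k then p else 0 := by
  have h : (⁅soGen n (-1) j, soGen n 1 k⁆ : so n).1 =
      -((2 : ℂ) • (Matrix.single (.inl (.inl k)) (.inl (.inl j)) 1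
        - Matrix.single (.inl (.inr j)) (.inl (.inr k)) 1)) := by
    rw [← lie_plus_minus, ← lie_skew]
    rfl
  change -(p / 2) * ∑ i : Fin n,
    (⁅soGen n (-1) j, soGen n 1 k⁆ : so n).1 (.inl (.inl i)) (.inl (.inl i)) = _
  rw [h]
  rcases eq_or_ne j k with rfl | hjk
  · simp [Matrix.single_apply]
  · simp [Matrix.single_apply, hjk, ite_and, Finset.sum_ite_eq]

/-- The left ideal of `U(so(2n+1))` generated by the elements `x - χ(x)`, for `x` in the parabolic
subalgebra and `χ` its vacuum character. -/
def inducedIdeal (n : ℕ) (p : ℂ) : Submodule (UniversalEnvelopingAlgebra ℂ (so n))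
    (UniversalEnvelopingAlgebra ℂ (so n)) :=
  Submodule.span _ {u | ∃ x : parabolic n,
    u = UniversalEnvelopingAlgebra.ι ℂ (x : so n) - algebraMap ℂ _ (vacuumChar n p x)}

/-- The induced module `W̄(p)`: the module induced from the one-dimensional representation `ℂ|0⟩`
of the parabolic subalgebra `P` to `so(2n+1)`, that is, `U(so(2n+1)) ⊗_{U(P)} ℂ|0⟩`, which for
a one-dimensional representation is the quotient of `U(so(2n+1))` by the left ideal above. -/
abbrev WBar (n : ℕ) (p : ℂ) : Type :=
  UniversalEnvelopingAlgebra ℂ (so n) ⧸ inducedIdeal n p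

/-- The vacuum vector `|0⟩` of `W̄(p)`. -/
def vacuum (n : ℕ) (p : ℂ) : WBar n p := Submodule.Quotient.mk 1

/-- The action of the generator `f_j^σ` on `W̄(p)`. -/
def inducedOp (n : ℕ) (p : ℂ) (σ : ℤˣ) (j : Fin n) : Module.End ℂ (WBar n p) :=
  Algebra.lsmul ℂ ℂ (WBar n p) (UniversalEnvelopingAlgebra.ι ℂ (soGen n σ j))

/-! ## Gelfand–Zetlin patterns -/

/-- A Gelfand–Zetlin pattern with `n` rows of nonnegative integers: `entry i j` is `m_{ij}`, the
`i`-th entry of row `j`, for `1 ≤ i ≤ j ≤ n`, and `0` for all other indices; row `n` is the top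
row. The top row is a partition. -/
@[ext]
structure GZPattern (n : ℕ) where
  entry : ℕ → ℕ → ℕ
  zeros : ∀ i j, ¬ (1 ≤ i ∧ i ≤ j ∧ j ≤ n) → entry i j = 0
  upper : ∀ i j, 1 ≤ i → i ≤ j → j < n → entry i j ≤ entry i (j + 1)
  lower : ∀ i j, 1 ≤ i → i ≤ j → j < n → entry (i + 1) (j + 1) ≤ entry i j

/-- The pattern all of whose entries are zero. -/
def zeroPattern (n : ℕ) : GZPattern n where
  entry := fun _ _ => 0
  zeros := fun _ _ _ => rfl
  upper := fun _ _ _ _ _ => le_rfl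
  lower := fun _ _ _ _ _ => le_rfl

/-- The entries of a pattern as integers. -/
def GZPattern.toInt {n : ℕ} (m : GZPattern n) : ℕ → ℕ → ℤ := fun i j => (m.entry i j : ℤ)

open Classical in
/-- The vector `|e)` of a family of vectors labelled by patterns, for an array `e` of integers;
it is read as `0` when `e` is not a pattern. -/
def ket {n : ℕ} {W : Type*} [AddCommGroup W] (b : GZPattern n → W) (e : ℕ → ℕ → ℤ) : W :=
  if h : ∃ q : GZPattern n, q.toInt = e then b h.choose else 0

/-- `l_{ij} = m_{ij} - i`. -/
def ell (e : ℕ → ℕ → ℤ) (i j : ℕ) : ℝ := (e i j : ℝ) - i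

/-! ## The `u(n)` Clebsch–Gordan coefficients -/

/-- A choice of indices `i_r ∈ {1, …, r}` for `r = j, …, n`. -/
abbrev IndexPath (n j : ℕ) : Type :=
  ∀ r : ↥(Finset.Icc j n), ↥(Finset.Icc 1 (r : ℕ))

/-- The index `i_r` (and `0` if `r` is not one of `j, …, n`). -/
def IndexPath.idx {n j : ℕ} (s : IndexPath n j) (r : ℕ) : ℕ :=
  if h : r ∈ Finset.Icc j n then (s ⟨r, h⟩ : ℕ) else 0

/-- The array obtained by adding `c` to the entries `m_{i_r, r}`, `r = j, …, n`. -/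
def IndexPath.shift {n j : ℕ} (s : IndexPath n j) (c : ℤ) (e : ℕ → ℕ → ℤ) : ℕ → ℕ → ℤ :=
  fun i r => if r ∈ Finset.Icc j n ∧ i = s.idx r then e i r + c else e i r

/-- The sign `S(k,l)`. -/
def sgn (k l : ℕ) : ℝ := if k ≤ l then 1 else -1

/-- The `u(t)`-`u(t-1)` isoscalar factor (without its sign) for raising `m_{a,t}` and
`m_{b,t-1}`. -/
def isoscalar (e : ℕ → ℕ → ℤ) (t a b : ℕ) : ℝ :=
  Real.sqrt
    (((∏ k ∈ (Finset.Icc 1 (t - 1)).erase b, (ell e k (t - 1) - ell e a t - 1)) *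
        ∏ k ∈ (Finset.Icc 1 t).erase a, (ell e k t - ell e b (t - 1))) /
      ((∏ k ∈ (Finset.Icc 1 t).erase a, (ell e k t - ell e a t)) *
        ∏ k ∈ (Finset.Icc 1 (t - 1)).erase b, (ell e k (t - 1) - ell e b (t - 1) - 1)))

/-- The isoscalar factor for raising `m_{a,j}` and no entry of row `j - 1`. -/
def isoscalarLast (e : ℕ → ℕ → ℤ) (j a : ℕ) : ℝ :=
  Real.sqrt
    ((∏ k ∈ Finset.Icc 1 (j - 1), (ell e k (j - 1) - ell e a j - 1)) /
      ∏ k ∈ (Finset.Icc 1 j).erase a, (ell e k j - ell e a j))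

/-- The `u(n)` Clebsch–Gordan coefficient `( m ; 1 0 ⋯ 0 | m' )` for the component of weight `ε_j` of
the tensor of rank `(1, 0, …, 0)`, where `m` has entries `e` and `m'` arises from `m` by
adding `1` to `m_{i_r, r}` for `r = j, …, n`. -/
def clebschGordan {n j : ℕ} (e : ℕ → ℕ → ℤ) (s : IndexPath n j) : ℝ :=
  (∏ t ∈ Finset.Icc (j + 1) n,
      (sgn (s.idx t) (s.idx (t - 1)) * isoscalar e t (s.idx t) (s.idx (t - 1)))) *
    isoscalarLast e j (s.idx j)

/-! ## The reduced matrix elements -/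

/-- `1` if `j` is even and `0` otherwise. -/
def evenInd (j : ℕ) : ℝ := if Even j then 1 else 0

/-- `1` if `j` is odd and `0` otherwise. -/
def oddInd (j : ℕ) : ℝ := if Odd j then 1 else 0

/-- For even `k`, the expression under the square root in `G_k(μ_1, …, μ_n)`. -/
def radicandEven (n k : ℕ) (μ : ℕ → ℤ) : ℝ :=
  -(((evenInd n * (μ k + n - k) + 1) *
      ∏ j ∈ (Finset.Icc 1 n).erase k, ((μ k : ℝ) - μ j - k + j)) /
    ∏ j ∈ (Finset.Icc 1 (n / 2)).erase (k / 2),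
      (((μ k : ℝ) - μ (2 * j) - k + 2 * j) * ((μ k : ℝ) - μ (2 * j) - k + 2 * j + 1)))

/-- For odd `k`, the expression under the square root in `G_k(μ_1, …, μ_n)`, without the
factor `p - μ_k + k - 1`. -/
def radicandOdd (n k : ℕ) (μ : ℕ → ℤ) : ℝ :=
  ((oddInd n * (μ k + n - k) + 1) *
      ∏ j ∈ (Finset.Icc 1 n).erase k, ((μ k : ℝ) - μ j - k + j)) /
    ∏ j ∈ (Finset.Icc 1 ((n + 1) / 2)).erase ((k + 1) / 2),
      (((μ k : ℝ) - μ (2 * j - 1) - k + 2 * j - 1) * ((μ k : ℝ) - μ (2 * j - 1) - k + 2 * j))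

/-- The factor `p - μ_k + k - 1`. -/
def orderFactor (p : ℂ) (k : ℕ) (μ : ℕ → ℤ) : ℂ := p - μ k + k - 1

/-- The reduced matrix element `G_k(μ_1, …, μ_n)`, with the principal square root. -/
def reducedG (n : ℕ) (p : ℂ) (k : ℕ) (μ : ℕ → ℤ) : ℂ :=
  if Even k then (radicandEven n k μ : ℂ) ^ (1 / 2 : ℂ)
  else (orderFactor p k μ * (radicandOdd n k μ : ℂ)) ^ (1 / 2 : ℂ)

/-- `G_k(μ_1, …, μ_n)`, except that the factor `p - μ_k + k - 1` is left out if it is zero. -/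
def reducedGRegular (n : ℕ) (p : ℂ) (k : ℕ) (μ : ℕ → ℤ) : ℂ :=
  if Odd k ∧ orderFactor p k μ = 0 then (radicandOdd n k μ : ℂ) ^ (1 / 2 : ℂ)
  else reducedG n p k μ

/-! ## The explicit actions -/

section actions

variable {n : ℕ} {W : Type*} [AddCommGroup W] [Module ℂ W]

/-- The action of `f_j^+` on `|m)` by Clebsch–Gordan coefficients times reduced matrix
elements `G k μ`. -/
def raiseVec (G : ℕ → (ℕ → ℤ) → ℂ) (b : GZPattern n → W) (j : ℕ) (m : GZPattern n) : W :=
  ∑ s : IndexPath n j,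
    ((clebschGordan m.toInt s : ℂ) * G (s.idx n) (fun i => m.toInt i n)) •
      ket b (s.shift 1 m.toInt)

/-- The action of `f_j^-` on `|m)` by Clebsch–Gordan coefficients times reduced matrix
elements `G k μ`, both taken at the lowered pattern. -/
def lowerVec (G : ℕ → (ℕ → ℤ) → ℂ) (b : GZPattern n → W) (j : ℕ) (m : GZPattern n) : W :=
  ∑ s : IndexPath n j,
    ((clebschGordan (s.shift (-1) m.toInt) s : ℂ) *
        G (s.idx n) (fun i => s.shift (-1) m.toInt i n)) •
      ket b (s.shift (-1) m.toInt)

/-- The entries of a pattern with `c` added to `m_{ik}`. -/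
def shiftAt (i k : ℕ) (c : ℤ) (e : ℕ → ℕ → ℤ) : ℕ → ℕ → ℤ :=
  fun a r => if a = i ∧ r = k then e a r + c else e a r

/-- The classical Gelfand–Zetlin matrix element of `E_{k,k+1}` for raising `m_{ik}`. -/
def gzCoeff (e : ℕ → ℕ → ℤ) (k i : ℕ) : ℝ :=
  Real.sqrt
    (-((∏ a ∈ Finset.Icc 1 (k + 1), (ell e a (k + 1) - ell e i k)) *
        ∏ a ∈ Finset.Icc 1 (k - 1), (ell e a (k - 1) - ell e i k - 1)) /
      ∏ a ∈ (Finset.Icc 1 k).erase i,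
        ((ell e a k - ell e i k) * (ell e a k - ell e i k - 1)))

/-- The vectors `b m` are acted upon as in the classical Gelfand–Zetlin basis, shifted by the
weight `(-p/2, …, -p/2)`, by the operators `E_{jk} = ½ [f_j^+, f_k^-]`: the action of
`E_{kk}`, `E_{k,k+1}` and `E_{k+1,k}` (which generate `u(n)`) is the classical one. -/
def IsGZFamily (p : ℂ) (f : ℤˣ → Fin n → Module.End ℂ W) (b : GZPattern n → W) : Prop :=
  (∀ (k : Fin n) (m : GZPattern n),
    (1 / 2 : ℂ) • ⁅f 1 k, f (-1) k⁆ (b m) =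
      (-(p / 2) + ∑ i ∈ Finset.Icc 1 (k + 1 : ℕ), (m.entry i (k + 1) : ℂ)
        - ∑ i ∈ Finset.Icc 1 (k : ℕ), (m.entry i k : ℂ)) • b m) ∧
  (∀ (k k' : Fin n) (m : GZPattern n), (k' : ℕ) = k + 1 →
    (1 / 2 : ℂ) • ⁅f 1 k, f (-1) k'⁆ (b m) =
      ∑ i ∈ Finset.Icc 1 (k + 1 : ℕ),
        (gzCoeff m.toInt (k + 1) i : ℂ) • ket b (shiftAt i (k + 1) 1 m.toInt)) ∧
  (∀ (k k' : Fin n) (m : GZPattern n), (k' : ℕ) = k + 1 →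
    (1 / 2 : ℂ) • ⁅f 1 k', f (-1) k⁆ (b m) =
      ∑ i ∈ Finset.Icc 1 (k + 1 : ℕ),
        (gzCoeff (shiftAt i (k + 1) (-1) m.toInt) (k + 1) i : ℂ) •
          ket b (shiftAt i (k + 1) (-1) m.toInt))

/-- The triple relations of `n` parafermions. -/
def TripleRelations (f : ℤˣ → Fin n → Module.End ℂ W) : Prop :=
  ∀ (ξ η ε : ℤˣ) (j k l : Fin n),
    ⁅⁅f ξ j, f η k⁆, f ε l⁆ =
      ((1 / 2 : ℂ) * (((ε : ℤ) : ℂ) - ((η : ℤ) : ℂ)) ^ 2 * (if k = l then 1 else 0)) • f ξ j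
      - ((1 / 2 : ℂ) * (((ε : ℤ) : ℂ) - ((ξ : ℤ) : ℂ)) ^ 2 * (if j = l then 1 else 0)) • f η k

end actions

/-- The space with basis all vectors `|m)`. -/
abbrev PatternSpace (n : ℕ) : Type := GZPattern n →₀ ℂ

/-- The basis vectors `|m)`. -/
def patternVec {n : ℕ} (m : GZPattern n) : PatternSpace n := Finsupp.single m 1

/-- The operators on the span of all `|m)` given by Clebsch–Gordan coefficients times `G_k`. -/
def patternOp (n : ℕ) (p : ℂ) (σ : ℤˣ) (j : Fin n) : Module.End ℂ (PatternSpace n) :=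
  Finsupp.linearCombination ℂ fun m =>
    if σ = 1 then raiseVec (reducedG n p) patternVec (j + 1) m
    else lowerVec (reducedG n p) patternVec (j + 1) m

end Parafermion

end

/-!
The proof constructs the parafermion operators from Chevalley generators. On the space with basis
`|m)` there are operators `rowUp k` and `rowDown k` that raise and lower the entries of row `k` by
`1`. For `k < n` they are the Gelfand–Zetlin generators of `u(n)`; for `k = n` their matrix elements
are square roots of `topRad`, times weights `a` for raising and `b` for lowering with
`a * b = p - m_{in} + i - 1` for odd `i` and `a * b = 1` for even `i`. Up to the factor that depends
on `p`, every `G_k` is the square root of a positive radicand, so both `G_k` and `G_k^*` are of this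
form (`HasWeights`).

* The weights `[rowUp k, rowDown k]` follow from partial fraction expansions: the radicands are
  residues of rational functions, whose sum is read off from the behaviour at infinity
  (`lagrange_sum`, `gzRad_sum`, `topRad_sum`). The off-diagonal terms cancel, because radicands for
  two successive steps do not depend on the order of the steps (`rowRad_exchange`).

* If no weight vanishes, all `|m)` are generated from `|0)`, dually only multiples of `|0)` are
  annihilated by all lowering operators, and a raising operator that commutes with all of these is
  zero (`eq_zero_of_lie_rowDown`). This proves the Serre relations and `[[f_j⁺, f_k⁺], f_l⁺] = 0`
  for the weights `a = 1` and a generic `p`. They do not involve `b`, and they carry over to all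
  weights `a`, including those with zeros, by a diagonal change of basis above each pattern
  (`GaugePair`).

* The Clebsch–Gordan coefficients are the matrix elements of the iterated commutators
  `f_j⁺ = [e_j, [e_{j+1}, … [e_{n-1}, f_n⁺]]]`, where `e_k = rowUp k` (`raiseOp_eq_lie`). By the
  Serre relations these are the components of a vector operator, and the triple relations between
  `f⁺` and `f⁻` reduce to those of the components `f_n⁺` and `f_n⁻` (`IsVectorPair.triple`).

* For the induced module, the weights `regularWeight` of `f⁺` have no zeros. The triple relations
  give a representation of `so(2n+1)` on the space of patterns (`soRep`), hence a homomorphism from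
  the induced module that maps the vacuum to `|0)` (`toPatternSpace`). It is surjective, because
  `|0)` generates the space. It is injective by a count of dimensions: since the commutators
  `[f_j⁺, f_k⁺]` commute with all `f_l⁺`, the induced module is spanned by ordered monomials in the
  `f_k⁺` and the `[f_j⁺, f_k⁺]` (`span_monomial_vacuum`), and growth diagrams of symmetric matrices,
  a form of the Robinson–Schensted–Knuth correspondence, map the monomials injectively to patterns
  and the degree to the sum of the top row (`Exponents.toPattern_injective`,
  `Exponents.rowSum_toPattern`). Neither the theorem of Poincaré, Birkhoff and Witt nor a character
  formula is needed.
-/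

open scoped Matrix

noncomputable section

namespace Parafermion

/-! ### Partial fractions and signs of products -/

open Polynomial in
/-- `lagrange_sum` for distinct nodes. -/
theorem lagrange_sum_of_injOn {K ι : Type*} [Field K] [DecidableEq ι] (t : Finset ι) (v : ι → K)
    (N : K[X]) (hN : N.Monic) (hdeg : N.natDegree = t.card) (hv : Set.InjOn v t) :
    ∑ i ∈ t, N.eval (v i) / ∏ j ∈ t.erase i, (v i - v j) = ∑ i ∈ t, v i + N.nextCoeff := by
  rcases t.eq_empty_or_nonempty with rfl | hne
  · have : N.natDegree = 0 := by simpa using hdeg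
    simp [nextCoeff, this]
  have hpos : 0 < t.card := hne.card_pos
  have hM : (Lagrange.nodal t v).Monic := Lagrange.nodal_monic
  have hMd : (Lagrange.nodal t v).natDegree = t.card := Lagrange.natDegree_nodal
  have hlt : (N - Lagrange.nodal t v).degree < t.card := by
    have h1 : N.degree = (Lagrange.nodal t v).degree := by
      rw [degree_eq_natDegree hN.ne_zero, degree_eq_natDegree hM.ne_zero, hdeg, hMd]
    have h2 := degree_sub_lt_left h1 hN.ne_zero (by rw [hN.leadingCoeff, hM.leadingCoeff])
    rwa [degree_eq_natDegree hN.ne_zero, hdeg] at h2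
  have h := Lagrange.coeff_eq_sum (s := t) (v := v) hv hlt
  have hnc : (Lagrange.nodal t v).nextCoeff = - ∑ i ∈ t, v i := by
    rw [Lagrange.nodal_eq]; exact prod_X_sub_C_nextCoeff v
  rw [nextCoeff_of_natDegree_pos (by omega), hMd] at hnc
  rw [nextCoeff_of_natDegree_pos (by omega : 0 < N.natDegree), hdeg]
  rw [coeff_sub, hnc] at h
  rw [sub_neg_eq_add, add_comm] at h
  rw [h]
  refine Finset.sum_congr rfl fun i hi => ?_
  rw [eval_sub, Lagrange.eval_nodal_at_node hi, sub_zero]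

open Polynomial in
/-- Comparison of the coefficients of `1 / x` in the partial fraction expansion of
`N / ∏ (X - v j)`. A node may occur twice provided that `N` has a double zero there; with the
convention `x / 0 = 0` such nodes contribute nothing to the sum. -/
theorem lagrange_sum {K ι : Type*} [Field K] [DecidableEq ι] (t : Finset ι) (v : ι → K)
    (N : K[X]) (hN : N.Monic) (hdeg : N.natDegree = t.card)
    (h3 : ∀ i ∈ t, ∀ j ∈ t, ∀ k ∈ t, i ≠ j → i ≠ k → j ≠ k → v i = v j → v i ≠ v k)
    (h2 : ∀ i ∈ t, ∀ j ∈ t, i ≠ j → v i = v j → (X - C (v i)) ^ 2 ∣ N) :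
    ∑ i ∈ t, N.eval (v i) / ∏ j ∈ t.erase i, (v i - v j) = ∑ i ∈ t, v i + N.nextCoeff := by
  induction h : t.card using Nat.strong_induction_on generalizing t N with
  | _ c ih =>
  by_cases hv : Set.InjOn v t
  · exact lagrange_sum_of_injOn t v N hN hdeg hv
  · -- a double node `v i = v j` contributes nothing, and cancels against the double zero of `N`
    simp only [Set.InjOn, not_forall] at hv
    obtain ⟨i, hi, j, hj, hij, hne⟩ := hv
    simp only [Finset.mem_coe] at hi hj
    obtain ⟨N', hN'⟩ := h2 i hi j hj hne hij
    have hsq : ((X - C (v i)) ^ 2).Monic := (monic_X_sub_C (v i)).pow 2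
    have hN'm : N'.Monic := hsq.of_mul_monic_left (hN' ▸ hN)
    have hji : j ∈ t.erase i := Finset.mem_erase.2 ⟨Ne.symm hne, hj⟩
    have hcard : ((t.erase i).erase j).card + 2 = t.card := by
      rw [Finset.card_erase_of_mem hji, Finset.card_erase_of_mem hi]
      have : 1 < t.card := Finset.one_lt_card.2 ⟨i, hi, j, hj, hne⟩
      omega
    have hd : N'.natDegree + 2 = N.natDegree := by
      rw [hN', hsq.natDegree_mul hN'm, (monic_X_sub_C (v i)).natDegree_pow, natDegree_X_sub_C]
      ring
    have hsub : ∀ k ∈ (t.erase i).erase j, k ∈ t ∧ k ≠ i ∧ k ≠ j := by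
      intro k hk
      simp only [Finset.mem_erase] at hk
      exact ⟨hk.2.2, hk.2.1, hk.1⟩
    have hvk : ∀ k ∈ (t.erase i).erase j, v i ≠ v k := by
      intro k hk
      obtain ⟨a, b, c⟩ := hsub k hk
      exact h3 i hi j hj k a hne b.symm c.symm hij
    have hind := ih ((t.erase i).erase j).card (by omega) ((t.erase i).erase j) N' hN'm (by omega)
      (fun a ha b hb c hc => h3 a (hsub a ha).1 b (hsub b hb).1 c (hsub c hc).1)
      (by
        intro a ha b hb hab hvab
        have hdv := h2 a (hsub a ha).1 b (hsub b hb).1 hab hvab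
        rw [hN'] at hdv
        refine IsCoprime.dvd_of_dvd_mul_left ?_ hdv
        exact (isCoprime_X_sub_C_of_isUnit_sub
          (sub_ne_zero.2 (hvk a ha).symm).isUnit).pow) rfl
    rw [← Finset.add_sum_erase t _ hi, ← Finset.add_sum_erase _ _ hji,
      ← Finset.add_sum_erase t v hi, ← Finset.add_sum_erase _ v hji]
    have e1 : ∏ k ∈ t.erase i, (v i - v k) = 0 :=
      Finset.prod_eq_zero hji (by rw [hij, sub_self])
    have e2 : ∏ k ∈ t.erase j, (v j - v k) = 0 :=
      Finset.prod_eq_zero (Finset.mem_erase.2 ⟨hne, hi⟩) (by rw [hij, sub_self])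
    have e3 : ∀ k ∈ (t.erase i).erase j, N.eval (v k) / ∏ l ∈ t.erase k, (v k - v l) =
        N'.eval (v k) / ∏ l ∈ ((t.erase i).erase j).erase k, (v k - v l) := by
      intro k hk
      obtain ⟨a, b, c⟩ := hsub k hk
      have hik : i ∈ t.erase k := Finset.mem_erase.2 ⟨b.symm, hi⟩
      have hjk : j ∈ (t.erase k).erase i := Finset.mem_erase.2 ⟨Ne.symm hne,
        Finset.mem_erase.2 ⟨c.symm, hj⟩⟩
      rw [← Finset.mul_prod_erase _ _ hik, ← Finset.mul_prod_erase _ _ hjk, hN', eval_mul,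
        ← hij, ← mul_assoc, ← sq, eval_pow, eval_sub, eval_X, eval_C,
        Finset.erase_right_comm (s := t.erase i), Finset.erase_right_comm (s := t) (a := i)]
      exact mul_div_mul_left _ _ (pow_ne_zero 2 (sub_ne_zero.2 (hvk k hk).symm))
    rw [e1, e2, Finset.sum_congr rfl e3, hind, hN', hsq.nextCoeff_mul hN'm,
      (monic_X_sub_C (v i)).nextCoeff_pow, nextCoeff_X_sub_C, ← hij]
    simp only [div_zero, nsmul_eq_mul]
    push_cast
    ring

/-- The case of `lagrange_sum` in which the nodes are `x a` and `x a - 1` for `a ∈ s`. -/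
theorem lagrange_sum_pairs {K : Type*} [Field K] [CharZero K] (s : Finset ℕ) (x : ℕ → K)
    (hx : Set.InjOn x s) (N : Polynomial K) (hN : N.Monic) (hdeg : N.natDegree = 2 * s.card)
    (h2 : ∀ i ∈ s, ∀ j ∈ s, x i = x j - 1 →
      (Polynomial.X - Polynomial.C (x i)) ^ 2 ∣ N) :
    ∑ i ∈ s, (N.eval (x i) / ∏ a ∈ s.erase i, ((x i - x a) * (x i - x a + 1))
      - N.eval (x i - 1) / ∏ a ∈ s.erase i, ((x i - 1 - x a) * (x i - 1 - x a + 1))) =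
      ∑ i ∈ s, (2 * x i - 1) + N.nextCoeff := by
  classical
  let v : ℕ × Bool → K := fun q => if q.2 then x q.1 - 1 else x q.1
  have key := lagrange_sum (s ×ˢ (Finset.univ : Finset Bool)) v N hN
    (by simp [hdeg, mul_comm])
    (by
      rintro ⟨i, bi⟩ hi ⟨j, bj⟩ hj ⟨k, bk⟩ hk hij hik hjk h1 h2
      simp only [Finset.mem_product, Finset.mem_univ, and_true] at hi hj hk
      have hw : ∀ a ∈ s, ∀ b ∈ s, x a = x b → a = b := fun a ha b hb h => hx ha hb h
      cases bi <;> cases bj <;> cases bk <;> simp [v] at h1 h2 hij hik hjk <;>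
        first
        | exact hij (hw _ hi _ hj (by first | linear_combination h1))
        | exact hik (hw _ hi _ hk (by first | linear_combination h2))
        | exact hjk (hw _ hj _ hk (by first | linear_combination h2 - h1)))
    (by
      rintro ⟨i, bi⟩ hi ⟨j, bj⟩ hj hij h1
      simp only [Finset.mem_product, Finset.mem_univ, and_true] at hi hj
      have hw : ∀ a ∈ s, ∀ b ∈ s, x a = x b → a = b := fun a ha b hb h => hx ha hb h
      cases bi <;> cases bj <;> simp [v] at h1 hij
      · exact absurd (hw _ hi _ hj h1) hij
      · simpa [v] using h2 i hi j hj h1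
      · have := h2 j hj i hi h1.symm
        simpa [v, h1] using this
      · exact absurd (hw _ hi _ hj h1) hij)
  have hprod : ∀ i ∈ s, ∀ b : Bool,
      ∏ q ∈ (s ×ˢ (Finset.univ : Finset Bool)).erase (i, b), (v (i, b) - v q) =
        (v (i, b) - v (i, !b)) * ∏ a ∈ s.erase i, ((v (i, b) - x a) * (v (i, b) - x a + 1)) := by
    intro i hi b
    have hmem : (i, !b) ∈ (s ×ˢ (Finset.univ : Finset Bool)).erase (i, b) := by
      simp [hi]
    rw [← Finset.mul_prod_erase _ _ hmem]
    congr 1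
    have : ((s ×ˢ (Finset.univ : Finset Bool)).erase (i, b)).erase (i, !b) =
        (s.erase i) ×ˢ (Finset.univ : Finset Bool) := by
      ext ⟨a, c⟩
      simp only [Finset.mem_erase, Finset.mem_product, Finset.mem_univ, and_true, ne_eq,
        Prod.mk.injEq]
      cases b <;> cases c <;> simp
    rw [this, Finset.prod_product]
    refine Finset.prod_congr rfl fun a _ => ?_
    simp [v]
    ring
  rw [Finset.sum_product, Finset.sum_product] at key
  rw [show ∑ i ∈ s, (2 * x i - 1) = ∑ i ∈ s, ∑ b : Bool, v (i, b) from
    Finset.sum_congr rfl fun i _ => by simp [v]; ring, ← key]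
  refine Finset.sum_congr rfl fun i hi => ?_
  rw [Fintype.sum_bool, hprod i hi, hprod i hi]
  simp [v]
  rw [div_neg]
  ring

/-- The sign of a product whose first `i` factors are positive and whose other factors are
negative. -/
theorem sign_prod_Icc (f : ℕ → ℝ) (i K : ℕ) (hi : i ≤ K) (h1 : ∀ a, 1 ≤ a → a ≤ i → 0 < f a)
    (h2 : ∀ a, i < a → a ≤ K → f a < 0) : 0 < (-1 : ℝ) ^ (K - i) * ∏ a ∈ Finset.Icc 1 K, f a := by
  induction K, hi using Nat.le_induction with
  | base =>
    simp only [Nat.sub_self, pow_zero, one_mul]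
    exact Finset.prod_pos fun a ha => h1 a (Finset.mem_Icc.1 ha).1 (Finset.mem_Icc.1 ha).2
  | succ K hK ih =>
    rw [Finset.prod_Icc_succ_top (by omega), Nat.succ_sub hK, pow_succ]
    have := ih fun a ha hb => h2 a ha (by omega)
    have h3 := h2 (K + 1) (by omega) le_rfl
    nlinarith [mul_pos this (neg_pos.2 h3)]

theorem sign_prod_erase (f : ℕ → ℝ) (i K : ℕ) (hi0 : 1 ≤ i) (hi : i ≤ K)
    (h1 : ∀ a, 1 ≤ a → a < i → 0 < f a) (h2 : ∀ a, i < a → a ≤ K → f a < 0) :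
    0 < (-1 : ℝ) ^ (K - i) * ∏ a ∈ (Finset.Icc 1 K).erase i, f a := by
  have := sign_prod_Icc (Function.update f i 1) i K hi
    (fun a ha hb => by
      rcases eq_or_ne a i with rfl | h
      · simp
      · simpa [h] using h1 a ha (by omega))
    (fun a ha hb => by
      have h : a ≠ i := by omega
      simpa [h] using h2 a ha hb)
  rw [← Finset.mul_prod_erase _ _ (Finset.mem_Icc.2 ⟨hi0, hi⟩)] at this
  rw [Function.update_self, one_mul] at this
  rwa [Finset.prod_congr rfl (g := f) fun a ha => by
    simp [Finset.ne_of_mem_erase ha]] at this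

/-! ### Patterns as integer arrays -/

/-- The integer arrays that are the entries of a Gelfand–Zetlin pattern. -/
structure IsGZ (n : ℕ) (e : ℕ → ℕ → ℤ) : Prop where
  zeros : ∀ i j, ¬ (1 ≤ i ∧ i ≤ j ∧ j ≤ n) → e i j = 0
  nonneg : ∀ i j, 0 ≤ e i j
  upper : ∀ i j, 1 ≤ i → i ≤ j → j < n → e i j ≤ e i (j + 1)
  lower : ∀ i j, 1 ≤ i → i ≤ j → j < n → e (i + 1) (j + 1) ≤ e i j

theorem GZPattern.isGZ {n : ℕ} (m : GZPattern n) : IsGZ n m.toInt where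
  zeros i j h := by simp [GZPattern.toInt, m.zeros i j h]
  nonneg i j := by simp [GZPattern.toInt]
  upper i j h1 h2 h3 := by simpa [GZPattern.toInt] using m.upper i j h1 h2 h3
  lower i j h1 h2 h3 := by simpa [GZPattern.toInt] using m.lower i j h1 h2 h3

theorem GZPattern.toInt_injective {n : ℕ} : Function.Injective (GZPattern.toInt (n := n)) := by
  intro m m' h
  ext i j
  have := congrFun (congrFun h i) j
  simpa [GZPattern.toInt] using this

theorem exists_toInt_eq_iff {n : ℕ} {e : ℕ → ℕ → ℤ} :
    (∃ q : GZPattern n, q.toInt = e) ↔ IsGZ n e := by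
  constructor
  · rintro ⟨q, rfl⟩
    exact q.isGZ
  · intro h
    refine ⟨⟨fun i j => (e i j).toNat, fun i j hij => by simp [h.zeros i j hij],
      fun i j h1 h2 h3 => Int.toNat_le_toNat (h.upper i j h1 h2 h3),
      fun i j h1 h2 h3 => Int.toNat_le_toNat (h.lower i j h1 h2 h3)⟩, ?_⟩
    funext i j
    simp [GZPattern.toInt, h.nonneg i j]

/-- The pattern with entries `e`. -/
def IsGZ.pattern {n : ℕ} {e : ℕ → ℕ → ℤ} (h : IsGZ n e) : GZPattern n :=
  (exists_toInt_eq_iff.2 h).choose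

@[simp]
theorem IsGZ.toInt_pattern {n : ℕ} {e : ℕ → ℕ → ℤ} (h : IsGZ n e) : h.pattern.toInt = e :=
  (exists_toInt_eq_iff.2 h).choose_spec

section ket

variable {n : ℕ} {W : Type*} [AddCommGroup W]

theorem ket_of_isGZ (b : GZPattern n → W) {e : ℕ → ℕ → ℤ} (h : IsGZ n e) :
    ket b e = b h.pattern := by
  unfold ket
  rw [dif_pos (exists_toInt_eq_iff.2 h)]
  rfl

theorem ket_of_not_isGZ (b : GZPattern n → W) {e : ℕ → ℕ → ℤ} (h : ¬ IsGZ n e) :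
    ket b e = 0 := by
  unfold ket
  rw [dif_neg (fun h' => h (exists_toInt_eq_iff.1 h'))]

@[simp]
theorem ket_toInt (b : GZPattern n → W) (m : GZPattern n) : ket b m.toInt = b m := by
  rw [ket_of_isGZ b m.isGZ]
  exact congrArg b (GZPattern.toInt_injective m.isGZ.toInt_pattern)

open Classical in
theorem ket_patternVec_apply (e : ℕ → ℕ → ℤ) (m : GZPattern n) :
    (ket patternVec e : PatternSpace n) m = if m.toInt = e then 1 else 0 := by
  by_cases h : IsGZ n e
  · rw [ket_of_isGZ _ h, patternVec, Finsupp.single_apply]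
    refine if_congr ⟨?_, ?_⟩ rfl rfl
    · rintro rfl; simp
    · rintro rfl; exact GZPattern.toInt_injective (by simp)
  · rw [ket_of_not_isGZ _ h, if_neg]
    · rfl
    · rintro rfl; exact h m.isGZ

end ket

/-! ### Entries of shifted patterns -/

theorem shiftAt_apply (i k : ℕ) (c : ℤ) (e : ℕ → ℕ → ℤ) (a r : ℕ) :
    shiftAt i k c e a r = e a r + if a = i ∧ r = k then c else 0 := by
  unfold shiftAt
  split_ifs <;> simp

theorem ell_shiftAt (i k : ℕ) (c : ℤ) (e : ℕ → ℕ → ℤ) (a r : ℕ) :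
    ell (shiftAt i k c e) a r = ell e a r + if a = i ∧ r = k then (c : ℝ) else 0 := by
  rw [ell, shiftAt_apply, ell]
  split_ifs <;> push_cast <;> ring

theorem shiftAt_comm (i k : ℕ) (c : ℤ) (i' k' : ℕ) (c' : ℤ) (e : ℕ → ℕ → ℤ) :
    shiftAt i k c (shiftAt i' k' c' e) = shiftAt i' k' c' (shiftAt i k c e) := by
  funext a r
  simp only [shiftAt_apply]
  ring

theorem shiftAt_shiftAt (i k : ℕ) (c c' : ℤ) (e : ℕ → ℕ → ℤ) :
    shiftAt i k c (shiftAt i k c' e) = shiftAt i k (c + c') e := by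
  funext a r
  simp only [shiftAt_apply]
  split_ifs <;> ring

@[simp]
theorem shiftAt_zero (i k : ℕ) (e : ℕ → ℕ → ℤ) : shiftAt i k 0 e = e := by
  funext a r
  simp [shiftAt_apply]

namespace IsGZ

variable {n : ℕ} {e : ℕ → ℕ → ℤ}

theorem row_antitone (h : IsGZ n e) {a b j : ℕ} (ha : 1 ≤ a) (hab : a ≤ b) (hb : b ≤ j)
    (hj : j ≤ n) : e b j ≤ e a j := by
  induction b, hab using Nat.le_induction with
  | base => exact le_rfl
  | succ b hab ih =>
    obtain ⟨j, rfl⟩ : ∃ j', j = j' + 1 := ⟨j - 1, by omega⟩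
    exact ((h.lower b j (by omega) (by omega) (by omega)).trans
      (h.upper b j (by omega) (by omega) (by omega))).trans (ih (by omega))

theorem le_above (h : IsGZ n e) {a b j : ℕ} (ha : 1 ≤ a) (hab : a ≤ b) (hb : b ≤ j)
    (hj : j < n) : e b j ≤ e a (j + 1) :=
  (h.upper b j (by omega) hb hj).trans (h.row_antitone ha hab (by omega) hj)

theorem above_le (h : IsGZ n e) {a b j : ℕ} (ha : 1 ≤ a) (hab : a < b) (hb : b ≤ j + 1)
    (hj : j < n) : e b (j + 1) ≤ e a j := by
  exact (h.row_antitone (by omega) hab hb hj).trans (h.lower a j ha (by omega) hj)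

theorem row_strict (h : IsGZ n e) {a b j : ℕ} (ha : 1 ≤ a) (hab : a < b) (hb : b ≤ j)
    (hj : j ≤ n) : ell e b j + (b - a) ≤ ell e a j := by
  have : (e b j : ℝ) ≤ e a j := by exact_mod_cast h.row_antitone ha hab.le hb hj
  unfold ell
  linarith

theorem ell_lt (h : IsGZ n e) {a b j : ℕ} (ha : 1 ≤ a) (hab : a < b) (hb : b ≤ j)
    (hj : j ≤ n) : ell e b j < ell e a j := by
  have := h.row_strict ha hab hb hj
  have h2 : (a : ℝ) < b := by exact_mod_cast hab
  linarith

theorem ell_injOn (h : IsGZ n e) {j : ℕ} (hj : j ≤ n) :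
    Set.InjOn (fun a => ell e a j) (Finset.Icc 1 j : Finset ℕ) := by
  intro a ha b hb hab
  simp only [Finset.coe_Icc, Set.mem_Icc] at ha hb hab
  rcases lt_trichotomy a b with hlt | rfl | hlt
  · exact absurd hab (h.ell_lt ha.1 hlt hb.2 hj).ne'
  · rfl
  · exact absurd hab (h.ell_lt hb.1 hlt ha.2 hj).ne

/-- An entry of a pattern can be raised if it is smaller than its two upper neighbours. -/
theorem raise_iff (h : IsGZ n e) {i k : ℕ} (hi : 1 ≤ i) (hik : i ≤ k) (hk : k ≤ n) :
    IsGZ n (shiftAt i k 1 e) ↔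
      (k < n → e i k < e i (k + 1)) ∧ (1 < i → e i k < e (i - 1) (k - 1)) := by
  constructor
  · intro h'
    refine ⟨fun hkn => ?_, fun h1 => ?_⟩
    · have := h'.upper i k hi hik hkn
      simp [shiftAt_apply] at this
      omega
    · have := h'.lower (i - 1) (k - 1) (by omega) (by omega) (by omega)
      rw [Nat.sub_add_cancel hi, Nat.sub_add_cancel (by omega)] at this
      simp only [shiftAt_apply, and_self, if_true] at this
      rw [if_neg (by omega)] at this
      omega
  · rintro ⟨h1, h2⟩
    refine ⟨fun a r har => ?_, fun a r => ?_, fun a r ha har hr => ?_, fun a r ha har hr => ?_⟩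
    · rw [shiftAt_apply, h.zeros a r har, if_neg (by omega)]
      rfl
    · rw [shiftAt_apply]
      have := h.nonneg a r
      split_ifs <;> omega
    · have := h.upper a r ha har hr
      rw [shiftAt_apply, shiftAt_apply]
      by_cases h3 : a = i ∧ r = k
      · obtain ⟨rfl, rfl⟩ := h3
        have := h1 hr
        simp
        omega
      · rw [if_neg h3]
        split_ifs <;> omega
    · have := h.lower a r ha har hr
      rw [shiftAt_apply, shiftAt_apply]
      by_cases h3 : a + 1 = i ∧ r + 1 = k
      · obtain ⟨rfl, rfl⟩ := h3
        have := h2 (by omega)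
        simp at this ⊢
        omega
      · rw [if_neg h3]
        split_ifs <;> omega

/-- An entry of a pattern can be lowered if it is larger than its two lower neighbours; in the top
row, one of these is the entry `e (i + 1) (n + 1) = 0`. -/
theorem lower_iff (h : IsGZ n e) {i k : ℕ} (hi : 1 ≤ i) (hik : i ≤ k) (hk : k ≤ n) :
    IsGZ n (shiftAt i k (-1) e) ↔
      e (i + 1) (k + 1) < e i k ∧ (i < k → e i (k - 1) < e i k) := by
  constructor
  · intro h'
    refine ⟨?_, fun h1 => ?_⟩
    · rcases hk.lt_or_eq with hk | rfl
      · have := h'.lower i k hi hik hk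
        simp [shiftAt_apply] at this
        omega
      · have := h'.nonneg i k
        simp [shiftAt_apply] at this
        rw [h.zeros _ _ (by omega)]
        omega
    · have := h'.upper i (k - 1) hi (by omega) (by omega)
      rw [Nat.sub_add_cancel (by omega)] at this
      simp only [shiftAt_apply, and_self, if_true] at this
      rw [if_neg (by omega)] at this
      omega
  · rintro ⟨h1, h2⟩
    have h0 := h.nonneg (i + 1) (k + 1)
    refine ⟨fun a r har => ?_, fun a r => ?_, fun a r ha har hr => ?_, fun a r ha har hr => ?_⟩
    · rw [shiftAt_apply, h.zeros a r har, if_neg (by omega)]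
      rfl
    · rw [shiftAt_apply]
      have := h.nonneg a r
      split_ifs with h3
      · obtain ⟨rfl, rfl⟩ := h3
        omega
      · omega
    · have := h.upper a r ha har hr
      rw [shiftAt_apply, shiftAt_apply]
      by_cases h3 : a = i ∧ r + 1 = k
      · obtain ⟨rfl, rfl⟩ := h3
        have := h2 (by omega)
        simp at this ⊢
        omega
      · rw [if_neg h3]
        split_ifs <;> omega
    · have := h.lower a r ha har hr
      rw [shiftAt_apply, shiftAt_apply]
      by_cases h3 : a = i ∧ r = k
      · obtain ⟨rfl, rfl⟩ := h3
        simp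
        omega
      · rw [if_neg h3]
        split_ifs <;> omega

end IsGZ

/-! ### Positivity of the radicands -/

/-- The radicand of `gzCoeff`. -/
def gzRad (e : ℕ → ℕ → ℤ) (k i : ℕ) : ℝ :=
  -((∏ a ∈ Finset.Icc 1 (k + 1), (ell e a (k + 1) - ell e i k)) *
      ∏ a ∈ Finset.Icc 1 (k - 1), (ell e a (k - 1) - ell e i k - 1)) /
    ∏ a ∈ (Finset.Icc 1 k).erase i,
      ((ell e a k - ell e i k) * (ell e a k - ell e i k - 1))

theorem gzCoeff_eq (e : ℕ → ℕ → ℤ) (k i : ℕ) : gzCoeff e k i = Real.sqrt (gzRad e k i) := rfl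

/-- The radicand of `isoscalarLast`. -/
def lastRad (e : ℕ → ℕ → ℤ) (j a : ℕ) : ℝ :=
  (∏ k ∈ Finset.Icc 1 (j - 1), (ell e k (j - 1) - ell e a j - 1)) /
    ∏ k ∈ (Finset.Icc 1 j).erase a, (ell e k j - ell e a j)

theorem isoscalarLast_eq (e : ℕ → ℕ → ℤ) (j a : ℕ) :
    isoscalarLast e j a = Real.sqrt (lastRad e j a) := rfl

theorem sub_one_mul_pow_pos {x y : ℝ} {r : ℕ} (hx : 0 < (-1 : ℝ) ^ r * x)
    (hy : 0 < (-1 : ℝ) ^ r * y) : 0 < x / y := by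
  have h1 : ((-1 : ℝ) ^ r) ≠ 0 := pow_ne_zero _ (by norm_num)
  have := div_pos hx hy
  rwa [mul_div_mul_left _ _ h1] at this

section radicands

variable {n : ℕ} {e : ℕ → ℕ → ℤ}

theorem IsGZ.ell_le_above (h : IsGZ n e) {a b j : ℕ} (ha : 1 ≤ a) (hab : a ≤ b) (hb : b ≤ j)
    (hj : j < n) : ell e b j + (b - a) ≤ ell e a (j + 1) := by
  have : (e b j : ℝ) ≤ e a (j + 1) := by exact_mod_cast h.le_above ha hab hb hj
  unfold ell
  linarith

theorem IsGZ.ell_above_le (h : IsGZ n e) {a b j : ℕ} (ha : 1 ≤ a) (hab : a < b) (hb : b ≤ j + 1)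
    (hj : j < n) : ell e b (j + 1) + (b - a) ≤ ell e a j := by
  have : (e b (j + 1) : ℝ) ≤ e a j := by exact_mod_cast h.above_le ha hab hb hj
  unfold ell
  linarith

theorem sign_prod_below (h : IsGZ n e) {j a : ℕ} (ha : 1 ≤ a) (haj : a ≤ j) (hj : j ≤ n)
    (h1 : 1 < a → e a j < e (a - 1) (j - 1)) :
    0 < (-1 : ℝ) ^ (j - a) * ∏ k ∈ Finset.Icc 1 (j - 1), (ell e k (j - 1) - ell e a j - 1) := by
  have := sign_prod_Icc (fun k => ell e k (j - 1) - ell e a j - 1) (a - 1) (j - 1) (by omega)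
    (fun k hk hka => by
      obtain ⟨j, rfl⟩ : ∃ j', j = j' + 1 := ⟨j - 1, by omega⟩
      have h2 : e a (j + 1) + 1 ≤ e k j := by
        have h3 := h1 (by omega)
        have h4 := h.row_antitone hk hka (j := j) (by omega) (by omega)
        simp only [Nat.add_sub_cancel] at h3
        omega
      have h3 : (e a (j + 1) : ℝ) + 1 ≤ e k j := by exact_mod_cast h2
      have h4 : (k : ℝ) + 1 ≤ a := by exact_mod_cast (by omega : k + 1 ≤ a)
      simp only [ell, Nat.add_sub_cancel]
      linarith)
    (fun k hk hka => by
      obtain ⟨j, rfl⟩ : ∃ j', j = j' + 1 := ⟨j - 1, by omega⟩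
      have := h.ell_le_above (a := a) (b := k) (j := j) ha (by omega) (by omega) (by omega)
      have h4 : (a : ℝ) ≤ k := by exact_mod_cast (by omega : a ≤ k)
      simp only [Nat.add_sub_cancel]
      linarith)
  rwa [show j - 1 - (a - 1) = j - a by omega] at this

theorem prod_below_eq_zero {j a : ℕ} (haj : a ≤ j) (h1 : 1 < a)
    (h2 : e a j = e (a - 1) (j - 1)) :
    ∏ k ∈ Finset.Icc 1 (j - 1), (ell e k (j - 1) - ell e a j - 1) = 0 := by
  refine Finset.prod_eq_zero (i := a - 1) (Finset.mem_Icc.2 ⟨by omega, by omega⟩) ?_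
  rw [ell, ell, h2, Nat.cast_sub h1.le]
  push_cast
  ring

theorem lastRad_pos (h : IsGZ n e) {j a : ℕ} (ha : 1 ≤ a) (haj : a ≤ j) (hj : j ≤ n)
    (h1 : 1 < a → e a j < e (a - 1) (j - 1)) : 0 < lastRad e j a := by
  refine sub_one_mul_pow_pos (sign_prod_below h ha haj hj h1) (sign_prod_erase _ a j ha haj
    (fun k hk hka => ?_) (fun k hk hka => ?_))
  · exact sub_pos.2 (h.ell_lt hk hka haj hj)
  · exact sub_neg.2 (h.ell_lt ha hk hka hj)

theorem lastRad_eq_zero {j a : ℕ} (haj : a ≤ j) (h1 : 1 < a)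
    (h2 : e a j = e (a - 1) (j - 1)) : lastRad e j a = 0 := by
  rw [lastRad, prod_below_eq_zero haj h1 h2, zero_div]

theorem lastRad_nonneg (h : IsGZ n e) {j a : ℕ} (ha : 1 ≤ a) (haj : a ≤ j) (hj : j ≤ n) :
    0 ≤ lastRad e j a := by
  by_cases h1 : 1 < a → e a j < e (a - 1) (j - 1)
  · exact (lastRad_pos h ha haj hj h1).le
  · push Not at h1
    obtain ⟨h1, h2⟩ := h1
    refine (lastRad_eq_zero haj h1 (le_antisymm ?_ h2)).ge
    have := h.above_le (a := a - 1) (b := a) (j := j - 1) (by omega) (by omega) (by omega)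
      (by omega)
    rwa [Nat.sub_add_cancel (by omega)] at this

theorem gzRad_pos (h : IsGZ n e) {k i : ℕ} (hi : 1 ≤ i) (hik : i ≤ k) (hk : k < n)
    (h0 : e i k < e i (k + 1)) (h1 : 1 < i → e i k < e (i - 1) (k - 1)) : 0 < gzRad e k i := by
  have hA := sign_prod_Icc (fun a => ell e a (k + 1) - ell e i k) i (k + 1) (by omega)
    (fun a ha hai => by
      have h2 : e i k + 1 ≤ e a (k + 1) :=
        (Int.add_one_le_of_lt h0).trans (h.row_antitone ha hai (by omega) hk)
      have h3 : (e i k : ℝ) + 1 ≤ e a (k + 1) := by exact_mod_cast h2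
      have h4 : (a : ℝ) ≤ i := by exact_mod_cast hai
      simp only [ell]
      linarith)
    (fun a ha hai => by
      have := h.ell_above_le hi ha hai hk
      have h4 : (i : ℝ) < a := by exact_mod_cast ha
      linarith)
  have hB := sign_prod_below h hi hik hk.le h1
  have hC : 0 < ∏ a ∈ (Finset.Icc 1 k).erase i,
      ((ell e a k - ell e i k) * (ell e a k - ell e i k - 1)) := by
    refine Finset.prod_pos fun a ha => ?_
    simp only [Finset.mem_erase, Finset.mem_Icc] at ha
    obtain ⟨hai, ha1, hak⟩ := ha
    rcases Nat.lt_or_gt_of_ne hai with hlt | hgt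
    · have h2 : e i k + 1 ≤ e a k := by
        have h3 := h1 (by omega)
        have h4 := h.row_antitone (a := a) (b := i - 1) (j := k) ha1 (by omega) (by omega) hk.le
        have h5 := h.upper (i - 1) (k - 1) (by omega) (by omega) (by omega)
        rw [Nat.sub_add_cancel (by omega)] at h5
        omega
      have h3 : (e i k : ℝ) + 1 ≤ e a k := by exact_mod_cast h2
      have h4 : (a : ℝ) + 1 ≤ i := by exact_mod_cast hlt
      refine mul_pos ?_ ?_ <;> simp only [ell] <;> linarith
    · have := h.ell_lt hi hgt hak hk.le
      exact mul_pos_of_neg_of_neg (by linarith) (by linarith)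
  refine div_pos ?_ hC
  rw [show k + 1 - i = (k - i) + 1 by omega, pow_succ] at hA
  have := mul_pos hA hB
  have hs : ((-1 : ℝ) ^ (k - i)) * (-1 : ℝ) ^ (k - i) = 1 := by
    rw [← mul_pow]; norm_num
  have e1 : ∀ x y s : ℝ, s * s = 1 → s * -1 * x * (s * y) = -(x * y) := by
    intro x y s hs
    linear_combination (-(x * y)) * hs
  rwa [e1 _ _ _ hs] at this

theorem gzRad_nonneg (h : IsGZ n e) {k i : ℕ} (hi : 1 ≤ i) (hik : i ≤ k) (hk : k < n) :
    0 ≤ gzRad e k i := by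
  by_cases h0 : e i k < e i (k + 1)
  · by_cases h1 : 1 < i → e i k < e (i - 1) (k - 1)
    · exact (gzRad_pos h hi hik hk h0 h1).le
    · push Not at h1
      obtain ⟨h1, h2⟩ := h1
      have h3 := h.above_le (a := i - 1) (b := i) (j := k - 1) (by omega) (by omega) (by omega)
        (by omega)
      rw [Nat.sub_add_cancel (by omega)] at h3
      rw [gzRad, prod_below_eq_zero hik h1 (le_antisymm h3 h2)]
      simp
  · have h2 : e i (k + 1) = e i k := le_antisymm (not_lt.1 h0) (h.upper i k hi hik hk)
    have : ∏ a ∈ Finset.Icc 1 (k + 1), (ell e a (k + 1) - ell e i k) = 0 := by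
      refine Finset.prod_eq_zero (i := i) (Finset.mem_Icc.2 ⟨by omega, by omega⟩) ?_
      rw [ell, ell, h2, sub_self]
    rw [gzRad, this]
    simp

/-- The coefficient of a raised array that is not a pattern vanishes. -/
theorem gzRad_eq_zero (h : IsGZ n e) {k i : ℕ} (hi : 1 ≤ i) (hik : i ≤ k) (hk : k < n)
    (h' : ¬ IsGZ n (shiftAt i k 1 e)) : gzRad e k i = 0 := by
  rw [h.raise_iff hi hik hk.le] at h'
  by_cases h0 : e i k < e i (k + 1)
  · have h1 : ¬ (1 < i → e i k < e (i - 1) (k - 1)) := fun h1 => h' ⟨fun _ => h0, h1⟩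
    push Not at h1
    obtain ⟨h1, h2⟩ := h1
    have h3 := h.above_le (a := i - 1) (b := i) (j := k - 1) (by omega) (by omega) (by omega)
      (by omega)
    rw [Nat.sub_add_cancel (by omega)] at h3
    rw [gzRad, prod_below_eq_zero hik h1 (le_antisymm h3 h2)]
    simp
  · have h2 : e i (k + 1) = e i k := le_antisymm (not_lt.1 h0) (h.upper i k hi hik hk)
    have : ∏ a ∈ Finset.Icc 1 (k + 1), (ell e a (k + 1) - ell e i k) = 0 := by
      refine Finset.prod_eq_zero (i := i) (Finset.mem_Icc.2 ⟨by omega, by omega⟩) ?_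
      rw [ell, ell, h2, sub_self]
    rw [gzRad, this]
    simp

theorem gzRad_lower_eq_zero (h : IsGZ n e) {k i : ℕ} (hi : 1 ≤ i) (hik : i ≤ k) (hk : k < n)
    (h' : ¬ IsGZ n (shiftAt i k (-1) e)) : gzRad (shiftAt i k (-1) e) k i = 0 := by
  rw [h.lower_iff hi hik hk.le] at h'
  by_cases h0 : e (i + 1) (k + 1) < e i k
  · have h1 : ¬ (i < k → e i (k - 1) < e i k) := fun h1 => h' ⟨h0, h1⟩
    push Not at h1
    obtain ⟨h1, h2⟩ := h1
    have h3 := h.upper i (k - 1) hi (by omega) (by omega)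
    rw [Nat.sub_add_cancel (by omega)] at h3
    have : ∏ a ∈ Finset.Icc 1 (k - 1), (ell (shiftAt i k (-1) e) a (k - 1) -
        ell (shiftAt i k (-1) e) i k - 1) = 0 := by
      refine Finset.prod_eq_zero (i := i) (Finset.mem_Icc.2 ⟨by omega, by omega⟩) ?_
      rw [ell_shiftAt, ell_shiftAt, if_neg (by omega), if_pos ⟨rfl, rfl⟩, ell, ell,
        le_antisymm h3 h2]
      push_cast
      ring
    rw [gzRad, this]
    simp
  · have h2 := le_antisymm (not_lt.1 h0) (h.lower i k hi hik hk)
    have : ∏ a ∈ Finset.Icc 1 (k + 1), (ell (shiftAt i k (-1) e) a (k + 1) -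
        ell (shiftAt i k (-1) e) i k) = 0 := by
      refine Finset.prod_eq_zero (i := i + 1) (Finset.mem_Icc.2 ⟨by omega, by omega⟩) ?_
      rw [ell_shiftAt, ell_shiftAt, if_neg (by omega), if_pos ⟨rfl, rfl⟩, ell, ell, h2]
      push_cast
      ring
    rw [gzRad, this]
    simp

end radicands

/-! ### The radicands of the top row -/

/-- The indices of the entries of row `n` whose parity is that of `i`. -/
def sameParity (n i : ℕ) : Finset ℕ := (Finset.Icc 1 n).filter fun j => (Even j ↔ Even i)

/-- The linear factor in the numerator of `R_i`, as a function of `l_{in}`. -/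
def linFactor (n i : ℕ) (x : ℝ) : ℝ := if (Even n ↔ Even i) then x + n + 1 else 1

/-- The sign in front of `R_i`. -/
def paritySign (i : ℕ) : ℝ := if Even i then -1 else 1

/-- The radicand `R_i` of the reduced matrix element without the factor `p - m_{in} + i - 1`. -/
def redRad (n : ℕ) (e : ℕ → ℕ → ℤ) (i : ℕ) : ℝ :=
  paritySign i * (linFactor n i (ell e i n) *
      ∏ j ∈ (Finset.Icc 1 n).erase i, (ell e i n - ell e j n)) /
    ∏ j ∈ (sameParity n i).erase i, ((ell e i n - ell e j n) * (ell e i n - ell e j n + 1))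

/-- The product of the radicand of the isoscalar factor for `u(n)` and of `R_i`, after the
cancellation of common factors. Entries of row `n` of opposite parities do not interact. -/
def topRad (n : ℕ) (e : ℕ → ℕ → ℤ) (i : ℕ) : ℝ :=
  paritySign i * ((∏ a ∈ Finset.Icc 1 (n - 1), (ell e i n + 1 - ell e a (n - 1))) *
      linFactor n i (ell e i n)) /
    ∏ j ∈ (sameParity n i).erase i, ((ell e i n - ell e j n) * (ell e i n - ell e j n + 1))

theorem mem_sameParity {n i j : ℕ} : j ∈ sameParity n i ↔ (1 ≤ j ∧ j ≤ n) ∧ (Even j ↔ Even i) := by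
  simp [sameParity]

theorem radicandEven_eq (n k : ℕ) (e : ℕ → ℕ → ℤ) (hk : Even k) :
    radicandEven n k (fun i => e i n) = redRad n e k := by
  obtain ⟨k, rfl⟩ := hk
  rw [radicandEven, redRad, ← neg_div]
  have hk2 : Even (k + k) := ⟨k, rfl⟩
  congr 1
  · rw [paritySign, if_pos hk2, neg_one_mul]
    congr 2
    · rw [linFactor, evenInd]
      by_cases hn : Even n
      · simp only [hn, hk2, if_true, ell]
        ring
      · simp only [hn, hk2, if_false]
        norm_num
    · refine Finset.prod_congr rfl fun j _ => ?_
      simp only [ell]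
      ring
  · refine Finset.prod_bij (fun j _ => 2 * j) ?_ ?_ ?_ ?_
    · intro j hj
      simp only [Finset.mem_erase, Finset.mem_Icc, mem_sameParity] at hj ⊢
      refine ⟨by omega, by omega, ?_⟩
      simp [hk2]
    · intro a _ b _ h
      simpa using h
    · intro b hb
      simp only [Finset.mem_erase, mem_sameParity, hk2, iff_true] at hb
      obtain ⟨hb1, hb2, c, rfl⟩ := hb
      refine ⟨c, ?_, by ring⟩
      simp only [Finset.mem_erase, Finset.mem_Icc]
      omega
    · intro j _
      simp only [ell]
      push_cast
      ring

theorem radicandOdd_eq (n k : ℕ) (e : ℕ → ℕ → ℤ) (hk : Odd k) :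
    radicandOdd n k (fun i => e i n) = redRad n e k := by
  obtain ⟨k, rfl⟩ := hk
  rw [radicandOdd, redRad]
  have hk2 : ¬ Even (2 * k + 1) := by simp
  congr 1
  · rw [paritySign, if_neg hk2, one_mul]
    congr 1
    · rw [linFactor, oddInd]
      by_cases hn : Even n
      · simp only [hn, hk2, if_false, Nat.not_odd_iff_even.2 hn]
        norm_num
      · simp only [hn, hk2, Nat.not_even_iff_odd.1 hn, if_true, ell]
        ring
    · refine Finset.prod_congr rfl fun j _ => ?_
      simp only [ell]
      ring
  · refine Finset.prod_bij (fun j _ => 2 * j - 1) ?_ ?_ ?_ ?_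
    · intro j hj
      simp only [Finset.mem_erase, Finset.mem_Icc, mem_sameParity] at hj ⊢
      refine ⟨by omega, by omega, ?_⟩
      simp only [hk2, iff_false, Nat.not_even_iff_odd]
      exact ⟨j - 1, by omega⟩
    · intro a ha b hb h
      simp only [Finset.mem_erase, Finset.mem_Icc] at ha hb
      omega
    · intro b hb
      simp only [Finset.mem_erase, mem_sameParity, hk2, iff_false, Nat.not_even_iff_odd] at hb
      obtain ⟨hb1, hb2, c, rfl⟩ := hb
      refine ⟨c + 1, ?_, by omega⟩
      simp only [Finset.mem_erase, Finset.mem_Icc]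
      omega
    · intro j hj
      simp only [Finset.mem_erase, Finset.mem_Icc] at hj
      obtain ⟨j, rfl⟩ : ∃ j', j = j' + 1 := ⟨j - 1, by omega⟩
      simp only [ell, show 2 * (j + 1) - 1 = 2 * j + 1 by omega]
      push_cast
      ring

section

variable {n : ℕ} {e : ℕ → ℕ → ℤ}

theorem linFactor_pos (h : IsGZ n e) {i : ℕ} (hi : i ≤ n) : 0 < linFactor n i (ell e i n) := by
  rw [linFactor]
  split_ifs
  · have h1 : (0 : ℝ) ≤ e i n := by exact_mod_cast h.nonneg i n
    have h2 : (i : ℝ) ≤ n := by exact_mod_cast hi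
    rw [ell]
    linarith
  · exact one_pos

/-- Two entries of the same parity in a row differ by at least two. -/
theorem IsGZ.ell_sameParity (h : IsGZ n e) {a b j : ℕ} (ha : 1 ≤ a) (hab : a < b) (hb : b ≤ j)
    (hj : j ≤ n) (hpar : Even b ↔ Even a) : ell e b j + 2 ≤ ell e a j := by
  have h1 := h.row_strict ha hab hb hj
  have h2 : a + 2 ≤ b := by
    rcases Nat.eq_or_lt_of_le hab with rfl | h'
    · exact absurd hpar (by by_cases h : Even a <;> simp [Nat.even_add_one, h])
    · omega
  have h3 : (a : ℝ) + 2 ≤ b := by exact_mod_cast h2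
  linarith

theorem prod_sameParity_pos (h : IsGZ n e) {i : ℕ} (hi : 1 ≤ i) (hin : i ≤ n) :
    0 < ∏ j ∈ (sameParity n i).erase i,
      ((ell e i n - ell e j n) * (ell e i n - ell e j n + 1)) := by
  refine Finset.prod_pos fun j hj => ?_
  simp only [Finset.mem_erase, mem_sameParity] at hj
  obtain ⟨hji, ⟨hj1, hjn⟩, hpar⟩ := hj
  rcases Nat.lt_or_gt_of_ne hji with hlt | hgt
  · have := h.ell_sameParity hj1 hlt hin le_rfl hpar.symm
    exact mul_pos_of_neg_of_neg (by linarith) (by linarith)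
  · have := h.ell_sameParity hi hgt hjn le_rfl hpar
    exact mul_pos (by linarith) (by linarith)

theorem prod_sub_comm (s : Finset ℕ) (f g : ℕ → ℝ) :
    ∏ j ∈ s, (f j - g j) = (-1) ^ s.card * ∏ j ∈ s, (g j - f j) := by
  rw [← Finset.prod_const, ← Finset.prod_mul_distrib]
  exact Finset.prod_congr rfl fun j _ => by ring

theorem paritySign_eq (i : ℕ) (hi : 1 ≤ i) : paritySign i = (-1) ^ (i - 1) := by
  obtain ⟨i, rfl⟩ : ∃ i', i = i' + 1 := ⟨i - 1, by omega⟩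
  rw [paritySign, Nat.add_sub_cancel]
  by_cases hi : Even i
  · simp [Nat.even_add_one, hi]
  · simp [Nat.even_add_one, hi, (Nat.not_even_iff_odd.1 hi).neg_one_pow]

theorem redRad_pos (h : IsGZ n e) {i : ℕ} (hi : 1 ≤ i) (hin : i ≤ n) : 0 < redRad n e i := by
  refine div_pos ?_ (prod_sameParity_pos h hi hin)
  have h1 := sign_prod_erase (fun j => ell e j n - ell e i n) i n hi hin
    (fun k hk hka => sub_pos.2 (h.ell_lt hk hka hin le_rfl))
    (fun k hk hka => sub_neg.2 (h.ell_lt hi hk hka le_rfl))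
  have h2 : ((Finset.Icc 1 n).erase i).card = n - 1 := by
    rw [Finset.card_erase_of_mem (Finset.mem_Icc.2 ⟨hi, hin⟩), Nat.card_Icc, Nat.add_sub_cancel]
  rw [prod_sub_comm, h2, paritySign_eq i hi]
  have h3 := mul_pos (linFactor_pos h hin) h1
  have h4 : (-1 : ℝ) ^ (i - 1) * (-1) ^ (n - 1) = (-1) ^ (n - i) := by
    rw [show n - 1 = (n - i) + (i - 1) by omega, pow_add, mul_left_comm, ← mul_pow]
    norm_num
  calc (0 : ℝ) < _ := h3
    _ = _ := by rw [← h4]; ring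

theorem topRad_eq (h : IsGZ n e) {i : ℕ} (hi : 1 ≤ i) (hin : i ≤ n) :
    topRad n e i = lastRad e n i * redRad n e i := by
  have h1 : ∏ j ∈ (Finset.Icc 1 n).erase i, (ell e j n - ell e i n) ≠ 0 := by
    refine Finset.prod_ne_zero_iff.2 fun j hj => ?_
    simp only [Finset.mem_erase, Finset.mem_Icc] at hj
    refine sub_ne_zero.2 fun hh => hj.1 (h.ell_injOn le_rfl ?_ ?_ hh)
    · simpa using hj.2
    · simp [hi, hin]
  have h2 : ((Finset.Icc 1 n).erase i).card = n - 1 := by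
    rw [Finset.card_erase_of_mem (Finset.mem_Icc.2 ⟨hi, hin⟩), Nat.card_Icc, Nat.add_sub_cancel]
  rw [topRad, lastRad, redRad, prod_sub_comm ((Finset.Icc 1 n).erase i) (fun _ => ell e i n), h2]
  have h3 : ∏ a ∈ Finset.Icc 1 (n - 1), (ell e i n + 1 - ell e a (n - 1)) =
      (-1) ^ (n - 1) * ∏ a ∈ Finset.Icc 1 (n - 1), (ell e a (n - 1) - ell e i n - 1) := by
    rw [prod_sub_comm]
    congr 1
    · simp
    · exact Finset.prod_congr rfl fun _ _ => by ring
  rw [h3]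
  field_simp

theorem topRad_nonneg (h : IsGZ n e) {i : ℕ} (hi : 1 ≤ i) (hin : i ≤ n) : 0 ≤ topRad n e i := by
  rw [topRad_eq h hi hin]
  exact mul_nonneg (lastRad_nonneg h hi hin le_rfl) (redRad_pos h hi hin).le

theorem topRad_pos (h : IsGZ n e) {i : ℕ} (hi : 1 ≤ i) (hin : i ≤ n)
    (h' : IsGZ n (shiftAt i n 1 e)) : 0 < topRad n e i := by
  rw [topRad_eq h hi hin]
  exact mul_pos (lastRad_pos h hi hin le_rfl ((h.raise_iff hi hin le_rfl).1 h').2)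
    (redRad_pos h hi hin)

theorem topRad_eq_zero (h : IsGZ n e) {i : ℕ} (hi : 1 ≤ i) (hin : i ≤ n)
    (h' : ¬ IsGZ n (shiftAt i n 1 e)) : topRad n e i = 0 := by
  rw [h.raise_iff hi hin le_rfl] at h'
  have h1 : ¬ (1 < i → e i n < e (i - 1) (n - 1)) := fun h1 => h' ⟨fun h => absurd h (by omega), h1⟩
  push Not at h1
  obtain ⟨h1, h2⟩ := h1
  have h3 := h.above_le (a := i - 1) (b := i) (j := n - 1) (by omega) (by omega) (by omega)
    (by omega)
  rw [Nat.sub_add_cancel (by omega)] at h3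
  rw [topRad_eq h hi hin, lastRad_eq_zero hin h1 (le_antisymm h3 h2), zero_mul]

theorem topRad_lower_eq_zero (h : IsGZ n e) {i : ℕ} (hi : 1 ≤ i) (hin : i ≤ n)
    (h' : ¬ IsGZ n (shiftAt i n (-1) e)) : topRad n (shiftAt i n (-1) e) i = 0 := by
  rw [h.lower_iff hi hin le_rfl, h.zeros (i + 1) (n + 1) (by omega)] at h'
  rcases hin.eq_or_lt with rfl | hlt
  · have h1 : e i i = 0 := by
      have := h.nonneg i i
      by_contra h2
      exact h' ⟨by omega, fun h => absurd h (by omega)⟩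
    have : linFactor i i (ell (shiftAt i i (-1) e) i i) = 0 := by
      rw [linFactor, if_pos Iff.rfl, ell_shiftAt, if_pos ⟨rfl, rfl⟩, ell, h1]
      push_cast
      ring
    rw [topRad, this]
    simp
  · have h1 : e i (n - 1) = e i n := by
      have h2 := h.upper i (n - 1) hi (by omega) (by omega)
      rw [Nat.sub_add_cancel (by omega)] at h2
      have h3 := h.nonneg i (n - 1)
      by_contra h4
      exact h' ⟨by omega, fun _ => by omega⟩
    have : ∏ a ∈ Finset.Icc 1 (n - 1), (ell (shiftAt i n (-1) e) i n + 1 -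
        ell (shiftAt i n (-1) e) a (n - 1)) = 0 := by
      refine Finset.prod_eq_zero (i := i) (Finset.mem_Icc.2 ⟨by omega, by omega⟩) ?_
      rw [ell_shiftAt, ell_shiftAt, if_pos ⟨rfl, rfl⟩, if_neg (by omega), ell, ell, h1]
      push_cast
      ring
    rw [topRad, this]
    simp

end

/-! ### Partial fractions: the diagonal relations -/

theorem sum_Icc_natCast (k : ℕ) : ∑ i ∈ Finset.Icc 1 k, (i : ℝ) = k * (k + 1) / 2 := by
  induction k with
  | zero => simp
  | succ k ih =>
    rw [Finset.sum_Icc_succ_top (by omega), ih]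
    push_cast
    ring

theorem sum_ell (e : ℕ → ℕ → ℤ) (k r : ℕ) : ∑ i ∈ Finset.Icc 1 k, ell e i r =
    ∑ i ∈ Finset.Icc 1 k, (e i r : ℝ) - k * (k + 1) / 2 := by
  rw [← sum_Icc_natCast, ← Finset.sum_sub_distrib]
  rfl

open Polynomial in
theorem monic_prod_X_sub_C' {K : Type*} [Field K] (s : Finset ℕ) (f : ℕ → K) :
    (∏ a ∈ s, (X - C (f a))).Monic := monic_prod_of_monic _ _ fun _ _ => monic_X_sub_C _

open Polynomial in
theorem natDegree_prod_X_sub_C' {K : Type*} [Field K] (s : Finset ℕ) (f : ℕ → K) :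
    (∏ a ∈ s, (X - C (f a))).natDegree = s.card := by
  rw [natDegree_prod_of_monic _ _ fun _ _ => monic_X_sub_C _]
  simp

open Polynomial in
/-- The diagonal of `[e_k, f_k] = h_k` below the top row: `gzRad` is, up to the sign, the residue of
a rational function whose poles are at the `l_{ik}` and the `l_{ik} - 1`. -/
theorem gzRad_sum {n : ℕ} {e : ℕ → ℕ → ℤ} (h : IsGZ n e) {k : ℕ} (hk : 1 ≤ k) (hkn : k < n) :
    ∑ i ∈ Finset.Icc 1 k, (gzRad (shiftAt i k (-1) e) k i - gzRad e k i) =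
      2 * ∑ i ∈ Finset.Icc 1 k, (e i k : ℝ) - ∑ i ∈ Finset.Icc 1 (k + 1), (e i (k + 1) : ℝ)
        - ∑ i ∈ Finset.Icc 1 (k - 1), (e i (k - 1) : ℝ) := by
  let A : ℝ[X] := ∏ a ∈ Finset.Icc 1 (k + 1), (X - C (ell e a (k + 1)))
  let B : ℝ[X] := ∏ a ∈ Finset.Icc 1 (k - 1), (X - C (ell e a (k - 1) - 1))
  have hA : A.Monic := monic_prod_X_sub_C' _ _
  have hB : B.Monic := monic_prod_X_sub_C' _ _
  have hsign : (-1 : ℝ) ^ (k + 1) * (-1) ^ (k - 1) = 1 := by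
    rw [show k + 1 = (k - 1) + 2 by omega, pow_add, mul_right_comm, ← mul_pow]
    norm_num
  have hev : ∀ x : ℝ, (A * B).eval x = (∏ a ∈ Finset.Icc 1 (k + 1), (ell e a (k + 1) - x)) *
      ∏ a ∈ Finset.Icc 1 (k - 1), (ell e a (k - 1) - x - 1) := by
    intro x
    simp only [A, B, eval_mul, eval_prod, eval_sub, eval_X, eval_C]
    rw [prod_sub_comm, prod_sub_comm _ (fun _ => x)]
    simp only [Nat.card_Icc, Nat.add_sub_cancel]
    rw [Finset.prod_congr rfl fun a _ => (sub_right_comm (ell e a (k - 1)) x 1)]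
    linear_combination (∏ a ∈ Finset.Icc 1 (k + 1), (ell e a (k + 1) - x)) *
      (∏ a ∈ Finset.Icc 1 (k - 1), (ell e a (k - 1) - 1 - x)) * hsign
  have key := lagrange_sum_pairs (Finset.Icc 1 k) (fun a => ell e a k) (h.ell_injOn hkn.le)
    (A * B) (hA.mul hB)
    (by
      rw [hA.natDegree_mul hB, natDegree_prod_X_sub_C', natDegree_prod_X_sub_C']
      simp
      omega)
    (by
      -- two poles coincide only if `m_{jk} = m_{j+1,k}`; then the interlacing conditions force an
      -- entry in each of the rows `k + 1` and `k - 1`, and the numerator has a double zero there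
      intro i hi j hj hij
      simp only [Finset.mem_Icc] at hi hj
      have hlt : j < i := by
        by_contra hle
        rcases (not_lt.1 hle).eq_or_lt with rfl | hlt
        · linarith
        · have := h.ell_lt hi.1 hlt hj.2 hkn.le
          linarith
      have h1 := h.row_strict hj.1 hlt hi.2 hkn.le
      have h2 : (i : ℝ) ≤ j + 1 := by linarith
      have h3 : i = j + 1 := by
        have : i ≤ j + 1 := by exact_mod_cast h2
        omega
      subst h3
      have h4 : e (j + 1) k = e j k := by
        have : (e (j + 1) k : ℝ) = e j k := by
          simp only [ell] at hij
          push_cast at hij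
          linarith
        exact_mod_cast this
      have h5 := h.le_above (a := j + 1) (b := j + 1) (by omega) le_rfl hi.2 hkn
      have h6 := h.above_le (a := j) (b := j + 1) hj.1 (by omega) (by omega) hkn
      have h7 := h.upper j (k - 1) hj.1 (by omega) (by omega)
      have h8 := h.lower j (k - 1) hj.1 (by omega) (by omega)
      rw [Nat.sub_add_cancel hk] at h7 h8
      rw [sq]
      refine mul_dvd_mul ?_ ?_
      · have e1 : ell e (j + 1) k = ell e (j + 1) (k + 1) := by
          rw [ell, ell, le_antisymm h5 (by omega)]
        rw [e1]
        exact Finset.dvd_prod_of_mem (fun a => X - C (ell e a (k + 1)))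
          (Finset.mem_Icc.2 ⟨by omega, by omega⟩)
      · have e1 : ell e (j + 1) k = ell e j (k - 1) - 1 := by
          rw [hij, ell, ell, le_antisymm h7 (by omega)]
        rw [e1]
        exact Finset.dvd_prod_of_mem (fun a => X - C (ell e a (k - 1) - 1))
          (Finset.mem_Icc.2 ⟨by omega, by omega⟩))
  rw [hA.nextCoeff_mul hB, prod_X_sub_C_nextCoeff, prod_X_sub_C_nextCoeff] at key
  have hL : ∀ i ∈ Finset.Icc 1 k, gzRad (shiftAt i k (-1) e) k i - gzRad e k i =
      ((A * B).eval (ell e i k) / ∏ a ∈ (Finset.Icc 1 k).erase i,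
          ((ell e i k - ell e a k) * (ell e i k - ell e a k + 1))
        - (A * B).eval (ell e i k - 1) / ∏ a ∈ (Finset.Icc 1 k).erase i,
          ((ell e i k - 1 - ell e a k) * (ell e i k - 1 - ell e a k + 1))) := by
    intro i _
    rw [hev, hev, gzRad, gzRad, neg_div, neg_div, sub_neg_eq_add, ← sub_eq_neg_add]
    congr 2
    · exact Finset.prod_congr rfl fun a _ => by ring
    · congr 1
      · refine Finset.prod_congr rfl fun a _ => ?_
        rw [ell_shiftAt, ell_shiftAt, if_neg (by omega), if_pos ⟨rfl, rfl⟩]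
        push_cast
        ring
      · refine Finset.prod_congr rfl fun a _ => ?_
        rw [ell_shiftAt, ell_shiftAt, if_neg (by omega), if_pos ⟨rfl, rfl⟩]
        push_cast
        ring
    · refine Finset.prod_congr rfl fun a ha => ?_
      rw [ell_shiftAt, ell_shiftAt, if_neg (by simp at ha; omega), if_pos ⟨rfl, rfl⟩]
      push_cast
      ring
  rw [Finset.sum_congr rfl hL, key]
  rw [Finset.sum_sub_distrib, Finset.sum_sub_distrib, ← Finset.mul_sum, sum_ell, sum_ell, sum_ell]
  simp only [Finset.sum_const, Nat.card_Icc, nsmul_eq_mul]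
  push_cast [Nat.cast_sub hk]
  ring

/-- The factor `p - m_{in} + i - 1` for odd `i` and `1` for even `i`, as a function of
`m_{in}`. -/
def topFactor (p : ℂ) (i : ℕ) (x : ℤ) : ℂ := if Even i then 1 else p - x + i - 1

theorem card_filter_even (n : ℕ) : ((Finset.Icc 1 n).filter fun j => Even j).card = n / 2 := by
  induction n with
  | zero => simp
  | succ n ih =>
    rw [← Finset.insert_Icc_right_eq_Icc_add_one (by omega), Finset.filter_insert]
    split_ifs with h
    · rw [Finset.card_insert_of_notMem (by simp), ih]
      obtain ⟨c, hc⟩ := h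
      omega
    · rw [ih]
      obtain ⟨c, hc⟩ := Nat.not_even_iff_odd.1 h
      omega

theorem card_filter_odd (n : ℕ) :
    ((Finset.Icc 1 n).filter fun j => ¬ Even j).card = (n + 1) / 2 := by
  have := Finset.card_filter_add_card_filter_not (s := Finset.Icc 1 n) (fun j => Even j)
  rw [card_filter_even, Nat.card_Icc] at this
  omega

open Polynomial in
/-- The contribution of the entries of one parity to the diagonal of `[f_n⁺, f_n⁻]`. The polynomial
`Z` stands for the factor that depends on `p`: it is `x - (p - 1)` for odd entries and `1` for even
entries. -/
theorem topRad_sum_aux {n : ℕ} (hn : 1 ≤ n) {e : ℕ → ℕ → ℤ} (h : IsGZ n e) (i₀ : ℕ) (Z : ℂ[X])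
    (hZ : Z.Monic) (hZd : n - 1 + (if (Even n ↔ Even i₀) then 1 else 0) + Z.natDegree =
      2 * (sameParity n i₀).card) :
    ∑ i ∈ sameParity n i₀, (Z.eval ((ell e i n : ℂ) - 1) *
        ((paritySign i₀ * topRad n (shiftAt i n (-1) e) i : ℝ) : ℂ)
      - Z.eval (ell e i n : ℂ) * ((paritySign i₀ * topRad n e i : ℝ) : ℂ)) =
      - (∑ i ∈ sameParity n i₀, (2 * (ell e i n : ℂ) - 1) -
        ∑ a ∈ Finset.Icc 1 (n - 1), ((ell e a (n - 1) : ℂ) - 1) +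
        (if (Even n ↔ Even i₀) then (n : ℂ) + 1 else 0) + Z.nextCoeff) := by
  let A : ℂ[X] := ∏ a ∈ Finset.Icc 1 (n - 1), (X - C ((ell e a (n - 1) : ℂ) - 1))
  let B : ℂ[X] := if (Even n ↔ Even i₀) then X + C ((n : ℂ) + 1) else 1
  have hA : A.Monic := monic_prod_X_sub_C' _ _
  have hB : B.Monic := by
    simp only [B]
    split_ifs
    · exact monic_X_add_C _
    · exact monic_one
  have hBd : B.natDegree = if (Even n ↔ Even i₀) then 1 else 0 := by
    simp only [B]
    split_ifs
    · exact natDegree_X_add_C _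
    · exact natDegree_one
  have hBn : B.nextCoeff = if (Even n ↔ Even i₀) then (n : ℂ) + 1 else 0 := by
    simp only [B]
    split_ifs
    · exact nextCoeff_X_add_C _
    · exact nextCoeff_C_eq_zero 1
  have hAB := hA.mul hB
  have hpar : ∀ i ∈ sameParity n i₀, sameParity n i = sameParity n i₀ ∧
      paritySign i = paritySign i₀ ∧ (Even i ↔ Even i₀) := by
    intro i hi
    have hi' := (mem_sameParity.1 hi).2
    refine ⟨?_, ?_, hi'⟩
    · ext j
      simp [mem_sameParity, hi']
    · simp [paritySign, hi']
  have hs : paritySign i₀ * paritySign i₀ = 1 := by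
    rw [paritySign]
    split_ifs <;> norm_num
  have key := lagrange_sum_pairs (sameParity n i₀) (fun a => (ell e a n : ℂ))
    (fun a ha b hb hab => h.ell_injOn le_rfl (Finset.filter_subset _ _ ha)
      (Finset.filter_subset _ _ hb) (Complex.ofReal_injective hab))
    (A * B * Z) (hAB.mul hZ)
    (by
      rw [hAB.natDegree_mul hZ, hA.natDegree_mul hB, natDegree_prod_X_sub_C', hBd, ← hZd]
      simp)
    (by
      intro i hi j hj hij
      have hij' : ell e i n = ell e j n - 1 := by exact_mod_cast hij
      have hi' := mem_sameParity.1 hi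
      have hj' := mem_sameParity.1 hj
      -- no two poles coincide, as entries of the same parity differ by at least two
      exfalso
      rcases lt_trichotomy i j with hlt | rfl | hlt
      · have := h.ell_lt hi'.1.1 hlt hj'.1.2 le_rfl
        linarith
      · linarith
      · have := h.ell_sameParity hj'.1.1 hlt hi'.1.2 le_rfl (by rw [hi'.2, hj'.2])
        linarith)
  rw [hAB.nextCoeff_mul hZ, hA.nextCoeff_mul hB, prod_X_sub_C_nextCoeff, hBn] at key
  rw [show ∀ x y z w : ℂ, -(x - y + z + w) = -(x + (-y + z + w)) from fun _ _ _ _ => by ring,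
    ← key, ← Finset.sum_neg_distrib]
  refine Finset.sum_congr rfl fun i hi => ?_
  obtain ⟨h1, h2, h3⟩ := hpar i hi
  have hev : ∀ x : ℝ, (((∏ a ∈ Finset.Icc 1 (n - 1), (x + 1 - ell e a (n - 1))) *
      linFactor n i x : ℝ) : ℂ) = (A * B).eval (x : ℂ) := by
    intro x
    simp only [A, B, eval_mul, eval_prod, eval_sub, eval_X, eval_C, Complex.ofReal_mul,
      Complex.ofReal_prod, linFactor, h3]
    congr 1
    · refine Finset.prod_congr rfl fun a _ => ?_
      push_cast
      ring
    · split_ifs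
      · simp
        ring
      · simp
  have e1 : paritySign i₀ * topRad n e i =
      ((∏ a ∈ Finset.Icc 1 (n - 1), (ell e i n + 1 - ell e a (n - 1))) *
        linFactor n i (ell e i n)) / ∏ a ∈ (sameParity n i₀).erase i,
          ((ell e i n - ell e a n) * (ell e i n - ell e a n + 1)) := by
    rw [topRad, h1, h2, ← mul_div_assoc, ← mul_assoc, hs, one_mul]
  have e2 : paritySign i₀ * topRad n (shiftAt i n (-1) e) i =
      ((∏ a ∈ Finset.Icc 1 (n - 1), (ell e i n - 1 + 1 - ell e a (n - 1))) *
        linFactor n i (ell e i n - 1)) / ∏ a ∈ (sameParity n i₀).erase i,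
          ((ell e i n - 1 - ell e a n) * (ell e i n - 1 - ell e a n + 1)) := by
    have e3 : ell (shiftAt i n (-1) e) i n = ell e i n - 1 := by
      rw [ell_shiftAt, if_pos ⟨rfl, rfl⟩]
      push_cast
      ring
    rw [topRad, h1, h2, ← mul_div_assoc, ← mul_assoc, hs, one_mul, e3]
    congr 1
    · congr 1
      refine Finset.prod_congr rfl fun a _ => ?_
      rw [ell_shiftAt, if_neg (by omega), add_zero]
    · refine Finset.prod_congr rfl fun a ha => ?_
      rw [ell_shiftAt, if_neg (by simp at ha; omega), add_zero]
  rw [e1, e2, Complex.ofReal_div, Complex.ofReal_div, hev, hev, eval_mul (p := A * B),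
    eval_mul (p := A * B)]
  push_cast
  ring

/-- The diagonal of `[f_n⁺, f_n⁻] = 2 E_{nn}`: the even and the odd entries contribute separately,
and only the odd ones see `p`. -/
theorem topRad_sum {n : ℕ} (hn : 1 ≤ n) {e : ℕ → ℕ → ℤ} (h : IsGZ n e) (p : ℂ) :
    ∑ i ∈ Finset.Icc 1 n, (topFactor p i (e i n - 1) * (topRad n (shiftAt i n (-1) e) i : ℂ)
      - topFactor p i (e i n) * (topRad n e i : ℂ)) =
      - p + 2 * (∑ i ∈ Finset.Icc 1 n, (e i n : ℂ) -
        ∑ i ∈ Finset.Icc 1 (n - 1), (e i (n - 1) : ℂ)) := by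
  have hodd : sameParity n 1 = (Finset.Icc 1 n).filter fun j => ¬ Even j := by
    ext j
    simp [sameParity]
  have heven : sameParity n 0 = (Finset.Icc 1 n).filter fun j => Even j := by
    ext j
    simp [sameParity]
  have kE := topRad_sum_aux hn h 0 1 Polynomial.monic_one (by
    rw [heven, card_filter_even]
    by_cases hn : Even n
    · obtain ⟨c, rfl⟩ := hn
      simp
      omega
    · obtain ⟨c, rfl⟩ := Nat.not_even_iff_odd.1 hn
      simp
      omega)
  have kO := topRad_sum_aux hn h 1 (Polynomial.X - Polynomial.C (p - 1))
    (Polynomial.monic_X_sub_C _) (by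
    rw [hodd, card_filter_odd, Polynomial.natDegree_X_sub_C]
    by_cases hn : Even n
    · obtain ⟨c, rfl⟩ := hn
      simp
      omega
    · obtain ⟨c, rfl⟩ := Nat.not_even_iff_odd.1 hn
      simp
      omega)
  rw [Polynomial.nextCoeff_X_sub_C] at kO
  have n1 : (1 : Polynomial ℂ).nextCoeff = 0 := Polynomial.nextCoeff_C_eq_zero 1
  rw [n1] at kE
  rw [← Finset.sum_filter_add_sum_filter_not (Finset.Icc 1 n) (fun j => Even j), ← heven, ← hodd]
  have sE : paritySign 0 = -1 := by simp [paritySign]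
  have sO : paritySign 1 = 1 := by simp [paritySign]
  have tE : ∑ i ∈ sameParity n 0,
      (topFactor p i (e i n - 1) * (topRad n (shiftAt i n (-1) e) i : ℂ)
        - topFactor p i (e i n) * (topRad n e i : ℂ)) =
      (∑ i ∈ sameParity n 0, (2 * (ell e i n : ℂ) - 1) -
        ∑ a ∈ Finset.Icc 1 (n - 1), ((ell e a (n - 1) : ℂ) - 1) +
        (if Even n then (n : ℂ) + 1 else 0)) := by
    have : ∀ x y : ℂ, x = - y → -x = y := fun x y h => by rw [h, neg_neg]
    simp only [Nat.even_iff, Nat.zero_mod, iff_true, add_zero] at kE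
    simp only [Nat.even_iff]
    rw [← this _ _ kE, ← Finset.sum_neg_distrib]
    refine Finset.sum_congr rfl fun i hi => ?_
    have hi' := (mem_sameParity.1 hi).2
    simp only [Even.zero, iff_true] at hi'
    rw [topFactor, topFactor, if_pos hi', if_pos hi', sE, Polynomial.eval_one,
      Polynomial.eval_one]
    push_cast
    ring
  have tO : ∑ i ∈ sameParity n 1,
      (topFactor p i (e i n - 1) * (topRad n (shiftAt i n (-1) e) i : ℂ)
        - topFactor p i (e i n) * (topRad n e i : ℂ)) =
      (∑ i ∈ sameParity n 1, (2 * (ell e i n : ℂ) - 1) -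
        ∑ a ∈ Finset.Icc 1 (n - 1), ((ell e a (n - 1) : ℂ) - 1) +
        (if Even n then 0 else (n : ℂ) + 1) - (p - 1)) := by
    have : ∀ x y : ℂ, x = - y → -x = y := fun x y h => by rw [h, neg_neg]
    rw [show (if Even n then 0 else (n : ℂ) + 1) = if (Even n ↔ Even 1) then (n : ℂ) + 1 else 0 by
      by_cases h : Even n <;> simp [h], sub_eq_add_neg _ (p - 1)]
    rw [← this _ _ kO, ← Finset.sum_neg_distrib]
    refine Finset.sum_congr rfl fun i hi => ?_
    have hi' : ¬ Even i := by rw [(mem_sameParity.1 hi).2]; simp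
    rw [topFactor, topFactor, if_neg hi', if_neg hi', sO]
    simp only [Polynomial.eval_sub, Polynomial.eval_X, Polynomial.eval_C, ell]
    push_cast
    ring
  rw [tE, tO]
  have hsum : ∑ i ∈ sameParity n 0, (2 * (ell e i n : ℂ) - 1) +
      ∑ i ∈ sameParity n 1, (2 * (ell e i n : ℂ) - 1) =
      ∑ i ∈ Finset.Icc 1 n, (2 * (ell e i n : ℂ) - 1) := by
    rw [heven, hodd, Finset.sum_filter_add_sum_filter_not]
  have hif : (if Even n then (n : ℂ) + 1 else 0) + (if Even n then 0 else (n : ℂ) + 1) = n + 1 := by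
    split_ifs <;> simp
  have hc1 : ∑ i ∈ Finset.Icc 1 n, (2 * (ell e i n : ℂ) - 1) =
      2 * ∑ i ∈ Finset.Icc 1 n, (e i n : ℂ) - n * (n + 1) - n := by
    rw [Finset.sum_sub_distrib, ← Finset.mul_sum]
    have := congrArg (fun x : ℝ => (x : ℂ)) (sum_ell e n n)
    push_cast at this
    rw [this]
    simp
    ring
  have hc2 : ∑ a ∈ Finset.Icc 1 (n - 1), ((ell e a (n - 1) : ℂ) - 1) =
      ∑ i ∈ Finset.Icc 1 (n - 1), (e i (n - 1) : ℂ) - n * (n - 1) / 2 - (n - 1) := by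
    rw [Finset.sum_sub_distrib]
    have := congrArg (fun x : ℝ => (x : ℂ)) (sum_ell e (n - 1) (n - 1))
    push_cast [Nat.cast_sub hn] at this
    rw [this]
    simp [Nat.cast_sub hn]
    ring
  rw [hc1] at hsum
  rw [hc2]
  linear_combination hsum + hif

/-! ### Exchange relations between the radicands -/

theorem prod_eq_mul_erase_of_mem {s : Finset ℕ} {j : ℕ} (hj : j ∈ s) (f g : ℕ → ℝ)
    (hfg : ∀ a ∈ s, a ≠ j → f a = g a) : ∏ a ∈ s, f a = f j * ∏ a ∈ s.erase j, g a := by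
  rw [← Finset.mul_prod_erase _ _ hj]
  congr 1
  refine Finset.prod_congr rfl fun a ha => ?_
  rw [Finset.mem_erase] at ha
  exact hfg a ha.2 ha.1

theorem gzRad_shift_above (e : ℕ → ℕ → ℤ) {k i j : ℕ} (hj : 1 ≤ j) (hjk : j ≤ k + 1) :
    ∃ r, gzRad e k i = (ell e j (k + 1) - ell e i k) * r ∧
      gzRad (shiftAt j (k + 1) 1 e) k i = (ell e j (k + 1) + 1 - ell e i k) * r := by
  have hm : j ∈ Finset.Icc 1 (k + 1) := Finset.mem_Icc.2 ⟨hj, hjk⟩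
  have e0 : ∀ a b, ell (shiftAt j (k + 1) 1 e) a b =
      ell e a b + if a = j ∧ b = k + 1 then 1 else 0 := fun a b => by
    rw [ell_shiftAt]; push_cast; rfl
  refine ⟨-(∏ a ∈ (Finset.Icc 1 (k + 1)).erase j, (ell e a (k + 1) - ell e i k)) *
    (∏ a ∈ Finset.Icc 1 (k - 1), (ell e a (k - 1) - ell e i k - 1)) /
    ∏ a ∈ (Finset.Icc 1 k).erase i, ((ell e a k - ell e i k) * (ell e a k - ell e i k - 1)),
    ?_, ?_⟩
  · rw [gzRad, ← Finset.mul_prod_erase _ _ hm]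
    ring
  · have h1 : k ≠ k + 1 := by omega
    have h2 : k - 1 ≠ k + 1 := by omega
    simp only [gzRad, e0, h1, h2, and_false, if_false, add_zero]
    rw [prod_eq_mul_erase_of_mem hm _ (fun a => ell e a (k + 1) - ell e i k)
      (fun a _ ha => by simp [ha])]
    simp only [and_self, if_true]
    ring

theorem gzRad_shift_below (e : ℕ → ℕ → ℤ) {k i j : ℕ} (hj : 1 ≤ j) (hjk : j ≤ k) :
    ∃ r, gzRad e (k + 1) i = (ell e j k - ell e i (k + 1) - 1) * r ∧
      gzRad (shiftAt j k 1 e) (k + 1) i = (ell e j k - ell e i (k + 1)) * r := by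
  have hm : j ∈ Finset.Icc 1 k := Finset.mem_Icc.2 ⟨hj, hjk⟩
  have e0 : ∀ a b, ell (shiftAt j k 1 e) a b =
      ell e a b + if a = j ∧ b = k then 1 else 0 := fun a b => by
    rw [ell_shiftAt]; push_cast; rfl
  refine ⟨-(∏ a ∈ Finset.Icc 1 (k + 1 + 1), (ell e a (k + 1 + 1) - ell e i (k + 1))) *
    (∏ a ∈ (Finset.Icc 1 k).erase j, (ell e a k - ell e i (k + 1) - 1)) /
    ∏ a ∈ (Finset.Icc 1 (k + 1)).erase i,
      ((ell e a (k + 1) - ell e i (k + 1)) * (ell e a (k + 1) - ell e i (k + 1) - 1)),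
    ?_, ?_⟩
  · rw [gzRad, Nat.add_sub_cancel, ← Finset.mul_prod_erase _ _ hm]
    ring
  · have h1 : k + 1 ≠ k := by omega
    have h2 : k + 1 + 1 ≠ k := by omega
    simp only [gzRad, e0, h1, h2, and_false, if_false, add_zero, Nat.add_sub_cancel]
    rw [prod_eq_mul_erase_of_mem hm _ (fun a => ell e a k - ell e i (k + 1) - 1)
      (fun a _ ha => by simp [ha])]
    simp only [and_self, if_true]
    ring

theorem gzRad_shift_same (e : ℕ → ℕ → ℤ) {k i j : ℕ} (hj : 1 ≤ j) (hjk : j ≤ k) (hij : i ≠ j) :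
    ∃ r, gzRad e k i = ((ell e j k - ell e i k) * (ell e j k - ell e i k - 1))⁻¹ * r ∧
      gzRad (shiftAt j k 1 e) k i =
        ((ell e j k + 1 - ell e i k) * (ell e j k - ell e i k))⁻¹ * r := by
  have hm : j ∈ (Finset.Icc 1 k).erase i :=
    Finset.mem_erase.2 ⟨hij.symm, Finset.mem_Icc.2 ⟨hj, hjk⟩⟩
  have e0 : ∀ a b, ell (shiftAt j k 1 e) a b =
      ell e a b + if a = j ∧ b = k then 1 else 0 := fun a b => by
    rw [ell_shiftAt]; push_cast; rfl
  refine ⟨-((∏ a ∈ Finset.Icc 1 (k + 1), (ell e a (k + 1) - ell e i k)) *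
    (∏ a ∈ Finset.Icc 1 (k - 1), (ell e a (k - 1) - ell e i k - 1))) *
    (∏ a ∈ ((Finset.Icc 1 k).erase i).erase j,
      ((ell e a k - ell e i k) * (ell e a k - ell e i k - 1)))⁻¹,
    ?_, ?_⟩
  · rw [gzRad, ← Finset.mul_prod_erase _ _ hm, div_eq_mul_inv, mul_inv]
    ring
  · have h1 : k + 1 ≠ k := by omega
    have hk0 : k - 1 ≠ k := by omega
    simp only [gzRad, e0, h1, hk0, and_false, if_false, add_zero, hij, false_and]
    rw [prod_eq_mul_erase_of_mem hm _
      (fun a => (ell e a k - ell e i k) * (ell e a k - ell e i k - 1))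
      (fun a _ ha => by simp [ha]), div_eq_mul_inv, mul_inv]
    simp only [and_self, if_true]
    rw [show ell e j k + 1 - ell e i k - 1 = ell e j k - ell e i k by ring]
    ring

theorem gzRad_shift_far (e : ℕ → ℕ → ℤ) {k i j l : ℕ} (c : ℤ) (h1 : l ≠ k) (h2 : l ≠ k + 1)
    (h3 : l ≠ k - 1) : gzRad (shiftAt j l c e) k i = gzRad e k i := by
  simp only [gzRad, ell_shiftAt, h1.symm, h2.symm, h3.symm, and_false, if_false, add_zero]

theorem topRad_shift_below (n : ℕ) (e : ℕ → ℕ → ℤ) {i j : ℕ} (hj : 1 ≤ j) (hjn : j ≤ n - 1) :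
    ∃ r, topRad n e i = (ell e i n + 1 - ell e j (n - 1)) * r ∧
      topRad n (shiftAt j (n - 1) 1 e) i = (ell e i n - ell e j (n - 1)) * r := by
  have hm : j ∈ Finset.Icc 1 (n - 1) := Finset.mem_Icc.2 ⟨hj, hjn⟩
  have e0 : ∀ a b, ell (shiftAt j (n - 1) 1 e) a b =
      ell e a b + if a = j ∧ b = n - 1 then 1 else 0 := fun a b => by
    rw [ell_shiftAt]; push_cast; rfl
  refine ⟨paritySign i * ((∏ a ∈ (Finset.Icc 1 (n - 1)).erase j,
    (ell e i n + 1 - ell e a (n - 1))) * linFactor n i (ell e i n)) /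
    ∏ j ∈ (sameParity n i).erase i, ((ell e i n - ell e j n) * (ell e i n - ell e j n + 1)),
    ?_, ?_⟩
  · rw [topRad, ← Finset.mul_prod_erase _ _ hm]
    ring
  · have h1 : n ≠ n - 1 := by omega
    simp only [topRad, e0, h1, and_false, if_false, add_zero]
    rw [prod_eq_mul_erase_of_mem hm _ (fun a => ell e i n + 1 - ell e a (n - 1))
      (fun a _ ha => by simp [ha])]
    simp only [and_self, if_true]
    ring

theorem topRad_shift_far (n : ℕ) (e : ℕ → ℕ → ℤ) {i j l : ℕ} (c : ℤ) (h1 : l ≠ n)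
    (h2 : l ≠ n - 1) : topRad n (shiftAt j l c e) i = topRad n e i := by
  simp only [topRad, ell_shiftAt, h1.symm, h2.symm, and_false, if_false, add_zero]

theorem topRad_shift_same (n : ℕ) (e : ℕ → ℕ → ℤ) {i j : ℕ} (hj : 1 ≤ j) (hjn : j ≤ n)
    (hij : i ≠ j) (hpar : Even j ↔ Even i) :
    ∃ r, topRad n e i = ((ell e i n - ell e j n) * (ell e i n - ell e j n + 1))⁻¹ * r ∧
      topRad n (shiftAt j n 1 e) i =
        ((ell e i n - ell e j n - 1) * (ell e i n - ell e j n))⁻¹ * r := by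
  have hm : j ∈ (sameParity n i).erase i :=
    Finset.mem_erase.2 ⟨hij.symm, mem_sameParity.2 ⟨⟨hj, hjn⟩, hpar⟩⟩
  have e0 : ∀ a b, ell (shiftAt j n 1 e) a b =
      ell e a b + if a = j ∧ b = n then 1 else 0 := fun a b => by
    rw [ell_shiftAt]; push_cast; rfl
  refine ⟨paritySign i * ((∏ a ∈ Finset.Icc 1 (n - 1), (ell e i n + 1 - ell e a (n - 1))) *
    linFactor n i (ell e i n)) * (∏ j ∈ ((sameParity n i).erase i).erase j,
      ((ell e i n - ell e j n) * (ell e i n - ell e j n + 1)))⁻¹, ?_, ?_⟩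
  · rw [topRad, ← Finset.mul_prod_erase _ _ hm, div_eq_mul_inv, mul_inv]
    ring
  · have h1 : n - 1 ≠ n := by omega
    simp only [topRad, e0, h1, and_false, if_false, add_zero, hij, false_and]
    rw [prod_eq_mul_erase_of_mem hm _
      (fun a => (ell e i n - ell e a n) * (ell e i n - ell e a n + 1))
      (fun a _ ha => by simp [ha]), div_eq_mul_inv, mul_inv]
    simp only [and_self, if_true]
    rw [show ell e i n - (ell e j n + 1) + 1 = ell e i n - ell e j n by ring,
      show ell e i n - (ell e j n + 1) = ell e i n - ell e j n - 1 by ring]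
    ring

theorem topRad_shift_same_of_parity (n : ℕ) (e : ℕ → ℕ → ℤ) {i j : ℕ} (c : ℤ)
    (hij : i ≠ j) (hpar : ¬ (Even j ↔ Even i)) :
    topRad n (shiftAt j n c e) i = topRad n e i := by
  have h1 : n - 1 ≠ n ∨ n = 0 := by omega
  simp only [topRad, ell_shiftAt, hij, false_and, if_false, add_zero]
  congr 1
  · congr 2
    refine Finset.prod_congr rfl fun a ha => ?_
    have := Finset.mem_Icc.1 ha
    rw [if_neg (by omega), add_zero]
  · refine Finset.prod_congr rfl fun a ha => ?_
    rw [if_neg, add_zero]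
    rintro ⟨rfl, -⟩
    exact hpar (mem_sameParity.1 (Finset.mem_of_mem_erase ha)).2

/-! ### Operators that shift the entries of a pattern -/

theorem patternSpace_ext {n : ℕ} {W : Type*} [AddCommGroup W] [Module ℂ W]
    {A B : PatternSpace n →ₗ[ℂ] W}
    (h : ∀ m : GZPattern n, A (patternVec m) = B (patternVec m)) : A = B :=
  Finsupp.lhom_ext' fun m => LinearMap.ext_ring (h m)

/-- The operator `|m) ↦ ∑ i ∈ I, c i m |σ i m)`. -/
def shiftOp {n : ℕ} {ι : Type*} (I : Finset ι) (σ : ι → (ℕ → ℕ → ℤ) → ℕ → ℕ → ℤ)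
    (c : ι → (ℕ → ℕ → ℤ) → ℂ) : Module.End ℂ (PatternSpace n) :=
  Finsupp.linearCombination ℂ fun m =>
    ∑ i ∈ I, c i m.toInt • ket patternVec (σ i m.toInt)

section shiftOp

variable {n : ℕ} {ι κ : Type*} {I : Finset ι} {J : Finset κ}
  {σ : ι → (ℕ → ℕ → ℤ) → ℕ → ℕ → ℤ} {τ : κ → (ℕ → ℕ → ℤ) → ℕ → ℕ → ℤ}
  {c : ι → (ℕ → ℕ → ℤ) → ℂ} {d : κ → (ℕ → ℕ → ℤ) → ℂ}

theorem shiftOp_apply (m : GZPattern n) : shiftOp I σ c (patternVec m) =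
    ∑ i ∈ I, c i m.toInt • (ket patternVec (σ i m.toInt) : PatternSpace n) := by
  rw [shiftOp, patternVec, Finsupp.linearCombination_single, one_smul]

theorem shiftOp_ket {e : ℕ → ℕ → ℤ} (h : IsGZ n e) :
    shiftOp I σ c (ket patternVec e : PatternSpace n) =
      ∑ i ∈ I, c i e • (ket patternVec (σ i e) : PatternSpace n) := by
  rw [ket_of_isGZ _ h, shiftOp_apply, h.toInt_pattern]

/-- The composition of two shift operators. An intermediate array that is not a pattern does not
matter as long as its coefficient vanishes or the final array is not a pattern either. -/
theorem shiftOp_shiftOp_apply (m : GZPattern n)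
    (h : ∀ i ∈ I, ∀ j ∈ J, ¬ IsGZ n (σ i m.toInt) → IsGZ n (τ j (σ i m.toInt)) →
      c i m.toInt * d j (σ i m.toInt) = 0) :
    shiftOp J τ d (shiftOp I σ c (patternVec m)) = ∑ i ∈ I, ∑ j ∈ J,
      (c i m.toInt * d j (σ i m.toInt)) •
        (ket patternVec (τ j (σ i m.toInt)) : PatternSpace n) := by
  rw [shiftOp_apply, map_sum]
  refine Finset.sum_congr rfl fun i hi => ?_
  rw [map_smul]
  by_cases hg : IsGZ n (σ i m.toInt)
  · rw [shiftOp_ket hg, Finset.smul_sum]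
    simp only [smul_smul]
  · rw [ket_of_not_isGZ _ hg, map_zero, smul_zero]
    refine (Finset.sum_eq_zero fun j hj => ?_).symm
    by_cases hg' : IsGZ n (τ j (σ i m.toInt))
    · rw [h i hi j hj hg hg', zero_smul]
    · rw [ket_of_not_isGZ _ hg', smul_zero]

theorem shiftOp_lie_apply (m : GZPattern n)
    (hcomm : ∀ i ∈ I, ∀ j ∈ J, τ j (σ i m.toInt) = σ i (τ j m.toInt))
    (h1 : ∀ i ∈ I, ∀ j ∈ J, ¬ IsGZ n (σ i m.toInt) → IsGZ n (τ j (σ i m.toInt)) →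
      c i m.toInt * d j (σ i m.toInt) = 0)
    (h2 : ∀ i ∈ I, ∀ j ∈ J, ¬ IsGZ n (τ j m.toInt) → IsGZ n (τ j (σ i m.toInt)) →
      d j m.toInt * c i (τ j m.toInt) = 0) :
    ⁅(shiftOp I σ c : Module.End ℂ (PatternSpace n)), shiftOp J τ d⁆ (patternVec m) =
      ∑ i ∈ I, ∑ j ∈ J,
        (d j m.toInt * c i (τ j m.toInt) - c i m.toInt * d j (σ i m.toInt)) •
          (ket patternVec (τ j (σ i m.toInt)) : PatternSpace n) := by
  rw [Ring.lie_def, LinearMap.sub_apply, Module.End.mul_apply, Module.End.mul_apply,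
    shiftOp_shiftOp_apply m h1, shiftOp_shiftOp_apply m, Finset.sum_comm,
    ← Finset.sum_sub_distrib]
  · refine Finset.sum_congr rfl fun i hi => ?_
    rw [← Finset.sum_sub_distrib]
    refine Finset.sum_congr rfl fun j hj => ?_
    rw [← hcomm i hi j hj, sub_smul]
  · intro j hj i hi hg hg'
    rw [← hcomm i hi j hj] at hg'
    exact h2 i hi j hj hg hg'

end shiftOp

/-- The symmetric bilinear form for which the vectors `|m)` are orthonormal. -/
def dotForm (n : ℕ) : PatternSpace n →ₗ[ℂ] PatternSpace n →ₗ[ℂ] ℂ :=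
  Finsupp.lsum ℂ fun m => LinearMap.toSpanSingleton ℂ _ (Finsupp.lapply m)

section dotForm

variable {n : ℕ}

theorem dotForm_patternVec (m : GZPattern n) (v : PatternSpace n) :
    dotForm n (patternVec m) v = v m := by
  simp [dotForm, patternVec]

theorem dotForm_patternVec_right (v : PatternSpace n) (m : GZPattern n) :
    dotForm n v (patternVec m) = v m := by
  have : (dotForm n).flip (patternVec m) = Finsupp.lapply m := by
    classical
    refine patternSpace_ext fun m' => ?_
    rw [LinearMap.flip_apply, dotForm_patternVec, Finsupp.lapply_apply, patternVec, patternVec,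
      Finsupp.single_apply, Finsupp.single_apply]
    exact if_congr eq_comm rfl rfl
  exact LinearMap.congr_fun this v

/-- The operators `A` and `B` are transposes of each other. -/
def IsTranspose (A B : Module.End ℂ (PatternSpace n)) : Prop :=
  LinearMap.IsAdjointPair (dotForm n) (dotForm n) A B

theorem isTranspose_iff {A B : Module.End ℂ (PatternSpace n)} :
    IsTranspose A B ↔ ∀ m m' : GZPattern n, A (patternVec m) m' = B (patternVec m') m := by
  constructor
  · intro h m m'
    have := h (patternVec m) (patternVec m')
    rwa [dotForm_patternVec, dotForm_patternVec_right] at this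
  · intro h
    have : (dotForm n).compl₁₂ A LinearMap.id = (dotForm n).compl₁₂ LinearMap.id B := by
      refine patternSpace_ext fun m => patternSpace_ext fun m' => ?_
      simp only [LinearMap.compl₁₂_apply, LinearMap.id_apply, dotForm_patternVec,
        dotForm_patternVec_right]
      exact h m m'
    intro v w
    exact LinearMap.congr_fun (LinearMap.congr_fun this v) w

theorem IsTranspose.lie {A B A' B' : Module.End ℂ (PatternSpace n)} (h : IsTranspose A B)
    (h' : IsTranspose A' B') : IsTranspose ⁅A, A'⁆ ⁅B', B⁆ := by
  rw [isTranspose_iff]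
  intro m m'
  have h1 := (LinearMap.IsAdjointPair.mul h h') (patternVec m) (patternVec m')
  have h2 := (LinearMap.IsAdjointPair.mul h' h) (patternVec m) (patternVec m')
  rw [dotForm_patternVec, dotForm_patternVec_right] at h1 h2
  rw [Ring.lie_def, LieRing.of_associative_ring_bracket, LinearMap.sub_apply,
    LinearMap.sub_apply, Finsupp.sub_apply, Finsupp.sub_apply]
  exact congrArg₂ _ h1 h2

theorem IsTranspose.eq_of_eq {A B A' B' : Module.End ℂ (PatternSpace n)} (h : IsTranspose A B)
    (h' : IsTranspose A' B') (hA : A = A') : B = B' := by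
  rw [isTranspose_iff] at h h'
  refine patternSpace_ext fun m => Finsupp.ext fun m' => ?_
  rw [← h, ← h', hA]

theorem IsTranspose.zero : IsTranspose (0 : Module.End ℂ (PatternSpace n)) 0 :=
  isTranspose_iff.2 fun _ _ => rfl

theorem IsTranspose.symm {A B : Module.End ℂ (PatternSpace n)} (h : IsTranspose A B) :
    IsTranspose B A := by
  rw [isTranspose_iff] at h ⊢
  exact fun m m' => (h m' m).symm

theorem IsTranspose.neg {A B : Module.End ℂ (PatternSpace n)} (h : IsTranspose A B) :
    IsTranspose (-A) (-B) := by
  rw [isTranspose_iff] at h ⊢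
  intro m m'
  simp [h m m']

theorem isTranspose_shiftOp {ι : Type*} {I : Finset ι}
    {σ σ' : ι → (ℕ → ℕ → ℤ) → ℕ → ℕ → ℤ} {c : ι → (ℕ → ℕ → ℤ) → ℂ}
    (h1 : ∀ i e, σ' i (σ i e) = e) (h2 : ∀ i e, σ i (σ' i e) = e) :
    IsTranspose (shiftOp I σ c : Module.End ℂ (PatternSpace n))
      (shiftOp I σ' fun i e => c i (σ' i e)) := by
  classical
  rw [isTranspose_iff]
  intro m m'
  rw [shiftOp_apply, shiftOp_apply, Finsupp.finsetSum_apply, Finsupp.finsetSum_apply]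
  refine Finset.sum_congr rfl fun i _ => ?_
  rw [Finsupp.smul_apply, Finsupp.smul_apply, ket_patternVec_apply, ket_patternVec_apply]
  by_cases h : m'.toInt = σ i m.toInt
  · have h' : σ' i m'.toInt = m.toInt := by rw [h, h1]
    rw [if_pos h, if_pos h'.symm, h']
  · have h' : m.toInt ≠ σ' i m'.toInt := fun h' => h (by rw [h', h2])
    rw [if_neg h, if_neg h', smul_zero, smul_zero]

end dotForm

/-! ### The Chevalley operators -/

/-- The radicand for raising the `i`-th entry of row `k`. -/
def rowRad (n k : ℕ) (e : ℕ → ℕ → ℤ) (i : ℕ) : ℝ :=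
  if k < n then gzRad e k i else topRad n e i

/-- The coefficient for raising the `i`-th entry of row `k`; in the top row, it contains the weight
`w i m_{in}`. -/
def rowCoeff (n : ℕ) (w : ℕ → ℤ → ℂ) (k i : ℕ) (e : ℕ → ℕ → ℤ) : ℂ :=
  (if k < n then 1 else w i (e i n)) * (Real.sqrt (rowRad n k e i) : ℂ)

/-- The operator that raises the entries of row `k`. -/
def rowUp (n : ℕ) (w : ℕ → ℤ → ℂ) (k : ℕ) : Module.End ℂ (PatternSpace n) :=
  shiftOp (Finset.Icc 1 k) (fun i => shiftAt i k 1) (rowCoeff n w k)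

/-- The operator that lowers the entries of row `k`. -/
def rowDown (n : ℕ) (w : ℕ → ℤ → ℂ) (k : ℕ) : Module.End ℂ (PatternSpace n) :=
  shiftOp (Finset.Icc 1 k) (fun i => shiftAt i k (-1))
    fun i e => rowCoeff n w k i (shiftAt i k (-1) e)

/-- The sum of the entries of row `k`. -/
def rowSum {n : ℕ} (m : GZPattern n) (k : ℕ) : ℕ := ∑ i ∈ Finset.Icc 1 k, m.entry i k

/-- The diagonal operator by which `E_{kk}` acts. -/
def weightOp (n : ℕ) (p : ℂ) (k : ℕ) : Module.End ℂ (PatternSpace n) :=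
  Finsupp.linearCombination ℂ fun m =>
    (-(p / 2) + (rowSum m k : ℂ) - (rowSum m (k - 1) : ℂ)) • patternVec m

theorem weightOp_apply {n : ℕ} (p : ℂ) (k : ℕ) (m : GZPattern n) :
    weightOp n p k (patternVec m) =
      (-(p / 2) + (rowSum m k : ℂ) - (rowSum m (k - 1) : ℂ)) • patternVec m := by
  rw [weightOp]
  nth_rw 1 [patternVec]
  rw [Finsupp.linearCombination_single, one_smul]

section chevalley

variable {n : ℕ}

theorem isTranspose_rowUp (w : ℕ → ℤ → ℂ) (k : ℕ) :
    IsTranspose (rowUp n w k) (rowDown n w k) :=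
  isTranspose_shiftOp (fun i e => by simp [shiftAt_shiftAt])
    (fun i e => by simp [shiftAt_shiftAt])

theorem isTranspose_weightOp (p : ℂ) (k : ℕ) :
    IsTranspose (weightOp n p k) (weightOp n p k) := by
  rw [isTranspose_iff]
  intro m m'
  rw [weightOp_apply, weightOp_apply, Finsupp.smul_apply, Finsupp.smul_apply, patternVec,
    patternVec]
  rcases eq_or_ne m m' with rfl | h
  · rfl
  · rw [Finsupp.single_eq_of_ne h, Finsupp.single_eq_of_ne h.symm, smul_zero, smul_zero]

theorem IsGZ.sup {e g : ℕ → ℕ → ℤ} (h : IsGZ n e) (h' : IsGZ n g) :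
    IsGZ n fun i j => max (e i j) (g i j) where
  zeros i j hij := by simp [h.zeros i j hij, h'.zeros i j hij]
  nonneg i j := le_max_of_le_left (h.nonneg i j)
  upper i j h1 h2 h3 := max_le_max (h.upper i j h1 h2 h3) (h'.upper i j h1 h2 h3)
  lower i j h1 h2 h3 := max_le_max (h.lower i j h1 h2 h3) (h'.lower i j h1 h2 h3)

theorem IsGZ.inf {e g : ℕ → ℕ → ℤ} (h : IsGZ n e) (h' : IsGZ n g) :
    IsGZ n fun i j => min (e i j) (g i j) where
  zeros i j hij := by simp [h.zeros i j hij, h'.zeros i j hij]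
  nonneg i j := le_min (h.nonneg i j) (h'.nonneg i j)
  upper i j h1 h2 h3 := min_le_min (h.upper i j h1 h2 h3) (h'.upper i j h1 h2 h3)
  lower i j h1 h2 h3 := min_le_min (h.lower i j h1 h2 h3) (h'.lower i j h1 h2 h3)

/-- If raising one entry and lowering another one leads from a pattern to a pattern, then either of
these steps does. -/
theorem IsGZ.of_raise_lower {e : ℕ → ℕ → ℤ} (h : IsGZ n e) {i k j l : ℕ} (hne : i ≠ j ∨ k ≠ l)
    (h' : IsGZ n (shiftAt j l (-1) (shiftAt i k 1 e))) :
    IsGZ n (shiftAt i k 1 e) ∧ IsGZ n (shiftAt j l (-1) e) := by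
  constructor
  · convert h.sup h' using 1
    funext a r
    simp only [shiftAt_apply]
    split_ifs <;> omega
  · convert h.inf h' using 1
    funext a r
    simp only [shiftAt_apply]
    split_ifs <;> omega

theorem rowRad_nonneg {e : ℕ → ℕ → ℤ} (h : IsGZ n e) {k i : ℕ} (hi : 1 ≤ i) (hik : i ≤ k)
    (hk : k ≤ n) : 0 ≤ rowRad n k e i := by
  rw [rowRad]
  split_ifs with hkn
  · exact gzRad_nonneg h hi hik hkn
  · obtain rfl : k = n := by omega
    exact topRad_nonneg h hi hik

theorem rowRad_pos {e : ℕ → ℕ → ℤ} (h : IsGZ n e) {k i : ℕ} (hi : 1 ≤ i) (hik : i ≤ k)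
    (hk : k ≤ n) (h' : IsGZ n (shiftAt i k 1 e)) : 0 < rowRad n k e i := by
  rw [rowRad]
  split_ifs with hkn
  · have := (h.raise_iff hi hik hk).1 h'
    exact gzRad_pos h hi hik hkn (this.1 hkn) this.2
  · obtain rfl : k = n := by omega
    exact topRad_pos h hi hik h'

theorem rowRad_eq_zero {e : ℕ → ℕ → ℤ} (h : IsGZ n e) {k i : ℕ} (hi : 1 ≤ i) (hik : i ≤ k)
    (hk : k ≤ n) (h' : ¬ IsGZ n (shiftAt i k 1 e)) : rowRad n k e i = 0 := by
  rw [rowRad]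
  split_ifs with hkn
  · exact gzRad_eq_zero h hi hik hkn h'
  · obtain rfl : k = n := by omega
    exact topRad_eq_zero h hi hik h'

theorem rowRad_lower_eq_zero {e : ℕ → ℕ → ℤ} (h : IsGZ n e) {k i : ℕ} (hi : 1 ≤ i) (hik : i ≤ k)
    (hk : k ≤ n) (h' : ¬ IsGZ n (shiftAt i k (-1) e)) :
    rowRad n k (shiftAt i k (-1) e) i = 0 := by
  rw [rowRad]
  split_ifs with hkn
  · exact gzRad_lower_eq_zero h hi hik hkn h'
  · obtain rfl : k = n := by omega
    exact topRad_lower_eq_zero h hi hik h'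

/-- Raising two different entries: the product of the radicands does not depend on the order. -/
theorem rowRad_exchange (e : ℕ → ℕ → ℤ) {k i l j : ℕ} (hi : 1 ≤ i) (hik : i ≤ k) (hk : k ≤ n)
    (hj : 1 ≤ j) (hjl : j ≤ l) (hl : l ≤ n) (hne : i ≠ j ∨ k ≠ l) :
    rowRad n k e i * rowRad n l e j =
      rowRad n k (shiftAt j l 1 e) i * rowRad n l (shiftAt i k 1 e) j := by
  wlog hkl : k ≤ l generalizing k i l j
  · rw [mul_comm, this hj hjl hl hi hik hk (by tauto) (by omega), mul_comm]
  rcases hkl.eq_or_lt with rfl | hlt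
  · have hij : i ≠ j := by tauto
    by_cases hkn : k < n
    · obtain ⟨r, h1, h2⟩ := gzRad_shift_same e (i := i) hj hjl hij
      obtain ⟨r', h3, h4⟩ := gzRad_shift_same e (i := j) hi hik hij.symm
      simp only [rowRad, hkn, if_true]
      have hh : ((ell e j k - ell e i k) * (ell e j k - ell e i k - 1))⁻¹ *
          ((ell e i k - ell e j k) * (ell e i k - ell e j k - 1))⁻¹ =
          ((ell e j k + 1 - ell e i k) * (ell e j k - ell e i k))⁻¹ *
          ((ell e i k + 1 - ell e j k) * (ell e i k - ell e j k))⁻¹ := by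
        rw [← mul_inv, ← mul_inv]
        congr 1
        ring
      rw [h1, h2, h3, h4]
      linear_combination r * r' * hh
    · obtain rfl : k = n := by omega
      simp only [rowRad, lt_irrefl, if_false]
      by_cases hpar : Even j ↔ Even i
      · obtain ⟨r, h1, h2⟩ := topRad_shift_same k e hj hjl hij hpar
        obtain ⟨r', h3, h4⟩ := topRad_shift_same k e hi hik hij.symm hpar.symm
        have hh : ((ell e i k - ell e j k) * (ell e i k - ell e j k + 1))⁻¹ *
            ((ell e j k - ell e i k) * (ell e j k - ell e i k + 1))⁻¹ =
            ((ell e i k - ell e j k - 1) * (ell e i k - ell e j k))⁻¹ *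
            ((ell e j k - ell e i k - 1) * (ell e j k - ell e i k))⁻¹ := by
          rw [← mul_inv, ← mul_inv]
          congr 1
          ring
        rw [h1, h2, h3, h4]
        linear_combination r * r' * hh
      · rw [topRad_shift_same_of_parity k e 1 hij hpar,
          topRad_shift_same_of_parity k e 1 hij.symm (fun h => hpar h.symm)]
  · have hkn : k < n := by omega
    by_cases hl1 : l = k + 1
    · subst hl1
      obtain ⟨r, h1, h2⟩ := gzRad_shift_above e (k := k) (i := i) hj hjl
      by_cases hln : k + 1 < n
      · obtain ⟨r', h3, h4⟩ := gzRad_shift_below e (k := k) (i := j) hi hik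
        simp only [rowRad, hkn, hln, if_true]
        rw [h1, h2, h3, h4]
        ring
      · obtain rfl : n = k + 1 := by omega
        obtain ⟨r', h3, h4⟩ := topRad_shift_below (k + 1) e (i := j) hi hik
        simp only [Nat.add_sub_cancel] at h3 h4
        simp only [rowRad, hkn, if_true, lt_irrefl, if_false]
        rw [h1, h2, h3, h4]
        ring
    · have e1 : rowRad n k (shiftAt j l 1 e) i = rowRad n k e i := by
        simp only [rowRad, hkn, if_true]
        exact gzRad_shift_far e 1 (by omega) (by omega) (by omega)
      have e2 : rowRad n l (shiftAt i k 1 e) j = rowRad n l e j := by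
        unfold rowRad
        split_ifs
        · exact gzRad_shift_far e 1 (by omega) (by omega) (by omega)
        · exact topRad_shift_far n e 1 (by omega) (by omega)
      rw [e1, e2]

theorem sqrt_mul_sqrt_eq {x y x' y' : ℝ} (hx : 0 ≤ x) (hx' : 0 ≤ x') (h : x * y = x' * y') :
    Real.sqrt x * Real.sqrt y = Real.sqrt x' * Real.sqrt y' := by
  rw [← Real.sqrt_mul hx, ← Real.sqrt_mul hx', h]

theorem rowCoeff_ne_zero {w : ℕ → ℤ → ℂ} (hw : ∀ i x, w i x ≠ 0) {e : ℕ → ℕ → ℤ} (h : IsGZ n e)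
    {k i : ℕ} (hi : 1 ≤ i) (hik : i ≤ k) (hk : k ≤ n) (h' : IsGZ n (shiftAt i k 1 e)) :
    rowCoeff n w k i e ≠ 0 := by
  rw [rowCoeff]
  refine mul_ne_zero ?_ ?_
  · split_ifs
    · exact one_ne_zero
    · exact hw _ _
  · exact_mod_cast (Real.sqrt_pos.2 (rowRad_pos h hi hik hk h')).ne'

theorem rowCoeff_exchange (a b : ℕ → ℤ → ℂ) {e : ℕ → ℕ → ℤ} (h : IsGZ n e) {k i l j : ℕ}
    (hi : 1 ≤ i) (hik : i ≤ k) (hk : k ≤ n) (hj : 1 ≤ j) (hjl : j ≤ l) (hl : l ≤ n)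
    (hne : i ≠ j ∨ k ≠ l) (h' : IsGZ n (shiftAt j l (-1) e)) :
    rowCoeff n b l j (shiftAt j l (-1) e) * rowCoeff n a k i (shiftAt j l (-1) e) =
      rowCoeff n a k i e * rowCoeff n b l j (shiftAt j l (-1) (shiftAt i k 1 e)) := by
  set g := shiftAt j l (-1) e with hg
  have he : e = shiftAt j l 1 g := by rw [hg, shiftAt_shiftAt]; simp
  have hc : shiftAt j l (-1) (shiftAt i k 1 e) = shiftAt i k 1 g := by
    rw [shiftAt_comm]
  rw [hc]
  have h1 := rowRad_exchange g hi hik hk hj hjl hl hne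
  rw [← he] at h1
  have h2 := sqrt_mul_sqrt_eq (rowRad_nonneg h' hi hik hk) (rowRad_nonneg h hi hik hk) h1
  have h3 : (Real.sqrt (rowRad n k g i) : ℂ) * (Real.sqrt (rowRad n l g j) : ℂ) =
      (Real.sqrt (rowRad n k e i) : ℂ) * (Real.sqrt (rowRad n l (shiftAt i k 1 g) j) : ℂ) := by
    exact_mod_cast h2
  have h4 : (if k < n then (1 : ℂ) else a i (g i n)) = if k < n then 1 else a i (e i n) := by
    split_ifs with hkn
    · rfl
    · rw [hg, shiftAt_apply, if_neg (by omega), add_zero]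
  have h5 : (if l < n then (1 : ℂ) else b j (shiftAt i k 1 g j n)) =
      if l < n then 1 else b j (g j n) := by
    split_ifs with hln
    · rfl
    · rw [shiftAt_apply, if_neg (by omega), add_zero]
  unfold rowCoeff
  rw [h4, h5]
  linear_combination (if k < n then (1 : ℂ) else a i (e i n)) *
    (if l < n then (1 : ℂ) else b j (g j n)) * h3

/-- Operators of different rows commute, because a step up in one row and a step down in another
have the same coefficients in either order. -/
theorem lie_rowUp_rowDown_of_ne (a b : ℕ → ℤ → ℂ) {k l : ℕ} (hk : k ≤ n) (hl : l ≤ n)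
    (hkl : k ≠ l) : ⁅rowUp n a k, rowDown n b l⁆ = 0 := by
  refine patternSpace_ext fun m => ?_
  rw [rowUp, rowDown, shiftOp_lie_apply m, LinearMap.zero_apply]
  · refine Finset.sum_eq_zero fun i hi => Finset.sum_eq_zero fun j hj => ?_
    rw [Finset.mem_Icc] at hi hj
    by_cases hg : IsGZ n (shiftAt j l (-1) (shiftAt i k 1 m.toInt))
    · rw [rowCoeff_exchange a b m.isGZ hi.1 hi.2 hk hj.1 hj.2 hl (Or.inr hkl)
        (m.isGZ.of_raise_lower (Or.inr hkl) hg).2, sub_self, zero_smul]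
    · rw [ket_of_not_isGZ _ hg, smul_zero]
  · intro i _ j _
    exact shiftAt_comm _ _ _ _ _ _ _
  · intro i _ j _ h1 h2
    exact absurd (m.isGZ.of_raise_lower (Or.inr hkl) h2).1 h1
  · intro i _ j _ h1 h2
    exact absurd (m.isGZ.of_raise_lower (Or.inr hkl) h2).2 h1

theorem rowCoeff_mul_rowCoeff (a b : ℕ → ℤ → ℂ) {k i : ℕ} {e : ℕ → ℕ → ℤ}
    (h : 0 ≤ rowRad n k e i) : rowCoeff n a k i e * rowCoeff n b k i e =
      (if k < n then 1 else a i (e i n) * b i (e i n)) * (rowRad n k e i : ℂ) := by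
  have h1 : (Real.sqrt (rowRad n k e i) : ℂ) * (Real.sqrt (rowRad n k e i) : ℂ) =
      (rowRad n k e i : ℂ) := by
    exact_mod_cast Real.mul_self_sqrt h
  unfold rowCoeff
  rw [← h1]
  split_ifs <;> ring

theorem lie_rowUp_rowDown_self (a b : ℕ → ℤ → ℂ) {k : ℕ} (hk : k ≤ n) (m : GZPattern n) :
    ⁅rowUp n a k, rowDown n b k⁆ (patternVec m) = (∑ i ∈ Finset.Icc 1 k,
      ((if k < n then 1 else a i (m.toInt i n - 1) * b i (m.toInt i n - 1)) *
          (rowRad n k (shiftAt i k (-1) m.toInt) i : ℂ) -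
        (if k < n then 1 else a i (m.toInt i n) * b i (m.toInt i n)) *
          (rowRad n k m.toInt i : ℂ))) • patternVec m := by
  rw [rowUp, rowDown, shiftOp_lie_apply m, Finset.sum_smul]
  · refine Finset.sum_congr rfl fun i hi => ?_
    rw [Finset.sum_eq_single_of_mem i hi]
    · rw [Finset.mem_Icc] at hi
      rw [shiftAt_shiftAt, neg_add_cancel, shiftAt_zero, ket_toInt]
      congr 1
      have h1 : 0 ≤ rowRad n k (shiftAt i k (-1) m.toInt) i := by
        by_cases hg : IsGZ n (shiftAt i k (-1) m.toInt)
        · exact rowRad_nonneg hg hi.1 hi.2 hk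
        · exact (rowRad_lower_eq_zero m.isGZ hi.1 hi.2 hk hg).ge
      rw [mul_comm, rowCoeff_mul_rowCoeff a b h1,
        rowCoeff_mul_rowCoeff a b (rowRad_nonneg m.isGZ hi.1 hi.2 hk)]
      congr 2
      split_ifs with hkn
      · rfl
      · obtain rfl : k = n := by omega
        rw [shiftAt_apply, if_pos ⟨rfl, rfl⟩, ← sub_eq_add_neg]
    · intro j hj hne
      rw [Finset.mem_Icc] at hi hj
      by_cases hg : IsGZ n (shiftAt j k (-1) (shiftAt i k 1 m.toInt))
      · rw [rowCoeff_exchange a b m.isGZ hi.1 hi.2 hk hj.1 hj.2 hk (Or.inl hne.symm)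
          (m.isGZ.of_raise_lower (Or.inl hne.symm) hg).2, sub_self, zero_smul]
      · rw [ket_of_not_isGZ _ hg, smul_zero]
  · intro i _ j _
    exact shiftAt_comm _ _ _ _ _ _ _
  · intro i hi j _ h1 h2
    rw [Finset.mem_Icc] at hi
    rw [rowCoeff, rowRad_eq_zero m.isGZ hi.1 hi.2 hk h1]
    simp
  · intro i _ j hj h1 h2
    rw [Finset.mem_Icc] at hj
    rw [rowCoeff, rowRad_lower_eq_zero m.isGZ hj.1 hj.2 hk h1]
    simp

theorem rowSum_cast (m : GZPattern n) (k : ℕ) :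
    (rowSum m k : ℂ) = ∑ i ∈ Finset.Icc 1 k, (m.toInt i k : ℂ) := by
  simp [rowSum, GZPattern.toInt]

/-- The relation `[e_k, f_k] = h_k` below the top row. -/
theorem lie_rowUp_rowDown (a b : ℕ → ℤ → ℂ) (p : ℂ) {k : ℕ} (hk : 1 ≤ k) (hkn : k < n) :
    ⁅rowUp n a k, rowDown n b k⁆ = weightOp n p k - weightOp n p (k + 1) := by
  refine patternSpace_ext fun m => ?_
  rw [lie_rowUp_rowDown_self a b hkn.le, LinearMap.sub_apply, weightOp_apply, weightOp_apply,
    ← sub_smul]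
  congr 1
  have := congrArg (fun x : ℝ => (x : ℂ)) (gzRad_sum m.isGZ hk hkn)
  simp only [hkn, if_true, one_mul, rowRad]
  push_cast at this
  simp only [this, rowSum_cast, Nat.add_sub_cancel]
  ring

/-- The relation `[f_n^+, f_n^-] = 2 E_{nn}`. -/
theorem lie_rowUp_rowDown_top (a b : ℕ → ℤ → ℂ) (p : ℂ) (hn : 1 ≤ n)
    (hab : ∀ i x, a i x * b i x = topFactor p i x) :
    ⁅rowUp n a n, rowDown n b n⁆ = (2 : ℂ) • weightOp n p n := by
  refine patternSpace_ext fun m => ?_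
  rw [lie_rowUp_rowDown_self a b le_rfl, LinearMap.smul_apply, weightOp_apply, smul_smul]
  congr 1
  simp only [lt_irrefl, if_false, rowRad, hab]
  rw [topRad_sum hn m.isGZ p, rowSum_cast, rowSum_cast]
  ring

/-- Operators that raise entries of rows that are not adjacent commute. -/
theorem lie_rowUp_rowUp_of_far (a : ℕ → ℤ → ℂ) {k l : ℕ} (hl : l ≤ n)
    (hkl : k + 1 < l) : ⁅rowUp n a k, rowUp n a l⁆ = 0 := by
  refine patternSpace_ext fun m => ?_
  rw [rowUp, rowUp, shiftOp_lie_apply m, LinearMap.zero_apply]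
  · refine Finset.sum_eq_zero fun i hi => Finset.sum_eq_zero fun j hj => ?_
    rw [Finset.mem_Icc] at hi hj
    have hkn : k < n := by omega
    have e1 : rowCoeff n a k i (shiftAt j l 1 m.toInt) = rowCoeff n a k i m.toInt := by
      simp only [rowCoeff, rowRad, hkn, if_true]
      rw [gzRad_shift_far _ _ (by omega) (by omega) (by omega)]
    have e2 : rowCoeff n a l j (shiftAt i k 1 m.toInt) = rowCoeff n a l j m.toInt := by
      unfold rowCoeff rowRad
      split_ifs
      · rw [gzRad_shift_far _ _ (by omega) (by omega) (by omega)]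
      · rw [topRad_shift_far _ _ _ (by omega) (by omega), shiftAt_apply, if_neg (by omega),
          add_zero]
    rw [e1, e2, mul_comm, sub_self, zero_smul]
  · intro i _ j _
    exact shiftAt_comm _ _ _ _ _ _ _
  · intro i hi j hj h1 h2
    rw [Finset.mem_Icc] at hi hj
    refine absurd ((m.isGZ.raise_iff hi.1 hi.2 (by omega)).2 ⟨fun hkn => ?_, fun h3 => ?_⟩) h1
    · have := h2.upper i k hi.1 hi.2 hkn
      simp only [shiftAt_apply, and_self, true_and, if_true] at this
      split_ifs at this <;> omega
    · have := h2.lower (i - 1) (k - 1) (by omega) (by omega) (by omega)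
      rw [Nat.sub_add_cancel (by omega), Nat.sub_add_cancel (by omega)] at this
      simp only [shiftAt_apply, and_self, if_true] at this
      split_ifs at this <;> omega
  · intro i hi j hj h1 h2
    rw [Finset.mem_Icc] at hi hj
    refine absurd ((m.isGZ.raise_iff hj.1 hj.2 (by omega)).2 ⟨fun hkn => ?_, fun h3 => ?_⟩) h1
    · have := h2.upper j l hj.1 hj.2 hkn
      simp only [shiftAt_apply, and_self, true_and, if_true] at this
      split_ifs at this <;> omega
    · have := h2.lower (j - 1) (l - 1) (by omega) (by omega) (by omega)
      rw [Nat.sub_add_cancel (by omega), Nat.sub_add_cancel (by omega)] at this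
      simp only [shiftAt_apply, and_self, if_true] at this
      split_ifs at this <;> omega

/-- An operator that adds `c r` to the `r`-th row sum of every pattern is a weight vector. -/
theorem lie_weightOp_shiftOp {ι : Type*} (I : Finset ι) (σ : ι → (ℕ → ℕ → ℤ) → ℕ → ℕ → ℤ)
    (d : ι → (ℕ → ℕ → ℤ) → ℂ) (p : ℂ) (c : ℕ → ℤ) (r : ℕ)
    (h : ∀ i ∈ I, ∀ e s, ∑ a ∈ Finset.Icc 1 s, σ i e a s = ∑ a ∈ Finset.Icc 1 s, e a s + c s) :
    ⁅weightOp n p r, (shiftOp I σ d : Module.End ℂ (PatternSpace n))⁆ =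
      ((c r : ℂ) - c (r - 1)) • shiftOp I σ d := by
  refine patternSpace_ext fun m => ?_
  rw [Ring.lie_def, LinearMap.sub_apply, Module.End.mul_apply, Module.End.mul_apply,
    LinearMap.smul_apply, weightOp_apply, map_smul, shiftOp_apply, map_sum, Finset.smul_sum,
    Finset.smul_sum, ← Finset.sum_sub_distrib]
  refine Finset.sum_congr rfl fun i hi => ?_
  rw [map_smul]
  by_cases hg : IsGZ n (σ i m.toInt)
  · have key : ∀ s, (rowSum hg.pattern s : ℂ) = rowSum m s + c s := by
      intro s
      rw [rowSum_cast, rowSum_cast, hg.toInt_pattern]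
      exact_mod_cast h i hi m.toInt s
    rw [ket_of_isGZ _ hg, weightOp_apply, smul_smul, smul_smul, smul_smul, ← sub_smul, key, key]
    congr 1
    ring
  · rw [ket_of_not_isGZ _ hg]
    simp

theorem sum_shiftAt {i k : ℕ} (hi : 1 ≤ i) (hik : i ≤ k) (c : ℤ) (e : ℕ → ℕ → ℤ) (s : ℕ) :
    ∑ a ∈ Finset.Icc 1 s, shiftAt i k c e a s =
      ∑ a ∈ Finset.Icc 1 s, e a s + if s = k then c else 0 := by
  simp only [shiftAt_apply, Finset.sum_add_distrib]
  congr 1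
  by_cases hs : s = k
  · subst hs
    simp [hi, hik]
  · simp [hs]

theorem lie_weightOp_rowUp (w : ℕ → ℤ → ℂ) (p : ℂ) (r k : ℕ) :
    ⁅weightOp n p r, rowUp n w k⁆ =
      ((if r = k then 1 else 0) - (if r - 1 = k then 1 else 0) : ℂ) • rowUp n w k := by
  have := lie_weightOp_shiftOp (n := n) (Finset.Icc 1 k) (fun i => shiftAt i k 1)
    (rowCoeff n w k) p (fun s => if s = k then 1 else 0) r
    (fun i hi e s => sum_shiftAt (Finset.mem_Icc.1 hi).1 (Finset.mem_Icc.1 hi).2 1 e s)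
  rw [rowUp, this]
  push_cast
  rfl

end chevalley

/-! ### The Clebsch–Gordan coefficients as iterated commutators -/

/-- The operator with matrix elements given by Clebsch–Gordan coefficients times reduced matrix
elements `G`, raising one entry of each of the rows `j, …, n`. -/
def raiseOp (n : ℕ) (G : ℕ → (ℕ → ℤ) → ℂ) (j : ℕ) : Module.End ℂ (PatternSpace n) :=
  shiftOp (Finset.univ : Finset (IndexPath n j)) (fun s => s.shift 1)
    fun s e => (clebschGordan e s : ℂ) * G (s.idx n) fun i => e i n

/-- The transpose of `raiseOp`. -/
def lowerOp (n : ℕ) (G : ℕ → (ℕ → ℤ) → ℂ) (j : ℕ) : Module.End ℂ (PatternSpace n) :=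
  shiftOp (Finset.univ : Finset (IndexPath n j)) (fun s => s.shift (-1))
    fun s e => (clebschGordan (s.shift (-1) e) s : ℂ) * G (s.idx n) fun i => s.shift (-1) e i n

namespace IndexPath

variable {n j : ℕ}

theorem shift_apply (s : IndexPath n j) (c : ℤ) (e : ℕ → ℕ → ℤ) (i r : ℕ) :
    s.shift c e i r = e i r + if r ∈ Finset.Icc j n ∧ i = s.idx r then c else 0 := by
  unfold shift
  split_ifs <;> simp

theorem shift_shift (s : IndexPath n j) (c c' : ℤ) (e : ℕ → ℕ → ℤ) :
    s.shift c (s.shift c' e) = s.shift (c + c') e := by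
  funext i r
  simp only [shift_apply]
  split_ifs <;> ring

@[simp]
theorem shift_zero (s : IndexPath n j) (e : ℕ → ℕ → ℤ) : s.shift 0 e = e := by
  funext i r
  simp [shift_apply]

theorem idx_mem (s : IndexPath n j) {r : ℕ} (hr : r ∈ Finset.Icc j n) :
    1 ≤ s.idx r ∧ s.idx r ≤ r := by
  rw [idx, dif_pos hr]
  exact Finset.mem_Icc.1 (s ⟨r, hr⟩).2

/-- The index path with `i_j = b`, followed by an index path from row `j + 1` on. -/
def cons (b : ↥(Finset.Icc 1 j)) (s : IndexPath n (j + 1)) : IndexPath n j := fun r =>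
  if h : (r : ℕ) = j then ⟨b, by rw [h]; exact b.2⟩
  else s ⟨r, by have := Finset.mem_Icc.1 r.2; exact Finset.mem_Icc.2 ⟨by omega, by omega⟩⟩

/-- Splitting off the first index of an index path. -/
def consEquiv (hj : j ≤ n) : ↥(Finset.Icc 1 j) × IndexPath n (j + 1) ≃ IndexPath n j where
  toFun q := cons q.1 q.2
  invFun s := (s ⟨j, Finset.mem_Icc.2 ⟨le_rfl, hj⟩⟩, fun r => s ⟨r, by
    have := Finset.mem_Icc.1 r.2; exact Finset.mem_Icc.2 ⟨by omega, by omega⟩⟩)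
  left_inv := by
    rintro ⟨b, s⟩
    refine Prod.ext ?_ ?_
    · simp [cons]
    · funext r
      have := Finset.mem_Icc.1 r.2
      have h : (r : ℕ) ≠ j := by omega
      simp [cons, h]
  right_inv := by
    intro s
    funext r
    by_cases h : (r : ℕ) = j
    · obtain ⟨r, hr⟩ := r
      simp only at h
      subst h
      simp [cons]
    · simp [cons, h]

theorem idx_cons_self (hj : j ≤ n) (b : ↥(Finset.Icc 1 j)) (s : IndexPath n (j + 1)) :
    (cons b s).idx j = b := by
  rw [idx, dif_pos (Finset.mem_Icc.2 ⟨le_rfl, hj⟩)]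
  simp [cons]

theorem idx_cons_of_lt (b : ↥(Finset.Icc 1 j)) (s : IndexPath n (j + 1)) {r : ℕ} (hr : j < r) :
    (cons b s).idx r = s.idx r := by
  unfold idx
  by_cases h : r ≤ n
  · rw [dif_pos (Finset.mem_Icc.2 ⟨hr.le, h⟩), dif_pos (Finset.mem_Icc.2 ⟨hr, h⟩)]
    simp [cons, hr.ne']
  · rw [dif_neg (by simp [h]), dif_neg (by simp [h])]

theorem shift_cons (hj : j ≤ n) (b : ↥(Finset.Icc 1 j)) (s : IndexPath n (j + 1)) (c : ℤ)
    (e : ℕ → ℕ → ℤ) : (cons b s).shift c e = shiftAt b j c (s.shift c e) := by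
  funext i r
  rw [shift_apply, shiftAt_apply, shift_apply]
  rcases lt_trichotomy r j with h | rfl | h
  · rw [if_neg (by simp; omega), if_neg (by simp; omega), if_neg (by omega)]
    ring
  · rw [idx_cons_self hj, if_neg (by simp : ¬ (r ∈ Finset.Icc (r + 1) n ∧ i = s.idx r))]
    simp [hj]
  · rw [idx_cons_of_lt b s h, if_neg (by omega : ¬ (i = (b : ℕ) ∧ r = j))]
    simp [h.le, Nat.succ_le_of_lt h]

end IndexPath

section

variable {n : ℕ}

theorem isTranspose_raiseOp (G : ℕ → (ℕ → ℤ) → ℂ) (j : ℕ) :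
    IsTranspose (raiseOp n G j) (lowerOp n G j) :=
  isTranspose_shiftOp (fun s e => by simp [IndexPath.shift_shift])
    (fun s e => by simp [IndexPath.shift_shift])

/-- The reduced matrix elements `G` are those for the weights `w`: the value of `G i` at the top row
of a pattern is the weight of its `i`-th entry times the square root of the radicand. -/
def HasWeights (n : ℕ) (G : ℕ → (ℕ → ℤ) → ℂ) (w : ℕ → ℤ → ℂ) : Prop :=
  ∀ e, IsGZ n e → ∀ i, 1 ≤ i → i ≤ n →
    G i (fun a => e a n) = w i (e i n) * (Real.sqrt (redRad n e i) : ℂ)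

theorem raiseOp_top {G : ℕ → (ℕ → ℤ) → ℂ} {w : ℕ → ℤ → ℂ} (h : HasWeights n G w) :
    raiseOp n G n = rowUp n w n := by
  refine patternSpace_ext fun m => ?_
  rw [raiseOp, rowUp, shiftOp_apply, shiftOp_apply]
  have hnn : n ∈ Finset.Icc n n := by simp
  rw [← Finset.sum_coe_sort (Finset.Icc 1 n)]
  refine Fintype.sum_bijective (fun s : IndexPath n n => s ⟨n, hnn⟩) ⟨?_, ?_⟩ _ _ ?_
  · intro s s' hs
    funext ⟨r, hr⟩
    obtain rfl : r = n := by simpa using hr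
    exact hs
  · intro b
    refine ⟨fun r => ⟨b, by rw [show (r : ℕ) = n by simpa using r.2]; exact b.2⟩, ?_⟩
    simp
  · intro s
    have hidx : s.idx n = (s ⟨n, hnn⟩ : ℕ) := by rw [IndexPath.idx, dif_pos hnn]
    have hmem := s.idx_mem hnn
    have hshift : s.shift 1 m.toInt = shiftAt (s.idx n) n 1 m.toInt := by
      funext i r
      rw [IndexPath.shift_apply, shiftAt_apply]
      refine congrArg _ (if_congr ?_ rfl rfl)
      constructor
      · rintro ⟨h1, h2⟩
        obtain rfl : r = n := by simpa using h1
        exact ⟨h2, rfl⟩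
      · rintro ⟨h1, rfl⟩
        exact ⟨hnn, h1⟩
    rw [← hidx, hshift]
    congr 1
    rw [h _ m.isGZ _ hmem.1 hmem.2, rowCoeff, rowRad, if_neg (lt_irrefl n), if_neg (lt_irrefl n),
      topRad_eq m.isGZ hmem.1 hmem.2,
      Real.sqrt_mul (lastRad_nonneg m.isGZ hmem.1 hmem.2 le_rfl), clebschGordan,
      Finset.Icc_eq_empty (by omega), Finset.prod_empty, one_mul, isoscalarLast_eq]
    push_cast
    ring

/-- The radicand of `isoscalar`. -/
def isoRad (e : ℕ → ℕ → ℤ) (t a b : ℕ) : ℝ :=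
  ((∏ k ∈ (Finset.Icc 1 (t - 1)).erase b, (ell e k (t - 1) - ell e a t - 1)) *
      ∏ k ∈ (Finset.Icc 1 t).erase a, (ell e k t - ell e b (t - 1))) /
    ((∏ k ∈ (Finset.Icc 1 t).erase a, (ell e k t - ell e a t)) *
      ∏ k ∈ (Finset.Icc 1 (t - 1)).erase b, (ell e k (t - 1) - ell e b (t - 1) - 1))

theorem isoscalar_eq (e : ℕ → ℕ → ℤ) (t a b : ℕ) :
    isoscalar e t a b = Real.sqrt (isoRad e t a b) := rfl

theorem sqrt_mul_sqrt_of_eq_sq_mul {x y z I J : ℝ} (hx : 0 ≤ x) (hJ : 0 ≤ J)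
    (h : x * y = z ^ 2 * (I * J)) : Real.sqrt x * Real.sqrt y =
      |z| * (Real.sqrt I * Real.sqrt J) := by
  rw [← Real.sqrt_mul hx, h, Real.sqrt_mul (sq_nonneg z), Real.sqrt_sq_eq_abs, Real.sqrt_mul' _ hJ]

/-- Raising an entry of row `j + 1`, then an entry of row `j`. -/
theorem isoscalarLast_mul_gzCoeff {e : ℕ → ℕ → ℤ} (h : IsGZ n e) {j a b : ℕ} (hj : j < n)
    (ha : 1 ≤ a) (haj : a ≤ j + 1) (hb : 1 ≤ b) (hbj : b ≤ j) :
    isoscalarLast e (j + 1) a * gzCoeff (shiftAt a (j + 1) 1 e) j b =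
      |ell e a (j + 1) + 1 - ell e b j| * (isoscalar e (j + 1) a b * isoscalarLast e j b) := by
  rw [isoscalarLast_eq, gzCoeff_eq, isoscalar_eq, isoscalarLast_eq]
  refine sqrt_mul_sqrt_of_eq_sq_mul (lastRad_nonneg h ha haj hj)
    (lastRad_nonneg h hb hbj hj.le) ?_
  have e0 : ∀ c d, ell (shiftAt a (j + 1) 1 e) c d =
      ell e c d + if c = a ∧ d = j + 1 then 1 else 0 := fun c d => by
    rw [ell_shiftAt]; push_cast; rfl
  have hbm : b ∈ Finset.Icc 1 j := Finset.mem_Icc.2 ⟨hb, hbj⟩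
  have ham : a ∈ Finset.Icc 1 (j + 1) := Finset.mem_Icc.2 ⟨ha, haj⟩
  have h1 : j ≠ j + 1 := by omega
  have h2 : j - 1 ≠ j + 1 := by omega
  simp only [lastRad, gzRad, isoRad, Nat.add_sub_cancel, e0, h1, h2, and_false, if_false, add_zero]
  rw [← Finset.mul_prod_erase _ _ hbm, prod_eq_mul_erase_of_mem ham _
    (fun k => ell e k (j + 1) - ell e b j) (fun k _ hk => by simp [hk]), Finset.prod_mul_distrib]
  simp only [and_self, if_true]
  ring

/-- Raising an entry of row `j`, then an entry of row `j + 1`. -/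
theorem gzCoeff_mul_isoscalarLast {e : ℕ → ℕ → ℤ} (h : IsGZ n e) {j a b : ℕ} (hj : j < n)
    (ha : 1 ≤ a) (haj : a ≤ j + 1) (hb : 1 ≤ b) (hbj : b ≤ j) :
    gzCoeff e j b * isoscalarLast (shiftAt b j 1 e) (j + 1) a =
      |ell e a (j + 1) - ell e b j| * (isoscalar e (j + 1) a b * isoscalarLast e j b) := by
  rw [isoscalarLast_eq, gzCoeff_eq, isoscalar_eq, isoscalarLast_eq]
  refine sqrt_mul_sqrt_of_eq_sq_mul (gzRad_nonneg h hb hbj hj)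
    (lastRad_nonneg h hb hbj hj.le) ?_
  have e0 : ∀ c d, ell (shiftAt b j 1 e) c d =
      ell e c d + if c = b ∧ d = j then 1 else 0 := fun c d => by
    rw [ell_shiftAt]; push_cast; rfl
  have hbm : b ∈ Finset.Icc 1 j := Finset.mem_Icc.2 ⟨hb, hbj⟩
  have ham : a ∈ Finset.Icc 1 (j + 1) := Finset.mem_Icc.2 ⟨ha, haj⟩
  have h1 : j + 1 ≠ j := by omega
  simp only [lastRad, gzRad, isoRad, Nat.add_sub_cancel, e0, h1, and_false, if_false, add_zero]
  rw [← Finset.mul_prod_erase _ _ ham, prod_eq_mul_erase_of_mem hbm _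
    (fun k => ell e k j - ell e a (j + 1) - 1) (fun k _ hk => by simp [hk]),
    Finset.prod_mul_distrib]
  simp only [and_self, if_true]
  ring

theorem abs_sub_abs_eq_sgn {e : ℕ → ℕ → ℤ} (h : IsGZ n e) {j a b : ℕ} (hj : j < n)
    (ha : 1 ≤ a) (haj : a ≤ j + 1) (hb : 1 ≤ b) (hbj : b ≤ j) :
    |ell e a (j + 1) + 1 - ell e b j| - |ell e a (j + 1) - ell e b j| = sgn a b := by
  rw [sgn]
  split_ifs with hab
  · have h1 := h.ell_le_above ha hab hbj hj
    have h2 : (a : ℝ) ≤ b := by exact_mod_cast hab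
    rw [abs_of_nonneg (by linarith), abs_of_nonneg (by linarith)]
    ring
  · have h1 := h.ell_above_le hb (not_le.1 hab) haj hj
    have h2 : (b : ℝ) + 1 ≤ a := by exact_mod_cast not_le.1 hab
    rw [abs_of_nonpos (by linarith), abs_of_nonpos (by linarith)]
    ring

/-- The product over the rows above row `j + 1` of the isoscalar factors of an index path that
starts in row `j + 1`. -/
def isoscalarProd {j : ℕ} (e : ℕ → ℕ → ℤ) (s : IndexPath n (j + 1)) : ℝ :=
  ∏ t ∈ Finset.Icc (j + 1 + 1) n,
    (sgn (s.idx t) (s.idx (t - 1)) * isoscalar e t (s.idx t) (s.idx (t - 1)))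

theorem clebschGordan_cons {j : ℕ} (hj : j < n) (e : ℕ → ℕ → ℤ) (b : ↥(Finset.Icc 1 j))
    (s : IndexPath n (j + 1)) : clebschGordan e (IndexPath.cons b s) =
      isoscalarProd e s * (sgn (s.idx (j + 1)) b *
        (isoscalar e (j + 1) (s.idx (j + 1)) b * isoscalarLast e j b)) := by
  rw [clebschGordan, ← Finset.mul_prod_Ioc_eq_prod_Icc (Nat.succ_le_of_lt hj),
    IndexPath.idx_cons_of_lt b s (Nat.lt_succ_self j), Nat.succ_eq_add_one, Nat.add_sub_cancel,
    IndexPath.idx_cons_self hj.le]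
  have : ∏ t ∈ Finset.Ioc (j + 1) n, (sgn ((IndexPath.cons b s).idx t)
      ((IndexPath.cons b s).idx (t - 1)) * isoscalar e t ((IndexPath.cons b s).idx t)
      ((IndexPath.cons b s).idx (t - 1))) = isoscalarProd e s := by
    rw [isoscalarProd]
    refine Finset.prod_congr (by ext; simp) fun t ht => ?_
    have ht := (Finset.mem_Icc.1 ht).1
    rw [IndexPath.idx_cons_of_lt b s (by omega), IndexPath.idx_cons_of_lt b s (by omega)]
  rw [this]
  ring

theorem isoscalarProd_shiftAt {j : ℕ} (e : ℕ → ℕ → ℤ) (b : ℕ) (s : IndexPath n (j + 1)) :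
    isoscalarProd (shiftAt b j 1 e) s = isoscalarProd e s := by
  refine Finset.prod_congr rfl fun t ht => ?_
  have ht := (Finset.mem_Icc.1 ht).1
  have h1 : t ≠ j := by omega
  have h2 : t - 1 ≠ j := by omega
  simp only [isoscalar, ell_shiftAt, h1, h2, and_false, if_false, add_zero]

theorem gzCoeff_shift {j : ℕ} (hj : j < n) (e : ℕ → ℕ → ℤ) (s : IndexPath n (j + 1)) (b : ℕ) :
    gzCoeff (s.shift 1 e) j b = gzCoeff (shiftAt (s.idx (j + 1)) (j + 1) 1 e) j b := by
  have e1 : ∀ c, ell (s.shift 1 e) c (j + 1) =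
      ell (shiftAt (s.idx (j + 1)) (j + 1) 1 e) c (j + 1) := fun c => by
    rw [ell, ell, IndexPath.shift_apply, shiftAt_apply]
    simp [Nat.succ_le_of_lt hj]
  have e2 : ∀ c r, r ≤ j → ell (s.shift 1 e) c r =
      ell (shiftAt (s.idx (j + 1)) (j + 1) 1 e) c r := fun c r hr => by
    rw [ell, ell, IndexPath.shift_apply, shiftAt_apply, if_neg (by simp; omega),
      if_neg (by omega)]
  simp only [gzCoeff, e1, e2 _ j le_rfl, e2 _ (j - 1) (Nat.sub_le j 1)]

/-- The recursion `f_j^+ = [e_j, f_{j+1}^+]` for the operators built from Clebsch–Gordan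
coefficients. For fixed indices, the two orders of raising differ by the factors
`|l_{a,j+1} + 1 - l_{bj}|` and `|l_{a,j+1} - l_{bj}|`, whose difference is the sign `S(a, b)`. -/
theorem raiseOp_eq_lie (w : ℕ → ℤ → ℂ) (G : ℕ → (ℕ → ℤ) → ℂ) {j : ℕ} (hj : j < n) :
    raiseOp n G j = ⁅rowUp n w j, raiseOp n G (j + 1)⁆ := by
  refine patternSpace_ext fun m => ?_
  have hjm : j + 1 ∈ Finset.Icc (j + 1) n := Finset.mem_Icc.2 ⟨le_rfl, hj⟩
  have hc1 : ∀ (b : ℕ), 1 ≤ b → b ≤ j → ∀ s : IndexPath n (j + 1),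
      rowCoeff n w j b m.toInt * ((clebschGordan (shiftAt b j 1 m.toInt) s : ℂ) *
        G (s.idx n) fun i => shiftAt b j 1 m.toInt i n) =
      ((isoscalarProd m.toInt s * (|ell m.toInt (s.idx (j + 1)) (j + 1) - ell m.toInt b j| *
        (isoscalar m.toInt (j + 1) (s.idx (j + 1)) b * isoscalarLast m.toInt j b)) : ℝ) : ℂ) *
          G (s.idx n) fun i => m.toInt i n := by
    intro b hb hbj s
    have hs := s.idx_mem hjm
    have hG : (fun i => shiftAt b j 1 m.toInt i n) = fun i => m.toInt i n := by
      funext i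
      rw [shiftAt_apply, if_neg (by omega), add_zero]
    rw [hG, ← gzCoeff_mul_isoscalarLast m.isGZ hj hs.1 hs.2 hb hbj, rowCoeff, rowRad, if_pos hj,
      if_pos hj, ← gzCoeff_eq]
    have : clebschGordan (shiftAt b j 1 m.toInt) s = isoscalarProd m.toInt s *
        isoscalarLast (shiftAt b j 1 m.toInt) (j + 1) (s.idx (j + 1)) := by
      rw [← isoscalarProd_shiftAt m.toInt b s]
      rfl
    rw [this]
    push_cast
    ring
  have hc2 : ∀ (b : ℕ), 1 ≤ b → b ≤ j → ∀ s : IndexPath n (j + 1),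
      ((clebschGordan m.toInt s : ℂ) * G (s.idx n) fun i => m.toInt i n) *
        rowCoeff n w j b (s.shift 1 m.toInt) =
      ((isoscalarProd m.toInt s * (|ell m.toInt (s.idx (j + 1)) (j + 1) + 1 - ell m.toInt b j| *
        (isoscalar m.toInt (j + 1) (s.idx (j + 1)) b * isoscalarLast m.toInt j b)) : ℝ) : ℂ) *
          G (s.idx n) fun i => m.toInt i n := by
    intro b hb hbj s
    have hs := s.idx_mem hjm
    rw [← isoscalarLast_mul_gzCoeff m.isGZ hj hs.1 hs.2 hb hbj, rowCoeff, rowRad, if_pos hj,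
      if_pos hj, ← gzCoeff_eq, gzCoeff_shift hj]
    have : clebschGordan m.toInt s = isoscalarProd m.toInt s *
        isoscalarLast m.toInt (j + 1) (s.idx (j + 1)) := rfl
    rw [this]
    push_cast
    ring
  have hcomm : ∀ (b : ℕ) (s : IndexPath n (j + 1)),
      s.shift 1 (shiftAt b j 1 m.toInt) = shiftAt b j 1 (s.shift 1 m.toInt) := by
    intro b s
    funext i r
    simp only [shiftAt_apply, IndexPath.shift_apply]
    ring
  rw [raiseOp, rowUp, raiseOp, shiftOp_lie_apply m, shiftOp_apply, ← Finset.sum_product',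
    ← Finset.sum_coe_sort (Finset.Icc 1 j ×ˢ (Finset.univ : Finset (IndexPath n (j + 1)))),
    ← (IndexPath.consEquiv hj.le).sum_comp]
  · refine Fintype.sum_bijective (fun q : ↥(Finset.Icc 1 j) × IndexPath n (j + 1) =>
      (⟨(q.1, q.2), by simp⟩ :
        ↥((Finset.Icc 1 j) ×ˢ (Finset.univ : Finset (IndexPath n (j + 1)))))) ⟨?_, ?_⟩ _ _ ?_
    · rintro ⟨b, s⟩ ⟨b', s'⟩ hh
      simp only [Subtype.mk.injEq, Prod.mk.injEq] at hh
      exact Prod.ext (Subtype.ext hh.1) hh.2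
    · rintro ⟨⟨b, s⟩, hb⟩
      exact ⟨(⟨b, (Finset.mem_product.1 hb).1⟩, s), rfl⟩
    · rintro ⟨b, s⟩
      have hb := Finset.mem_Icc.1 b.2
      have hs := s.idx_mem hjm
      simp only [IndexPath.consEquiv, Equiv.coe_fn_mk]
      rw [IndexPath.shift_cons hj.le, hcomm, hc1 b hb.1 hb.2, hc2 b hb.1 hb.2, ← sub_mul,
        IndexPath.idx_cons_of_lt b s hj, clebschGordan_cons hj,
        ← abs_sub_abs_eq_sgn m.isGZ hj hs.1 hs.2 hb.1 hb.2]
      congr 2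
      push_cast
      ring
  · intro b _ s _
    exact hcomm b s
  · intro b hb s _ h1 h2
    rw [Finset.mem_Icc] at hb
    have hs := s.idx_mem hjm
    rw [hc1 b hb.1 hb.2]
    -- raising row `j` alone can only fail because `m_{bj} = m_{b,j+1}`, and then `i_{j+1} = b`
    have h3 : s.idx (j + 1) = b ∧ m.toInt b j = m.toInt b (j + 1) := by
      have h4 := h2.upper b j hb.1 hb.2 hj
      have hj1 : ¬ (j + 1 ≤ j) := by omega
      have hj2 : ¬ (j + 1 = j) := by omega
      simp only [IndexPath.shift_apply, shiftAt_apply, Finset.mem_Icc, hj1, hj2, false_and,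
        and_false, if_false, add_zero, and_self, if_true] at h4
      have h5 := m.isGZ.upper b j hb.1 hb.2 hj
      have h6 : ¬ (m.toInt b j < m.toInt b (j + 1)) := by
        intro h6
        refine h1 ((m.isGZ.raise_iff hb.1 hb.2 hj.le).2 ⟨fun _ => h6, fun hb1 => ?_⟩)
        have h7 := h2.lower (b - 1) (j - 1) (by omega) (by omega) (by omega)
        rw [Nat.sub_add_cancel (by omega), Nat.sub_add_cancel (by omega)] at h7
        have hj3 : ¬ (j + 1 ≤ j - 1) := by omega
        have hj4 : ¬ (j - 1 = j) := by omega
        simp only [IndexPath.shift_apply, shiftAt_apply, Finset.mem_Icc, hj1, hj3, hj4, false_and,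
          and_false, if_false, add_zero, and_self, if_true] at h7
        omega
      split_ifs at h4 with h7
      · exact ⟨h7.2.symm, by omega⟩
      · omega
    have h4 : ell m.toInt (s.idx (j + 1)) (j + 1) - ell m.toInt b j = 0 := by
      rw [h3.1, ell, ell, h3.2, sub_self]
    rw [h4]
    simp
  · intro b hb s _ h1 h2
    rw [Finset.mem_Icc] at hb
    have hs := s.idx_mem hjm
    rw [hc2 b hb.1 hb.2]
    rw [hcomm] at h2
    -- the other rows alone can only fail because `i_{j+1} = b + 1` and `m_{b+1,j+1} = m_{bj}`
    have h3 : s.idx (j + 1) = b + 1 ∧ m.toInt (b + 1) (j + 1) = m.toInt b j := by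
      by_contra h3
      refine h1 ⟨fun i r hir => ?_, fun i r => ?_, fun i r hi hir hr => ?_,
        fun i r hi hir hr => ?_⟩
      · have := h2.zeros i r hir
        rw [shiftAt_apply, if_neg (by omega)] at this
        simpa using this
      · have := m.isGZ.nonneg i r
        rw [IndexPath.shift_apply]
        split_ifs <;> omega
      · have h4 := h2.upper i r hi hir hr
        rw [shiftAt_apply, shiftAt_apply] at h4
        by_cases h5 : i = b ∧ r + 1 = j
        · have h6 := m.isGZ.upper i r hi hir hr
          rw [IndexPath.shift_apply, IndexPath.shift_apply, if_neg (by simp; omega),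
            if_neg (by simp; omega)]
          omega
        · rw [if_neg h5] at h4
          split_ifs at h4 <;> omega
      · have h4 := h2.lower i r hi hir hr
        rw [shiftAt_apply, shiftAt_apply] at h4
        by_cases h5 : i = b ∧ r = j
        · obtain ⟨rfl, rfl⟩ := h5
          have h6 := m.isGZ.lower i r hi hir hr
          rw [IndexPath.shift_apply, IndexPath.shift_apply, if_neg (by simp : ¬ (r ∈
            Finset.Icc (r + 1) n ∧ i = s.idx r))]
          split_ifs with h7
          · have h8 := h7.2
            have : m.toInt (i + 1) (r + 1) ≠ m.toInt i r := fun h9 => h3 ⟨h8.symm, h9⟩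
            omega
          · omega
        · rw [if_neg h5] at h4
          split_ifs at h4 <;> omega
    have h4 : ell m.toInt (s.idx (j + 1)) (j + 1) + 1 - ell m.toInt b j = 0 := by
      rw [h3.1, ell, ell, h3.2]
      push_cast
      ring
    rw [h4]
    simp

end

/-! ### Uniqueness of the vacuum -/

section vacuum

variable {n : ℕ}

/-- The sum of all entries of a pattern. -/
def total (m : GZPattern n) : ℕ := ∑ k ∈ Finset.Icc 1 n, rowSum m k

theorem total_eq_of_toInt {m q : GZPattern n} {i k : ℕ} {c : ℤ} (hi : 1 ≤ i) (hik : i ≤ k)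
    (hk : k ≤ n) (h : q.toInt = shiftAt i k c m.toInt) : (total q : ℤ) = total m + c := by
  have key : ∀ s, (rowSum q s : ℤ) = rowSum m s + if s = k then c else 0 := by
    intro s
    have h1 : ∀ m : GZPattern n, (rowSum m s : ℤ) = ∑ a ∈ Finset.Icc 1 s, m.toInt a s := by
      intro m
      simp [rowSum, GZPattern.toInt]
    rw [h1, h1, h, sum_shiftAt hi hik]
  rw [total, total]
  push_cast
  simp only [key, Finset.sum_add_distrib]
  simp [hk, hi.trans hik]

/-- In the rows `1, …, k`, every entry is as small as the row above it allows. -/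
def IsMinimal (m : GZPattern n) (k : ℕ) : Prop :=
  ∀ i r, 1 ≤ i → i ≤ r → r ≤ k → m.toInt i r = m.toInt (i + 1) (r + 1)

theorem IsMinimal.eq_zero {m : GZPattern n} (h : IsMinimal m n) : m = zeroPattern n := by
  have key : ∀ d i r, r + d = n + 1 → m.toInt i r = 0 := by
    intro d
    induction d with
    | zero => exact fun i r hr => m.isGZ.zeros i r (by omega)
    | succ d ih =>
      intro i r hr
      by_cases hi : 1 ≤ i ∧ i ≤ r
      · rw [h i r hi.1 hi.2 (by omega), ih _ _ (by omega)]
      · exact m.isGZ.zeros i r (by omega)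
  refine GZPattern.toInt_injective ?_
  funext i r
  have h0 : (zeroPattern n).toInt i r = 0 := by simp [GZPattern.toInt, zeroPattern]
  rw [h0]
  by_cases hr : r ≤ n
  · exact key (n + 1 - r) i r (by omega)
  · exact m.isGZ.zeros i r (by omega)

/-- Every `|m)` other than `|0)` is obtained by raising: take the lowest row `k` of `m` that has
an entry larger than the next row requires, and the last such entry in it. Lowering it gives a
pattern, and raising row `k` again gives `|m)` and vectors whose row `k - 1` is not minimal, which
are dealt with by induction on `k`. -/
theorem patternVec_mem_of_rowUp {w : ℕ → ℤ → ℂ} (hw : ∀ i x, w i x ≠ 0)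
    {S : Submodule ℂ (PatternSpace n)} {N : ℕ}
    (h : ∀ (q : GZPattern n) (k : ℕ), 1 ≤ k → k ≤ n → total q < N →
      rowUp n w k (patternVec q) ∈ S)
    (m : GZPattern n) (hm : m ≠ zeroPattern n) (hN : total m = N) : patternVec m ∈ S := by
  suffices hk : ∀ k ≤ n, ∀ m : GZPattern n, total m = N → ¬ IsMinimal m k → patternVec m ∈ S from
    hk n le_rfl m hN fun h' => hm h'.eq_zero
  intro k
  induction k with
  | zero => exact fun _ m _ hm => absurd (fun i r h1 h2 h3 => by omega) hm
  | succ k ih =>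
    intro hk m hN hm
    by_cases hmin : IsMinimal m k
    swap
    · exact ih (by omega) m hN hmin
    -- the last entry of row `k + 1` that is not minimal
    obtain ⟨i, ⟨hi1, hik, hine⟩, hilast⟩ : ∃ i, (1 ≤ i ∧ i ≤ k + 1 ∧
        m.toInt i (k + 1) ≠ m.toInt (i + 1) (k + 2)) ∧
        ∀ i', i < i' → i' ≤ k + 1 → m.toInt i' (k + 1) = m.toInt (i' + 1) (k + 2) := by
      classical
      have hex : ((Finset.Icc 1 (k + 1)).filter fun i =>
          m.toInt i (k + 1) ≠ m.toInt (i + 1) (k + 2)).Nonempty := by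
        by_contra hne
        rw [Finset.not_nonempty_iff_eq_empty, Finset.filter_eq_empty_iff] at hne
        refine hm fun i r h1 h2 h3 => ?_
        rcases h3.lt_or_eq with h3 | rfl
        · exact hmin i r h1 h2 (by omega)
        · simpa using hne (Finset.mem_Icc.2 ⟨h1, h2⟩)
      obtain ⟨i, hi, hmax⟩ := Finset.exists_max_image _ id hex
      rw [Finset.mem_filter, Finset.mem_Icc] at hi
      refine ⟨i, ⟨hi.1.1, hi.1.2, hi.2⟩, fun i' hi' hik' => ?_⟩
      by_contra hc
      have := hmax i' (Finset.mem_filter.2 ⟨Finset.mem_Icc.2 ⟨by omega, hik'⟩, hc⟩)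
      simp only [id] at this
      omega
    have hlt : m.toInt (i + 1) (k + 1 + 1) < m.toInt i (k + 1) := by
      refine lt_of_le_of_ne ?_ (Ne.symm hine)
      rcases hk.lt_or_eq with hk' | hk'
      · exact m.isGZ.lower i (k + 1) hi1 hik hk'
      · rw [m.isGZ.zeros (i + 1) (k + 1 + 1) (by omega)]
        exact m.isGZ.nonneg _ _
    have hg : IsGZ n (shiftAt i (k + 1) (-1) m.toInt) := by
      refine (m.isGZ.lower_iff hi1 hik hk).2 ⟨hlt, fun hik' => ?_⟩
      rw [Nat.add_sub_cancel, hmin i k hi1 (by omega) le_rfl, hilast (i + 1) (by omega) hik']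
      refine lt_of_le_of_lt ?_ hlt
      rcases hk.lt_or_eq with hk' | hk'
      · exact m.isGZ.row_antitone (by omega) (by omega) (by omega) hk'
      · rw [m.isGZ.zeros (i + 1 + 1) (k + 2) (by omega)]
        exact m.isGZ.nonneg _ _
    have htot := total_eq_of_toInt hi1 hik hk hg.toInt_pattern
    have hup := h hg.pattern (k + 1) (by omega) hk (by omega)
    have him : i ∈ Finset.Icc 1 (k + 1) := Finset.mem_Icc.2 ⟨hi1, hik⟩
    rw [rowUp, shiftOp_apply, hg.toInt_pattern, ← Finset.add_sum_erase _ _ him, shiftAt_shiftAt,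
      add_neg_cancel, shiftAt_zero, ket_toInt] at hup
    have hrest : ∀ i' ∈ (Finset.Icc 1 (k + 1)).erase i,
        rowCoeff n w (k + 1) i' (shiftAt i (k + 1) (-1) m.toInt) •
          (ket patternVec (shiftAt i' (k + 1) 1 (shiftAt i (k + 1) (-1) m.toInt)) :
            PatternSpace n) ∈ S := by
      intro i' hi'
      rw [Finset.mem_erase, Finset.mem_Icc] at hi'
      obtain ⟨hne, hi1', hik'⟩ := hi'
      refine S.smul_mem _ ?_
      by_cases hg' : IsGZ n (shiftAt i' (k + 1) 1 (shiftAt i (k + 1) (-1) m.toInt))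
      swap
      · rw [ket_of_not_isGZ _ hg']
        exact S.zero_mem
      rw [ket_of_isGZ _ hg']
      have htot' := total_eq_of_toInt (m := hg.pattern) (q := hg'.pattern) (c := 1) hi1' hik' hk
        (by simp)
      refine ih (by omega) _ (by omega) fun hmin' => ?_
      rcases Nat.lt_or_ge 1 i with hi2 | hi2
      · have e1 := hmin (i - 1) k (by omega) (by omega) le_rfl
        have e2 := hmin' (i - 1) k (by omega) (by omega) le_rfl
        rw [hg'.toInt_pattern] at e2
        rw [Nat.sub_add_cancel hi1] at e1 e2
        simp only [shiftAt_apply] at e2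
        simp [hne.symm] at e2
        omega
      · have e1 := hmin (i' - 1) k (by omega) (by omega) le_rfl
        have e2 := hmin' (i' - 1) k (by omega) (by omega) le_rfl
        rw [hg'.toInt_pattern] at e2
        rw [Nat.sub_add_cancel hi1'] at e1 e2
        simp only [shiftAt_apply] at e2
        simp [hne] at e2
        omega
    have hc : rowCoeff n w (k + 1) i (shiftAt i (k + 1) (-1) m.toInt) ≠ 0 :=
      rowCoeff_ne_zero hw hg hi1 hik hk (by
        rw [shiftAt_shiftAt, add_neg_cancel, shiftAt_zero]
        exact m.isGZ)
    have h1 := (S.add_mem_iff_left (S.sum_mem hrest)).1 hup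
    exact (S.smul_mem_iff hc).1 h1

/-- The vectors `|m)` are generated from `|0)` by the raising operators. -/
theorem eq_top_of_rowUp_mem {w : ℕ → ℤ → ℂ} (hw : ∀ i x, w i x ≠ 0)
    {S : Submodule ℂ (PatternSpace n)} (h0 : patternVec (zeroPattern n) ∈ S)
    (h : ∀ k, 1 ≤ k → k ≤ n → ∀ v ∈ S, rowUp n w k v ∈ S) : S = ⊤ := by
  have key : ∀ N, ∀ m : GZPattern n, total m = N → patternVec m ∈ S := by
    intro N
    induction N using Nat.strong_induction_on with
    | _ N ih =>
      intro m hN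
      by_cases hm : m = zeroPattern n
      · rwa [hm]
      · exact patternVec_mem_of_rowUp hw (fun q k h1 h2 h3 => h k h1 h2 _ (ih _ h3 q rfl)) m hm hN
  rw [eq_top_iff]
  intro v _
  rw [← Finsupp.sum_single v]
  refine S.sum_mem fun m _ => ?_
  have := S.smul_mem (v m) (key _ m rfl)
  rwa [patternVec, Finsupp.smul_single, smul_eq_mul, mul_one] at this

/-- Only multiples of `|0)` are annihilated by all lowering operators. -/
theorem apply_eq_zero_of_rowDown {w : ℕ → ℤ → ℂ} (hw : ∀ i x, w i x ≠ 0) {v : PatternSpace n}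
    (h : ∀ k, 1 ≤ k → k ≤ n → rowDown n w k v = 0) {m : GZPattern n} (hm : m ≠ zeroPattern n) :
    v m = 0 := by
  have := patternVec_mem_of_rowUp (S := LinearMap.ker (dotForm n v)) hw
    (fun q k h1 h2 _ => by
      rw [LinearMap.mem_ker]
      have h3 := (isTranspose_rowUp (n := n) w k).symm v (patternVec q)
      rw [← h3, h k h1 h2, map_zero, LinearMap.zero_apply]) m hm rfl
  rwa [LinearMap.mem_ker, dotForm_patternVec_right] at this

/-- The operator `A` produces no multiple of `|0)`. -/
def Raises (A : Module.End ℂ (PatternSpace n)) : Prop := ∀ v, A v (zeroPattern n) = 0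

theorem Raises.lie {A B : Module.End ℂ (PatternSpace n)} (hA : Raises A) (hB : Raises B) :
    Raises ⁅A, B⁆ := by
  intro v
  rw [Ring.lie_def, LinearMap.sub_apply, Finsupp.sub_apply, Module.End.mul_apply,
    Module.End.mul_apply, hA, hB, sub_zero]

theorem raises_rowUp (w : ℕ → ℤ → ℂ) {k : ℕ} : Raises (rowUp n w k) := by
  classical
  have : (Finsupp.lapply (zeroPattern n)) ∘ₗ rowUp n w k = (0 : PatternSpace n →ₗ[ℂ] ℂ) := by
    refine patternSpace_ext fun m => ?_
    rw [LinearMap.comp_apply, rowUp, shiftOp_apply, map_sum, LinearMap.zero_apply]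
    refine Finset.sum_eq_zero fun i _ => ?_
    rw [Finsupp.lapply_apply, Finsupp.smul_apply, ket_patternVec_apply, if_neg, smul_zero]
    intro hc
    have h1 := congrFun (congrFun hc i) k
    have h2 := m.isGZ.nonneg i k
    have h0 : (zeroPattern n).toInt i k = 0 := by simp [GZPattern.toInt, zeroPattern]
    rw [h0, shiftAt_apply, if_pos ⟨rfl, rfl⟩] at h1
    omega
  exact fun v => LinearMap.congr_fun this v

/-- A raising operator that commutes with all lowering operators is zero, since by induction it maps
every `|m)` to a vector that is annihilated by all lowering operators. -/
theorem eq_zero_of_lie_rowDown {w : ℕ → ℤ → ℂ} (hw : ∀ i x, w i x ≠ 0)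
    {X : Module.End ℂ (PatternSpace n)} (hX : Raises X)
    (h : ∀ k, 1 ≤ k → k ≤ n → ⁅X, rowDown n w k⁆ = 0) : X = 0 := by
  refine patternSpace_ext fun m => ?_
  rw [LinearMap.zero_apply]
  induction hN : total m using Nat.strong_induction_on generalizing m with
  | _ N ih =>
    ext m'
    by_cases hm' : m' = zeroPattern n
    · rw [hm']
      exact hX _
    refine apply_eq_zero_of_rowDown hw (fun k h1 h2 => ?_) hm'
    have h3 := LinearMap.congr_fun (h k h1 h2) (patternVec m)
    rw [Ring.lie_def, LinearMap.sub_apply, Module.End.mul_apply, Module.End.mul_apply,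
      LinearMap.zero_apply, sub_eq_zero] at h3
    rw [← h3, rowDown, shiftOp_apply, map_sum]
    refine Finset.sum_eq_zero fun i hi => ?_
    rw [Finset.mem_Icc] at hi
    rw [map_smul]
    by_cases hg : IsGZ n (shiftAt i k (-1) m.toInt)
    · have := total_eq_of_toInt hi.1 hi.2 h2 hg.toInt_pattern
      rw [ket_of_isGZ _ hg, ih (total hg.pattern) (by omega) _ rfl, smul_zero]
    · rw [ket_of_not_isGZ _ hg, map_zero, smul_zero]

end vacuum

/-! ### Commutators of Chevalley generators -/

section lie

variable {L : Type*} [LieRing L] [LieAlgebra ℂ L]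

/-- The Serre element `[e, [e, g]]` commutes with the lowering operator `f` of `e`, if `f` commutes
with `g` and the coroot `h = [e, f]` takes the value `-1` on `g`. -/
theorem lie_serre_left {e f g h : L} (hef : ⁅f, e⁆ = -h) (hgf : ⁅f, g⁆ = 0)
    (he : ⁅h, e⁆ = (2 : ℂ) • e) (hg : ⁅h, g⁆ = -g) : ⁅f, ⁅e, ⁅e, g⁆⁆⁆ = 0 := by
  have h1 : ⁅f, ⁅e, g⁆⁆ = g := by
    rw [leibniz_lie, hef, hgf, neg_lie, hg]
    simp
  rw [leibniz_lie, h1, hef, neg_lie, leibniz_lie h, he, hg, smul_lie, lie_neg, two_smul]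
  abel

/-- The Serre element `[e, [e, g]]` commutes with the lowering operator `f` of `g`, if `f` commutes
with `e` and `e` is a weight vector for `h = [g, f]`. -/
theorem lie_serre_right {e f g h : L} {c : ℂ} (hef : ⁅f, e⁆ = 0) (hgf : ⁅f, g⁆ = -h)
    (he : ⁅h, e⁆ = c • e) : ⁅f, ⁅e, ⁅e, g⁆⁆⁆ = 0 := by
  have h1 : ⁅f, ⁅e, g⁆⁆ = c • e := by
    rw [leibniz_lie, hef, hgf, zero_lie, lie_neg, lie_skew, he, zero_add]
  rw [leibniz_lie, hef, h1, zero_lie, lie_smul, lie_self, smul_zero, zero_add]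

/-- Operators `e_k` and `F_j` with `F_n = e_n` and `F_j = [e_j, F_{j+1}]`, for which the relations
of the upper triangular part of `gl(n)` and the quadratic relations for `e_n` hold. -/
structure IsRaisingSystem (n : ℕ) (e F : ℕ → L) : Prop where
  top : F n = e n
  step : ∀ j, 1 ≤ j → j < n → F j = ⁅e j, F (j + 1)⁆
  far : ∀ k l, 1 ≤ k → k + 1 < l → l ≤ n → ⁅e k, e l⁆ = 0
  serre : ∀ k, 1 ≤ k → k < n → ⁅e k, ⁅e k, e (k + 1)⁆⁆ = 0
  serre' : ∀ k, 1 ≤ k → k + 1 < n → ⁅e (k + 1), ⁅e (k + 1), e k⁆⁆ = 0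

/-- The `F_j` are the components of a vector operator for the subalgebra generated by the `e_k`. -/
theorem IsRaisingSystem.lie_eq {n : ℕ} {e F : ℕ → L} (h : IsRaisingSystem n e F) {k j : ℕ}
    (hk : 1 ≤ k) (hkn : k < n) (hj : 1 ≤ j) (hjn : j ≤ n) :
    ⁅e k, F j⁆ = if k + 1 = j then F k else 0 := by
  have key : ∀ d j, j + d = n → 1 ≤ j → ∀ k, 1 ≤ k → k < n →
      ⁅e k, F j⁆ = if k + 1 = j then F k else 0 := by
    intro d
    induction d using Nat.strong_induction_on with
    | _ d ih =>
      intro j hjd hj k hk hkn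
      rcases Nat.eq_zero_or_pos d with rfl | hd
      · obtain rfl : j = n := by omega
        split_ifs with hkj
        · subst hkj
          exact (h.step k hk hkn).symm
        · rw [h.top, h.far k j hk (by omega) le_rfl]
      have ih1 := ih (d - 1) (by omega) (j + 1) (by omega) (by omega)
      split_ifs with hkj
      · subst hkj
        exact (h.step k hk hkn).symm
      rw [h.step j hj (by omega)]
      rcases Nat.lt_or_ge k j with hlt | hge
      · rw [leibniz_lie, h.far k j hk (by omega) (by omega), ih1 k hk hkn, if_neg (by omega),
          zero_lie, lie_zero, add_zero]
      rcases hge.eq_or_lt with rfl | hlt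
      · rcases Nat.lt_or_ge (j + 1) n with hj1 | hj1
        · rw [h.step (j + 1) (by omega) hj1, leibniz_lie (e j) (e (j + 1)),
            ih (d - 2) (by omega) (j + 2) (by omega) (by omega) j hj hkn, if_neg (by omega),
            lie_zero, add_zero, leibniz_lie, h.serre j hj hkn,
            ih (d - 2) (by omega) (j + 2) (by omega) (by omega) j hj hkn, if_neg (by omega),
            lie_zero, zero_lie, add_zero]
        · obtain rfl : n = j + 1 := by omega
          rw [h.top, h.serre j hj hkn]
      rcases Nat.lt_or_ge (j + 1) k with hlt' | hge'
      · rw [leibniz_lie, ih1 k hk hkn, if_neg (by omega), lie_zero, add_zero,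
          ← lie_skew (e k) (e j), h.far j k hj hlt' hkn.le, neg_zero, zero_lie]
      · obtain rfl : k = j + 1 := by omega
        have h0 := ih (d - 2) (by omega) (j + 2) (by omega) (by omega) j hj (by omega)
        rw [if_neg (by omega)] at h0
        have h1 := ih1 (j + 1) (by omega) hkn
        rw [if_neg (by omega)] at h1
        have h2 := h.serre' j hj hkn
        have h3 := h.step (j + 1) (by omega) hkn
        -- expanding `[e_{j+1}, F_j]` in two ways gives the same element with opposite signs
        have h4 : ⁅e j, F (j + 1)⁆ = ⁅⁅e j, e (j + 1)⁆, F (j + 2)⁆ := by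
          rw [h3, leibniz_lie, h0, lie_zero, add_zero]
        have h5 : ⁅e (j + 1), ⁅e j, e (j + 1)⁆⁆ = 0 := by
          rw [← lie_skew (e j), lie_neg, h2, neg_zero]
        have h6 : ⁅e (j + 1), ⁅e j, F (j + 1)⁆⁆ = ⁅⁅e j, e (j + 1)⁆, F (j + 1)⁆ := by
          rw [h4, leibniz_lie, h5, zero_lie, zero_add, ← h3]
        have h7 : ⁅e (j + 1), ⁅e j, F (j + 1)⁆⁆ = -⁅⁅e j, e (j + 1)⁆, F (j + 1)⁆ := by
          rw [leibniz_lie, h1, lie_zero, add_zero, ← lie_skew (e (j + 1)), neg_lie]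
        rw [← h6, eq_neg_iff_add_eq_zero, ← two_smul ℂ] at h7
        exact (smul_eq_zero.1 h7).resolve_left two_ne_zero
  exact key (n - j) j (by omega) hj k hk hkn

/-- The component `F_j` of the vector operator has weight `ε_j`. -/
theorem IsRaisingSystem.weight_lie_eq {n : ℕ} {e F H : ℕ → L} (h : IsRaisingSystem n e F)
    (hH : ∀ r k, 1 ≤ r → r ≤ n → 1 ≤ k → k ≤ n →
      ⁅H r, e k⁆ = ((if r = k then 1 else 0) - (if r - 1 = k then 1 else 0) : ℂ) • e k)
    {r j : ℕ} (hr : 1 ≤ r) (hrn : r ≤ n) (hj : 1 ≤ j) (hjn : j ≤ n) :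
    ⁅H r, F j⁆ = (if r = j then 1 else 0 : ℂ) • F j := by
  induction hjn using Nat.decreasingInduction with
  | self =>
    rw [h.top, hH r n hr hrn hj le_rfl, if_neg (by omega : ¬ r - 1 = n), sub_zero]
  | of_succ j hjn ih =>
    rw [h.step j hj hjn, leibniz_lie, hH r j hr hrn hj hjn.le, ih (by omega), smul_lie, lie_smul,
      ← add_smul]
    congr 1
    have : r - 1 = j ↔ r = j + 1 := by omega
    simp only [this]
    ring

/-- The lowering operators act on the components `F_j` as on the standard basis of the vector
representation. -/
theorem IsRaisingSystem.lower_lie_eq {n : ℕ} {e F H f : ℕ → L} (h : IsRaisingSystem n e F)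
    (hH : ∀ r k, 1 ≤ r → r ≤ n → 1 ≤ k → k ≤ n →
      ⁅H r, e k⁆ = ((if r = k then 1 else 0) - (if r - 1 = k then 1 else 0) : ℂ) • e k)
    (hne : ∀ k l, 1 ≤ k → k ≤ n → 1 ≤ l → l ≤ n → k ≠ l → ⁅e k, f l⁆ = 0)
    (hself : ∀ k, 1 ≤ k → k < n → ⁅e k, f k⁆ = H k - H (k + 1))
    {k j : ℕ} (hk : 1 ≤ k) (hkn : k < n) (hj : 1 ≤ j) (hjn : j ≤ n) :
    ⁅f k, F j⁆ = if k = j then F (k + 1) else 0 := by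
  induction hjn using Nat.decreasingInduction with
  | self =>
    rw [h.top, if_neg hkn.ne, ← lie_skew, hne n k hj le_rfl hk hkn.le hkn.ne', neg_zero]
  | of_succ j hjn ih =>
    rw [h.step j hj hjn, leibniz_lie, ih (by omega), ← lie_skew (f k) (e j)]
    split_ifs with h1 h2 h2
    · omega
    · subst h1
      rw [h.lie_eq hj (by omega) (by omega) (by omega), if_neg (by omega),
        hne j (j + 1) hj hjn.le hk hkn.le (by omega), neg_zero, zero_lie, add_zero]
    · subst h2
      rw [hself k hk hkn, neg_lie, sub_lie, h.weight_lie_eq hH hk hkn.le (by omega) hjn,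
        h.weight_lie_eq hH (by omega) hkn (by omega) hjn, if_neg (by omega), if_pos rfl]
      simp
    · rw [hne j k hj hjn.le hk hkn.le (Ne.symm h2), neg_zero, zero_lie, lie_zero, add_zero]

/-- Two vector operators `F⁺`, `F⁻` of `gl(n)`, dual to each other, with a highest weight component
of the relation `[½[F_j⁺, F_k⁻], F_l⁺] = δ_{kl} F_j⁺`. -/
structure IsVectorPair (n : ℕ) (e f Fp Fm : ℕ → L) (Hn : L) : Prop where
  raise_plus : ∀ k j, 1 ≤ k → k < n → 1 ≤ j → j ≤ n →
    ⁅e k, Fp j⁆ = if k + 1 = j then Fp k else 0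
  lower_plus : ∀ k j, 1 ≤ k → k < n → 1 ≤ j → j ≤ n →
    ⁅f k, Fp j⁆ = if k = j then Fp (k + 1) else 0
  lower_minus : ∀ k j, 1 ≤ k → k < n → 1 ≤ j → j ≤ n →
    ⁅f k, Fm j⁆ = if k + 1 = j then -Fm k else 0
  raise_minus : ∀ k j, 1 ≤ k → k < n → 1 ≤ j → j ≤ n →
    ⁅e k, Fm j⁆ = if k = j then -Fm (k + 1) else 0
  top : ⁅Fp n, Fm n⁆ = (2 : ℂ) • Hn
  weight_plus : ∀ j, 1 ≤ j → j ≤ n → ⁅Hn, Fp j⁆ = if n = j then Fp n else 0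
  weight_minus : ∀ j, 1 ≤ j → j ≤ n → ⁅Hn, Fm j⁆ = if n = j then -Fm n else 0

namespace IsVectorPair

variable {n : ℕ} {e f Fp Fm : ℕ → L} {Hn : L}

/-- Exchanging the roles of `F⁺` and `F⁻`. -/
theorem swap (h : IsVectorPair n e f Fp Fm Hn) : IsVectorPair n (-f) (-e) Fm Fp (-Hn) where
  raise_plus k j h1 h2 h3 h4 := by
    rw [Pi.neg_apply, neg_lie, h.lower_minus k j h1 h2 h3 h4]
    split_ifs <;> simp
  lower_plus k j h1 h2 h3 h4 := by
    rw [Pi.neg_apply, neg_lie, h.raise_minus k j h1 h2 h3 h4]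
    split_ifs <;> simp
  lower_minus k j h1 h2 h3 h4 := by
    rw [Pi.neg_apply, neg_lie, h.raise_plus k j h1 h2 h3 h4]
    split_ifs <;> simp
  raise_minus k j h1 h2 h3 h4 := by
    rw [Pi.neg_apply, neg_lie, h.lower_plus k j h1 h2 h3 h4]
    split_ifs <;> simp
  top := by rw [← lie_skew, h.top, smul_neg]
  weight_plus j h1 h2 := by
    rw [neg_lie, h.weight_minus j h1 h2]
    split_ifs <;> simp
  weight_minus j h1 h2 := by
    rw [neg_lie, h.weight_plus j h1 h2]
    split_ifs <;> simp

/-- The operator `f_k` leads from the component `k + 1` of `F⁻` to the component `k`. -/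
theorem lie_lower (h : IsVectorPair n e f Fp Fm Hn) {j k : ℕ} (hj : 1 ≤ j) (hjn : j ≤ n)
    (hk : 1 ≤ k) (hkn : k < n) : ⁅Fp j, Fm k⁆ =
      (if k = j then ⁅Fp (k + 1), Fm (k + 1)⁆ else 0) - ⁅f k, ⁅Fp j, Fm (k + 1)⁆⁆ := by
  rw [leibniz_lie, h.lower_plus k j hk hkn hj hjn, h.lower_minus k (k + 1) hk hkn (by omega) hkn,
    if_pos rfl]
  split_ifs <;> simp

/-- The operator `e_j` leads from the component `j + 1` of `F⁺` to the component `j`. -/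
theorem lie_raise (h : IsVectorPair n e f Fp Fm Hn) {j k : ℕ} (hj : 1 ≤ j) (hjn : j < n)
    (hk : 1 ≤ k) (hkn : k ≤ n) : ⁅Fp j, Fm k⁆ =
      (if j = k then ⁅Fp (j + 1), Fm (j + 1)⁆ else 0) + ⁅e j, ⁅Fp (j + 1), Fm k⁆⁆ := by
  rw [leibniz_lie, h.raise_minus j k hj hjn hk hkn, h.raise_plus j (j + 1) hj hjn (by omega) hjn,
    if_pos rfl]
  split_ifs with hjk
  · rw [lie_neg]
    abel
  · simp

/-- The relation `[½[F_j⁺, F_k⁻], F_l⁺] = δ_{kl} F_j⁺` follows from its component `j = k = n`, by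
applying the operators `f_k` and `e_j`. -/
theorem triple (h : IsVectorPair n e f Fp Fm Hn) {j k l : ℕ} (hj : 1 ≤ j) (hjn : j ≤ n)
    (hk : 1 ≤ k) (hkn : k ≤ n) (hl : 1 ≤ l) (hln : l ≤ n) :
    ⁅⁅Fp j, Fm k⁆, Fp l⁆ = if k = l then (2 : ℂ) • Fp j else 0 := by
  induction hjn using Nat.decreasingInduction generalizing k l with
  | self =>
    induction hkn using Nat.decreasingInduction generalizing l with
    | self =>
      rw [h.top, smul_lie, h.weight_plus l hl hln]
      split_ifs <;> simp
    | of_succ k hkn ih =>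
      rw [h.lie_lower hj le_rfl hk hkn, if_neg hkn.ne, zero_sub, neg_lie, lie_lie (f k),
        ih (by omega) hl hln, h.lower_plus k l hk hkn hl hln]
      split_ifs with h1 h2 h2
      · omega
      · rw [lie_smul, h.lower_plus k n hk hkn hj le_rfl, if_neg hkn.ne]
        simp
      · rw [ih (by omega) (by omega) hkn, if_pos rfl]
        simp
      · simp
  | of_succ j hjn ih =>
    rw [h.lie_raise hj hjn hk hkn, add_lie, lie_lie (e j), ih (by omega) hk hkn hl hln,
      h.raise_plus j l hj hjn hl hln]
    have h1 : ⁅⁅Fp (j + 1), Fm k⁆, if j + 1 = l then Fp j else 0⁆ =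
        if j + 1 = l ∧ k = j then (2 : ℂ) • Fp (j + 1) else 0 := by
      by_cases h2 : j + 1 = l
      · rw [if_pos h2, ih (by omega) hk hkn hj hjn.le]
        simp [h2]
      · simp [h2]
    have h3 : ⁅if j = k then ⁅Fp (j + 1), Fm (j + 1)⁆ else 0, Fp l⁆ =
        if j + 1 = l ∧ k = j then (2 : ℂ) • Fp (j + 1) else 0 := by
      by_cases h2 : j = k
      · rw [if_pos h2, ih (by omega) (by omega) (by omega) hl hln]
        simp [h2]
      · simp [h2, Ne.symm h2]
    rw [h1, h3]
    split_ifs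
    · rw [lie_smul, h.raise_plus j (j + 1) hj hjn (by omega) hjn, if_pos rfl]
      abel
    · simp
    · rw [lie_smul, h.raise_plus j (j + 1) hj hjn (by omega) hjn, if_pos rfl]
      abel
    · simp

theorem triple_minus (h : IsVectorPair n e f Fp Fm Hn) {j k l : ℕ} (hj : 1 ≤ j) (hjn : j ≤ n)
    (hk : 1 ≤ k) (hkn : k ≤ n) (hl : 1 ≤ l) (hln : l ≤ n) :
    ⁅⁅Fp j, Fm k⁆, Fm l⁆ = if j = l then -(2 : ℂ) • Fm k else 0 := by
  rw [← lie_skew (Fp j), neg_lie, h.swap.triple hk hkn hj hjn hl hln]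
  split_ifs <;> simp

theorem lie_lie_minus (h : IsVectorPair n e f Fp Fm Hn) {j k l : ℕ} (hj : 1 ≤ j) (hjn : j ≤ n)
    (hk : 1 ≤ k) (hkn : k ≤ n) (hl : 1 ≤ l) (hln : l ≤ n) :
    ⁅⁅Fp j, Fp k⁆, Fm l⁆ =
      (if k = l then (2 : ℂ) • Fp j else 0) - if j = l then (2 : ℂ) • Fp k else 0 := by
  rw [lie_lie, ← lie_skew (Fp j) ⁅Fp k, Fm l⁆, ← lie_skew (Fp k) ⁅Fp j, Fm l⁆,
    h.triple hk hkn hl hln hj hjn, h.triple hj hjn hl hln hk hkn]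
  simp only [eq_comm (a := l)]
  abel

/-- The elements `½[F_k⁺, F_k⁻]`, `½[F_k⁺, F_{k+1}⁻]` and `½[F_{k+1}⁺, F_k⁻]` are the Chevalley
generators of `gl(n)`. -/
theorem chevalley (h : IsVectorPair n e f Fp Fm Hn) {H : ℕ → L} (hn : H n = Hn)
    (hef : ∀ k, 1 ≤ k → k < n → ⁅e k, f k⁆ = H k - H (k + 1))
    (he : ∀ k, 1 ≤ k → k < n → ⁅H (k + 1), e k⁆ = -e k)
    (hf : ∀ k, 1 ≤ k → k < n → ⁅H (k + 1), f k⁆ = f k) {k : ℕ} (hk : 1 ≤ k) (hkn : k ≤ n) :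
    ⁅Fp k, Fm k⁆ = (2 : ℂ) • H k ∧ (k < n → ⁅Fp k, Fm (k + 1)⁆ = (2 : ℂ) • e k ∧
      ⁅Fp (k + 1), Fm k⁆ = (2 : ℂ) • f k) := by
  induction hkn using Nat.decreasingInduction with
  | self => exact ⟨by rw [h.top, hn], fun h' => absurd h' (lt_irrefl _)⟩
  | of_succ k hkn ih =>
    have ih := (ih (by omega)).1
    have h1 : ⁅Fp k, Fm (k + 1)⁆ = (2 : ℂ) • e k := by
      rw [h.lie_raise hk hkn (by omega) hkn, if_neg (by omega), ih, lie_smul, ← lie_skew,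
        he k hk hkn]
      simp
    have h2 : ⁅Fp (k + 1), Fm k⁆ = (2 : ℂ) • f k := by
      rw [h.lie_lower (by omega) hkn hk hkn, if_neg (by omega), ih, lie_smul, ← lie_skew,
        hf k hk hkn]
      simp
    refine ⟨?_, fun _ => ⟨h1, h2⟩⟩
    rw [h.lie_raise hk hkn hk hkn.le, if_pos rfl, h2, ih, lie_smul, hef k hk hkn, ← smul_add]
    congr 1
    abel

end IsVectorPair

/-- The triple relations, from those that involve both signs and those for equal signs. -/
theorem lie_lie_eq_of_units {ι : Type*} [DecidableEq ι] {g : ℤˣ → ι → L}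
    (h1 : ∀ j k l, ⁅⁅g 1 j, g (-1) k⁆, g 1 l⁆ = if k = l then (2 : ℂ) • g 1 j else 0)
    (h2 : ∀ j k l, ⁅⁅g 1 j, g (-1) k⁆, g (-1) l⁆ = if j = l then -(2 : ℂ) • g (-1) k else 0)
    (h3 : ∀ j k l, ⁅⁅g 1 j, g 1 k⁆, g 1 l⁆ = 0)
    (h4 : ∀ j k l, ⁅⁅g (-1) j, g (-1) k⁆, g (-1) l⁆ = 0) (ξ η ε : ℤˣ) (j k l : ι) :
    ⁅⁅g ξ j, g η k⁆, g ε l⁆ =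
      ((1 / 2 : ℂ) * (((ε : ℤ) : ℂ) - ((η : ℤ) : ℂ)) ^ 2 * (if k = l then 1 else 0)) • g ξ j
      - ((1 / 2 : ℂ) * (((ε : ℤ) : ℂ) - ((ξ : ℤ) : ℂ)) ^ 2 * (if j = l then 1 else 0)) • g η k := by
  have c1 : (1 / 2 : ℂ) * (1 - -1) ^ 2 = 2 := by norm_num
  have c2 : (1 / 2 : ℂ) * (-1 - 1) ^ 2 = 2 := by norm_num
  have h5 : ∀ j k l, ⁅⁅g 1 j, g 1 k⁆, g (-1) l⁆ =
      (if k = l then (2 : ℂ) • g 1 j else 0) - if j = l then (2 : ℂ) • g 1 k else 0 := by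
    intro j k l
    rw [lie_lie, ← lie_skew (g 1 j) ⁅g 1 k, g (-1) l⁆, ← lie_skew (g 1 k) ⁅g 1 j, g (-1) l⁆, h1, h1]
    simp only [eq_comm (a := l)]
    abel
  have h6 : ∀ j k l, ⁅⁅g (-1) j, g (-1) k⁆, g 1 l⁆ =
      (if k = l then (2 : ℂ) • g (-1) j else 0) - if j = l then (2 : ℂ) • g (-1) k else 0 := by
    intro j k l
    rw [lie_lie, ← lie_skew (g (-1) k) (g 1 l), ← lie_skew (g (-1) j) (g 1 l), lie_neg, lie_neg,
      lie_skew, ← lie_skew (g (-1) k) ⁅g 1 l, g (-1) j⁆, h2, h2]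
    simp only [eq_comm (a := l), neg_smul]
    split_ifs <;> simp [neg_add_eq_sub]
  rcases Int.units_eq_one_or ξ with rfl | rfl <;> rcases Int.units_eq_one_or η with rfl | rfl <;>
    rcases Int.units_eq_one_or ε with rfl | rfl <;>
    simp only [Units.val_one, Units.val_neg, Int.cast_one, Int.cast_neg, sub_self, c1, c2]
  · simp [h3]
  · rw [h5]; split_ifs <;> simp
  · rw [h1]; split_ifs <;> simp
  · rw [h2]; split_ifs <;> simp
  · rw [← lie_skew (g (-1) j) (g 1 k), neg_lie, h1]; split_ifs <;> simp
  · rw [← lie_skew (g (-1) j) (g 1 k), neg_lie, h2]; split_ifs <;> simp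
  · rw [h6]; split_ifs <;> simp
  · simp [h4]

end lie

/-! ### The relations between the operators -/

theorem ring_sub_lie {R : Type*} [Ring R] (a b c : R) : ⁅a - b, c⁆ = ⁅a, c⁆ - ⁅b, c⁆ := by
  simp only [Ring.lie_def]
  noncomm_ring

theorem ring_smul_lie {R : Type*} [Ring R] [Algebra ℂ R] (r : ℂ) (a b : R) :
    ⁅r • a, b⁆ = r • ⁅a, b⁆ := by
  simp only [Ring.lie_def, smul_mul_assoc, mul_smul_comm, smul_sub]

section relations

variable {n : ℕ}

theorem lie_eq_zero_comm {A B : Module.End ℂ (PatternSpace n)} : ⁅A, B⁆ = 0 ↔ ⁅B, A⁆ = 0 := by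
  rw [Ring.lie_def, Ring.lie_def, sub_eq_zero, sub_eq_zero, eq_comm]

theorem neg_lie_comm (A B : Module.End ℂ (PatternSpace n)) : ⁅A, B⁆ = -⁅B, A⁆ := by
  rw [Ring.lie_def, Ring.lie_def]
  exact (neg_sub (B * A) (A * B)).symm

/-- The commutator `[e_j, [e_{j+1}, … [e_{n-1}, e_n]]]` of raising operators, for `j = n - d`. -/
def raiseChain (n : ℕ) (w : ℕ → ℤ → ℂ) : ℕ → Module.End ℂ (PatternSpace n)
  | 0 => rowUp n w n
  | d + 1 => ⁅rowUp n w (n - (d + 1)), raiseChain n w d⁆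

/-- The transpose of `raiseChain`. -/
def lowerChain (n : ℕ) (w : ℕ → ℤ → ℂ) : ℕ → Module.End ℂ (PatternSpace n)
  | 0 => rowDown n w n
  | d + 1 => ⁅lowerChain n w d, rowDown n w (n - (d + 1))⁆

/-- The parafermion creation operator with top row weights `w`. -/
def vectorUp (n : ℕ) (w : ℕ → ℤ → ℂ) (j : ℕ) : Module.End ℂ (PatternSpace n) :=
  raiseChain n w (n - j)

/-- The parafermion annihilation operator with top row weights `w`. -/
def vectorDown (n : ℕ) (w : ℕ → ℤ → ℂ) (j : ℕ) : Module.End ℂ (PatternSpace n) :=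
  lowerChain n w (n - j)

theorem vectorUp_top (w : ℕ → ℤ → ℂ) : vectorUp n w n = rowUp n w n := by
  rw [vectorUp, Nat.sub_self, raiseChain]

theorem vectorDown_top (w : ℕ → ℤ → ℂ) : vectorDown n w n = rowDown n w n := by
  rw [vectorDown, Nat.sub_self, lowerChain]

theorem vectorUp_eq_lie (w : ℕ → ℤ → ℂ) {j : ℕ} (hj : j < n) :
    vectorUp n w j = ⁅rowUp n w j, vectorUp n w (j + 1)⁆ := by
  rw [vectorUp, vectorUp, show n - j = n - (j + 1) + 1 by omega, raiseChain,
    show n - (n - (j + 1) + 1) = j by omega]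

theorem isTranspose_vectorUp (w : ℕ → ℤ → ℂ) (j : ℕ) :
    IsTranspose (vectorUp n w j) (vectorDown n w j) := by
  rw [vectorUp, vectorDown]
  generalize n - j = d
  induction d with
  | zero => exact isTranspose_rowUp w n
  | succ d ih => exact (isTranspose_rowUp w _).lie ih

theorem raiseOp_eq_vectorUp {G : ℕ → (ℕ → ℤ) → ℂ} {w : ℕ → ℤ → ℂ} (h : HasWeights n G w) {j : ℕ}
    (hj : j ≤ n) : raiseOp n G j = vectorUp n w j := by
  induction hj using Nat.decreasingInduction with
  | self => rw [raiseOp_top h, vectorUp_top]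
  | of_succ j hj ih => rw [raiseOp_eq_lie w G hj, vectorUp_eq_lie w hj, ih]

theorem lowerOp_eq_vectorDown {G : ℕ → (ℕ → ℤ) → ℂ} {w : ℕ → ℤ → ℂ} (h : HasWeights n G w) {j : ℕ}
    (hj : j ≤ n) : lowerOp n G j = vectorDown n w j :=
  (isTranspose_raiseOp G j).eq_of_eq (isTranspose_vectorUp w j) (raiseOp_eq_vectorUp h hj)

theorem raises_vectorUp (w : ℕ → ℤ → ℂ) (j : ℕ) : Raises (vectorUp n w j) := by
  rw [vectorUp]
  generalize n - j = d
  induction d with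
  | zero => exact raises_rowUp w
  | succ d ih => exact (raises_rowUp w).lie ih

/-- Weights for which no matrix element of the lowering operators vanishes: those of `p = -1/2`,
since then `p - x + i - 1` is not an integer. -/
def genericWeight : ℕ → ℤ → ℂ := topFactor (-1 / 2)

theorem genericWeight_ne_zero (i : ℕ) (x : ℤ) : genericWeight i x ≠ 0 := by
  rw [genericWeight, topFactor]
  split_ifs
  · exact one_ne_zero
  · intro h
    have h2 : ((2 * (i : ℤ) - 2 * x - 3 : ℤ) : ℂ) = 0 := by
      push_cast
      linear_combination 2 * h
    have h3 := Int.cast_eq_zero.1 h2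
    omega

/-- The raising operators with weights `1` and the lowering operators with generic weights satisfy
the relations of the Chevalley generators for `p = -1/2`. -/
theorem lie_rowDown_generic {k : ℕ} (hk : 1 ≤ k) (hkn : k ≤ n) :
    ⁅rowDown n genericWeight k, rowUp n (fun _ _ => 1) k⁆ =
      -(if k < n then weightOp n (-1 / 2) k - weightOp n (-1 / 2) (k + 1)
        else (2 : ℂ) • weightOp n (-1 / 2) n) := by
  rw [neg_lie_comm]
  split_ifs with h
  · rw [lie_rowUp_rowDown _ _ _ hk h]
  · obtain rfl : k = n := by omega
    exact congrArg Neg.neg (lie_rowUp_rowDown_top _ _ (-1 / 2) hk fun i x => one_mul _)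

/-- The action on the raising operators of the commutators in `lie_rowDown_generic`, which are the
simple coroots of `so(2n+1)`. -/
theorem lie_coroot_rowUp (w : ℕ → ℤ → ℂ) (k l : ℕ) :
    ⁅(if k < n then weightOp n (-1 / 2) k - weightOp n (-1 / 2) (k + 1)
        else (2 : ℂ) • weightOp n (-1 / 2) n), rowUp n w l⁆ =
      (if k < n then (2 * (if k = l then 1 else 0) - (if k - 1 = l then 1 else 0) -
        (if k + 1 = l then 1 else 0)) else
        2 * ((if n = l then 1 else 0) - (if n - 1 = l then 1 else 0)) : ℂ) • rowUp n w l := by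
  have h1 := lie_weightOp_rowUp (n := n) w (-1 / 2) k l
  have h2 := lie_weightOp_rowUp (n := n) w (-1 / 2) (k + 1) l
  have h3 := lie_weightOp_rowUp (n := n) w (-1 / 2) n l
  rw [Nat.add_sub_cancel] at h2
  by_cases h : k < n
  · have e : ⁅weightOp n (-1 / 2) k - weightOp n (-1 / 2) (k + 1), rowUp n w l⁆ =
        ⁅weightOp n (-1 / 2) k, rowUp n w l⁆ - ⁅weightOp n (-1 / 2) (k + 1), rowUp n w l⁆ :=
      ring_sub_lie (R := Module.End ℂ (PatternSpace n)) _ _ _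
    rw [if_pos h, if_pos h, e, h1, h2]
    refine (sub_smul _ _ (rowUp n w l)).symm.trans (congrArg (· • rowUp n w l) ?_)
    ring
  · have e : ⁅(2 : ℂ) • weightOp n (-1 / 2) n, rowUp n w l⁆ =
        (2 : ℂ) • ⁅weightOp n (-1 / 2) n, rowUp n w l⁆ :=
      ring_smul_lie (R := Module.End ℂ (PatternSpace n)) _ _ _
    rw [if_neg h, if_neg h, e, h3, smul_smul]

/-- The relation `[e_k, [e_k, e_l]] = 0` for adjacent rows `k`, `l` with `k < n`, at weights `1`:
the left hand side commutes with all lowering operators. -/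
theorem serre_one {k l : ℕ} (hk : 1 ≤ k) (hkn : k < n) (hl : 1 ≤ l) (hln : l ≤ n)
    (hkl : l = k + 1 ∨ k = l + 1) :
    ⁅rowUp n (fun _ _ => 1) k, ⁅rowUp n (fun _ _ => 1) k, rowUp n (fun _ _ => 1) l⁆⁆ = 0 := by
  refine eq_zero_of_lie_rowDown genericWeight_ne_zero
    ((raises_rowUp _).lie ((raises_rowUp _).lie (raises_rowUp _))) fun r hr hrn => ?_
  rw [lie_eq_zero_comm]
  have h0 : ∀ s, 1 ≤ s → s ≤ n → s ≠ r →
      ⁅rowDown n genericWeight r, rowUp n (fun _ _ => 1) s⁆ = 0 := fun s _ hs hsr =>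
    lie_eq_zero_comm.1 (lie_rowUp_rowDown_of_ne _ _ hs hrn hsr)
  let _ : LieRing (Module.End ℂ (PatternSpace n)) := LieRing.ofAssociativeRing
  let _ : LieAlgebra ℂ (Module.End ℂ (PatternSpace n)) := LieAlgebra.ofAssociativeAlgebra
  have hself := lie_rowDown_generic hr hrn
  have hcor := lie_coroot_rowUp (n := n) (fun _ _ => 1) r
  by_cases hrk : r = k
  · subst hrk
    refine lie_serre_left hself (h0 l hl hln (by omega)) ?_ ?_
    · refine (hcor r).trans ?_
      rw [if_pos hkn, if_pos rfl, if_neg (by omega), if_neg (by omega)]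
      norm_num
    · refine (hcor l).trans ?_
      rw [if_pos hkn, if_neg (by omega)]
      rcases hkl with rfl | rfl
      · rw [if_neg (by omega), if_pos rfl]
        simp
      · rw [if_pos (by omega), if_neg (by omega)]
        simp
  · by_cases hrl : r = l
    · subst hrl
      exact lie_serre_right (h0 k hk hkn.le (Ne.symm hrk)) hself (hcor k)
    · refine lie_serre_right (h := 0) (c := 0) (h0 k hk hkn.le (Ne.symm hrk))
        ((h0 l hl hln (Ne.symm hrl)).trans neg_zero.symm) ?_
      rw [zero_lie, zero_smul]

/-! ### Change of the weights in the top row -/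

/-- The product of the weights of the entries of the top row that lead from `m` to `q`. -/
def gaugeFactor (w : ℕ → ℤ → ℂ) (m q : GZPattern n) : ℂ :=
  ∏ i ∈ Finset.Icc 1 n, ∏ x ∈ Finset.Ico (m.toInt i n) (q.toInt i n), w i x

/-- The diagonal operator with entries `gaugeFactor w m`. -/
def gaugeOp (w : ℕ → ℤ → ℂ) (m : GZPattern n) : Module.End ℂ (PatternSpace n) :=
  Finsupp.linearCombination ℂ fun q => gaugeFactor w m q • patternVec q

/-- The span of all patterns whose top row contains the top row of `m`. -/
def aboveSpace (m : GZPattern n) : Submodule ℂ (PatternSpace n) :=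
  Submodule.span ℂ (patternVec '' {q | ∀ i, 1 ≤ i → i ≤ n → m.toInt i n ≤ q.toInt i n})

theorem gaugeOp_patternVec (w : ℕ → ℤ → ℂ) (m q : GZPattern n) :
    gaugeOp w m (patternVec q) = gaugeFactor w m q • patternVec q := by
  rw [gaugeOp]
  nth_rw 1 [patternVec]
  rw [Finsupp.linearCombination_single, one_smul]

/-- `B` arises from `A` by changing the weights of the top row from `1` to `w`. These weights may
vanish, so `A` and `B` need not be conjugate; but on the vectors above a given pattern `m` the
operator `gaugeOp w m`, which fixes `|m)`, intertwines them. -/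
def GaugePair (w : ℕ → ℤ → ℂ) (A B : Module.End ℂ (PatternSpace n)) : Prop :=
  ∀ m : GZPattern n, ∀ v ∈ aboveSpace m, A v ∈ aboveSpace m ∧
    B (gaugeOp w m v) = gaugeOp w m (A v)

theorem GaugePair.lie {w : ℕ → ℤ → ℂ} {A B A' B' : Module.End ℂ (PatternSpace n)}
    (h : GaugePair w A B) (h' : GaugePair w A' B') : GaugePair w ⁅A, A'⁆ ⁅B, B'⁆ := by
  intro m v hv
  have h1 := h m v hv
  have h1' := h' m v hv
  have h2 := h m _ h1'.1
  have h2' := h' m _ h1.1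
  simp only [Ring.lie_def, LinearMap.sub_apply, Module.End.mul_apply, map_sub]
  refine ⟨Submodule.sub_mem _ h2.1 h2'.1, ?_⟩
  rw [h1.2, h1'.2, h2.2, h2'.2]

/-- Relations carry over from the weights `1` to all weights. -/
theorem GaugePair.eq_zero {w : ℕ → ℤ → ℂ} {B : Module.End ℂ (PatternSpace n)}
    (h : GaugePair w 0 B) : B = 0 := by
  refine patternSpace_ext fun m => ?_
  have h1 : gaugeFactor w m m = 1 := by simp [gaugeFactor]
  have h2 := (h m (patternVec m) (Submodule.subset_span ⟨m, fun _ _ _ => le_rfl, rfl⟩)).2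
  rwa [gaugeOp_patternVec, h1, one_smul, LinearMap.zero_apply, map_zero] at h2

theorem gaugePair_rowUp (w : ℕ → ℤ → ℂ) {k : ℕ} (hk : k ≤ n) :
    GaugePair w (rowUp n (fun _ _ => 1) k) (rowUp n w k) := by
  intro m v hv
  induction hv using Submodule.span_induction with
  | zero => simp
  | add v v' _ _ h h' =>
    simp only [map_add]
    exact ⟨Submodule.add_mem _ h.1 h'.1, by rw [h.2, h'.2]⟩
  | smul c v _ h =>
    simp only [map_smul]
    exact ⟨Submodule.smul_mem _ _ h.1, by rw [h.2]⟩
  | mem v hv =>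
    obtain ⟨q, hq, rfl⟩ := hv
    rw [gaugeOp_patternVec, map_smul, rowUp, rowUp, shiftOp_apply, shiftOp_apply, map_sum,
      Finset.smul_sum]
    have key : ∀ i ∈ Finset.Icc 1 k, ∀ hg : IsGZ n (shiftAt i k 1 q.toInt),
        patternVec hg.pattern ∈ aboveSpace m ∧ gaugeFactor w m q * rowCoeff n w k i q.toInt =
          rowCoeff n (fun _ _ => 1) k i q.toInt * gaugeFactor w m hg.pattern := by
      intro i hi hg
      rw [Finset.mem_Icc] at hi
      refine ⟨Submodule.subset_span ⟨_, fun a h1 h2 => (hq a h1 h2).trans ?_, rfl⟩, ?_⟩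
      · rw [hg.toInt_pattern, shiftAt_apply]
        split_ifs <;> omega
      · rw [gaugeFactor, gaugeFactor, hg.toInt_pattern, rowCoeff, rowCoeff]
        by_cases hkn : k < n
        · have : ∀ a, shiftAt i k 1 q.toInt a n = q.toInt a n := fun a => by
            rw [shiftAt_apply, if_neg (by omega), add_zero]
          simp only [this, hkn, if_true]
          ring
        · obtain rfl : k = n := by omega
          have him : i ∈ Finset.Icc 1 k := Finset.mem_Icc.2 hi
          have e1 : ∏ a ∈ (Finset.Icc 1 k).erase i,
              ∏ x ∈ Finset.Ico (m.toInt a k) (shiftAt i k 1 q.toInt a k), w a x =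
              ∏ a ∈ (Finset.Icc 1 k).erase i,
                ∏ x ∈ Finset.Ico (m.toInt a k) (q.toInt a k), w a x :=
            Finset.prod_congr rfl fun a ha => by
              rw [shiftAt_apply, if_neg (by simp [(Finset.mem_erase.1 ha).1]), add_zero]
          have e2 : shiftAt i k 1 q.toInt i k = q.toInt i k + 1 := by simp [shiftAt_apply]
          rw [← Finset.mul_prod_erase _ _ him, ← Finset.mul_prod_erase _ _ him, e1, e2,
            ← Finset.insert_Ico_right_eq_Ico_add_one (hq i hi.1 hi.2),
            Finset.prod_insert (by simp)]
          simp only [lt_irrefl, if_false]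
          ring
    constructor
    · refine Submodule.sum_mem _ fun i hi => Submodule.smul_mem _ _ ?_
      by_cases hg : IsGZ n (shiftAt i k 1 q.toInt)
      · rw [ket_of_isGZ _ hg]
        exact (key i hi hg).1
      · rw [ket_of_not_isGZ _ hg]
        exact Submodule.zero_mem _
    · refine Finset.sum_congr rfl fun i hi => ?_
      by_cases hg : IsGZ n (shiftAt i k 1 q.toInt)
      · rw [ket_of_isGZ _ hg, map_smul, gaugeOp_patternVec, smul_smul, smul_smul,
          (key i hi hg).2]
      · rw [ket_of_not_isGZ _ hg]
        simp

theorem gaugePair_vectorUp (w : ℕ → ℤ → ℂ) (j : ℕ) :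
    GaugePair w (vectorUp n (fun _ _ => 1) j) (vectorUp n w j) := by
  rw [vectorUp, vectorUp]
  generalize n - j = d
  induction d with
  | zero => exact gaugePair_rowUp w le_rfl
  | succ d ih => exact (gaugePair_rowUp w (Nat.sub_le _ _)).lie ih

/-- The Serre relations of `gl(n)`, and the one between the last two rows, for all weights. -/
theorem serre (w : ℕ → ℤ → ℂ) {k l : ℕ} (hk : 1 ≤ k) (hkn : k < n) (hl : 1 ≤ l) (hln : l ≤ n)
    (hkl : l = k + 1 ∨ k = l + 1) : ⁅rowUp n w k, ⁅rowUp n w k, rowUp n w l⁆⁆ = 0 := by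
  have h := (gaugePair_rowUp w hkn.le).lie
    ((gaugePair_rowUp w hkn.le).lie (gaugePair_rowUp w hln))
  rw [serre_one hk hkn hl hln hkl] at h
  exact h.eq_zero

theorem isRaisingSystem_vectorUp (w : ℕ → ℤ → ℂ) :
    @IsRaisingSystem (Module.End ℂ (PatternSpace n)) LieRing.ofAssociativeRing n (rowUp n w)
      (vectorUp n w) :=
  @IsRaisingSystem.mk (Module.End ℂ (PatternSpace n)) LieRing.ofAssociativeRing _ _ _
    (vectorUp_top w) (fun _ _ hj => vectorUp_eq_lie w hj)
    (fun _ _ _ hkl hl => lie_rowUp_rowUp_of_far w hl hkl)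
    (fun k hk hkn => serre w hk hkn (by omega) hkn (Or.inl rfl))
    (fun k hk hkn => serre w (by omega) hkn hk (by omega) (Or.inr rfl))

theorem lie_rowDown_vectorUp (a b : ℕ → ℤ → ℂ) {k j : ℕ} (hk : 1 ≤ k) (hkn : k < n) (hj : 1 ≤ j)
    (hjn : j ≤ n) :
    ⁅rowDown n b k, vectorUp n a j⁆ = if k = j then vectorUp n a (k + 1) else 0 :=
  @IsRaisingSystem.lower_lie_eq (Module.End ℂ (PatternSpace n)) LieRing.ofAssociativeRing
    LieAlgebra.ofAssociativeAlgebra _ _ _ (weightOp n 0) _ (isRaisingSystem_vectorUp a)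
    (fun r k _ _ _ _ => lie_weightOp_rowUp a 0 r k)
    (fun _ _ _ hk _ hl hkl => lie_rowUp_rowDown_of_ne a b hk hl hkl)
    (fun _ hk hkn => lie_rowUp_rowDown a b 0 hk hkn) _ _ hk hkn hj hjn

theorem lie_rowUp_vectorUp (w : ℕ → ℤ → ℂ) {k j : ℕ} (hk : 1 ≤ k) (hkn : k < n) (hj : 1 ≤ j)
    (hjn : j ≤ n) : ⁅rowUp n w k, vectorUp n w j⁆ = if k + 1 = j then vectorUp n w k else 0 :=
  @IsRaisingSystem.lie_eq (Module.End ℂ (PatternSpace n)) LieRing.ofAssociativeRing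
    LieAlgebra.ofAssociativeAlgebra _ _ _ (isRaisingSystem_vectorUp w) _ _ hk hkn hj hjn

theorem lie_weightOp_vectorUp (w : ℕ → ℤ → ℂ) (p : ℂ) {r j : ℕ} (hr : 1 ≤ r) (hrn : r ≤ n)
    (hj : 1 ≤ j) (hjn : j ≤ n) :
    ⁅weightOp n p r, vectorUp n w j⁆ = (if r = j then 1 else 0 : ℂ) • vectorUp n w j :=
  @IsRaisingSystem.weight_lie_eq (Module.End ℂ (PatternSpace n)) LieRing.ofAssociativeRing
    LieAlgebra.ofAssociativeAlgebra _ _ _ (weightOp n p) (isRaisingSystem_vectorUp w)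
    (fun r k _ _ _ _ => lie_weightOp_rowUp w p r k) _ _ hr hrn hj hjn

theorem IsTranspose.ite {A B : Module.End ℂ (PatternSpace n)} (c : Prop) [Decidable c]
    (h : IsTranspose A B) : IsTranspose (if c then A else 0) (if c then B else 0) := by
  split_ifs
  · exact h
  · exact .zero

theorem neg_ite_zero (c : Prop) [Decidable c] (A : Module.End ℂ (PatternSpace n)) :
    -(if c then A else 0) = if c then -A else 0 := by
  split_ifs
  · rfl
  · exact neg_zero (G := Module.End ℂ (PatternSpace n))

/-- The operators `vectorUp n a` and `vectorDown n b` form a dual pair of vector operators. -/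
theorem isVectorPair (a b : ℕ → ℤ → ℂ) (p : ℂ) (hn : 1 ≤ n)
    (hab : ∀ i x, a i x * b i x = topFactor p i x) :
    @IsVectorPair (Module.End ℂ (PatternSpace n)) LieRing.ofAssociativeRing
      LieAlgebra.ofAssociativeAlgebra n (rowUp n a) (rowDown n b) (vectorUp n a) (vectorDown n b)
      (weightOp n p n) := by
  refine @IsVectorPair.mk (Module.End ℂ (PatternSpace n)) LieRing.ofAssociativeRing
    LieAlgebra.ofAssociativeAlgebra _ _ _ _ _ _
    (fun k j h1 h2 h3 h4 => lie_rowUp_vectorUp a h1 h2 h3 h4)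
    (fun k j h1 h2 h3 h4 => lie_rowDown_vectorUp a b h1 h2 h3 h4)
    (fun k j h1 h2 h3 h4 => ?_) (fun k j h1 h2 h3 h4 => ?_) ?_ (fun j h1 h2 => ?_)
    (fun j h1 h2 => ?_)
  · have h := ((isTranspose_rowUp b k).lie (isTranspose_vectorUp b j)).eq_of_eq
      ((isTranspose_vectorUp b k).ite (k + 1 = j)) (lie_rowUp_vectorUp b h1 h2 h3 h4)
    refine (neg_lie_comm _ _).trans ?_
    rw [h, neg_ite_zero]
  · have h := ((isTranspose_rowUp a k).symm.lie (isTranspose_vectorUp b j)).eq_of_eq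
      ((isTranspose_vectorUp b (k + 1)).ite (k = j)) (lie_rowDown_vectorUp b a h1 h2 h3 h4)
    refine (neg_lie_comm _ _).trans ?_
    rw [h, neg_ite_zero]
  · rw [vectorUp_top, vectorDown_top]
    exact lie_rowUp_rowDown_top a b p hn hab
  · refine (lie_weightOp_vectorUp a p hn le_rfl h1 h2).trans ?_
    split_ifs with h
    · rw [h, one_smul]
    · rw [zero_smul]
  · have h0 : ⁅weightOp n p n, vectorUp n b j⁆ = if n = j then vectorUp n b n else 0 := by
      refine (lie_weightOp_vectorUp b p hn le_rfl h1 h2).trans ?_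
      split_ifs with h
      · rw [h, one_smul]
      · rw [zero_smul]
    have h := ((isTranspose_weightOp p n).lie (isTranspose_vectorUp b j)).eq_of_eq
      ((isTranspose_vectorUp b n).ite (n = j)) h0
    refine (neg_lie_comm _ _).trans ?_
    rw [h, neg_ite_zero]

end relations

/-! ### The relation `[[f_j⁺, f_k⁺], f_l⁺] = 0` -/

section lie

variable {L : Type*} [LieRing L] [LieAlgebra ℂ L]

/-- The operator `f_n⁻` commutes with the triple commutators of the `f_j⁺`. -/
theorem IsVectorPair.lie_minus_top {n : ℕ} {e f Fp Fm : ℕ → L} {Hn : L}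
    (h : IsVectorPair n e f Fp Fm Hn) {j k l : ℕ} (hj : 1 ≤ j) (hjn : j ≤ n)
    (hk : 1 ≤ k) (hkn : k ≤ n) (hl : 1 ≤ l) (hln : l ≤ n) :
    ⁅⁅⁅Fp j, Fp k⁆, Fp l⁆, Fm n⁆ = 0 := by
  have hn : 1 ≤ n := hj.trans hjn
  have h1 : ⁅⁅Fp j, Fp k⁆, ⁅Fp l, Fm n⁆⁆ =
      (if j = n then (2 : ℂ) • ⁅Fp k, Fp l⁆ else 0) -
        (if k = n then (2 : ℂ) • ⁅Fp j, Fp l⁆ else 0) := by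
    rw [← lie_skew, leibniz_lie, h.triple hl hln hn le_rfl hj hjn,
      h.triple hl hln hn le_rfl hk hkn, ← lie_skew (Fp k) (Fp l)]
    simp only [eq_comm (a := n)]
    split_ifs
    · rw [smul_lie, lie_smul, smul_neg]
      abel
    · rw [smul_lie, lie_zero, smul_neg]
      abel
    · rw [lie_smul, zero_lie]
      abel
    · simp
  have h2 : ⁅⁅⁅Fp j, Fp k⁆, Fm n⁆, Fp l⁆ =
      (if k = n then (2 : ℂ) • ⁅Fp j, Fp l⁆ else 0) -
        (if j = n then (2 : ℂ) • ⁅Fp k, Fp l⁆ else 0) := by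
    rw [h.lie_lie_minus hj hjn hk hkn hn le_rfl, sub_lie]
    split_ifs <;> simp
  rw [lie_lie, h1, ← lie_skew (Fp l) ⁅⁅Fp j, Fp k⁆, Fm n⁆, h2]
  abel

/-- The operators `f_r` map a triple commutator of the `f_j⁺` to triple commutators with a larger
sum of the indices. -/
theorem IsVectorPair.lower_lie_triple {n : ℕ} {e f Fp Fm : ℕ → L} {Hn : L}
    (h : IsVectorPair n e f Fp Fm Hn) {r j k l : ℕ} (hr : 1 ≤ r) (hrn : r < n) (hj : 1 ≤ j)
    (hjn : j ≤ n) (hk : 1 ≤ k) (hkn : k ≤ n) (hl : 1 ≤ l) (hln : l ≤ n) :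
    ⁅f r, ⁅⁅Fp j, Fp k⁆, Fp l⁆⁆ = (if r = j then ⁅⁅Fp (r + 1), Fp k⁆, Fp l⁆ else 0) +
      (if r = k then ⁅⁅Fp j, Fp (r + 1)⁆, Fp l⁆ else 0) +
      (if r = l then ⁅⁅Fp j, Fp k⁆, Fp (r + 1)⁆ else 0) := by
  rw [leibniz_lie, leibniz_lie (f r) (Fp j), h.lower_plus r j hr hrn hj hjn,
    h.lower_plus r k hr hrn hk hkn, h.lower_plus r l hr hrn hl hln, add_lie]
  split_ifs <;> simp

end lie

section

variable {n : ℕ}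

/-- The relation at weights `1`: by downward induction on `j + k + l`, the left hand side commutes
with all lowering operators. -/
theorem triple_vectorUp_one {j k l : ℕ} (hj : 1 ≤ j) (hjn : j ≤ n) (hk : 1 ≤ k) (hkn : k ≤ n)
    (hl : 1 ≤ l) (hln : l ≤ n) :
    ⁅⁅vectorUp n (fun _ _ => 1) j, vectorUp n (fun _ _ => 1) k⁆, vectorUp n (fun _ _ => 1) l⁆ =
      0 := by
  have hp := isVectorPair (n := n) (fun _ _ => 1) genericWeight (-1 / 2) (hj.trans hjn)
    (fun i x => one_mul _)
  induction hN : 3 * n - (j + k + l) using Nat.strong_induction_on generalizing j k l with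
  | _ N ih =>
    refine eq_zero_of_lie_rowDown genericWeight_ne_zero
      (((raises_vectorUp _ _).lie (raises_vectorUp _ _)).lie (raises_vectorUp _ _))
      fun r hr hrn => ?_
    rcases hrn.lt_or_eq with hrn | rfl
    · rw [lie_eq_zero_comm]
      refine (@IsVectorPair.lower_lie_triple (Module.End ℂ (PatternSpace n))
        LieRing.ofAssociativeRing LieAlgebra.ofAssociativeAlgebra _ _ _ _ _ _ hp _ _ _ _ hr hrn
        hj hjn hk hkn hl hln).trans ?_
      have h1 : ∀ {A B C : Module.End ℂ (PatternSpace n)}, A = 0 → B = 0 → C = 0 →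
          A + B + C = 0 := by
        rintro A B C rfl rfl rfl
        rw [add_zero, add_zero]
      refine h1 ?_ ?_ ?_
      · split_ifs with h
        · exact ih _ (by omega) (by omega) (by omega) hk hkn hl hln rfl
        · rfl
      · split_ifs with h
        · exact ih _ (by omega) hj hjn (by omega) (by omega) hl hln rfl
        · rfl
      · split_ifs with h
        · exact ih _ (by omega) hj hjn hk hkn (by omega) (by omega) rfl
        · rfl
    · rw [← vectorDown_top]
      exact @IsVectorPair.lie_minus_top (Module.End ℂ (PatternSpace r)) LieRing.ofAssociativeRing
        LieAlgebra.ofAssociativeAlgebra _ _ _ _ _ _ hp _ _ _ hj hjn hk hkn hl hln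

/-- The relation for all weights, which follows from the one at weights `1` by a change of gauge. -/
theorem triple_vectorUp (w : ℕ → ℤ → ℂ) {j k l : ℕ} (hj : 1 ≤ j) (hjn : j ≤ n) (hk : 1 ≤ k)
    (hkn : k ≤ n) (hl : 1 ≤ l) (hln : l ≤ n) :
    ⁅⁅vectorUp n w j, vectorUp n w k⁆, vectorUp n w l⁆ = 0 := by
  have h := ((gaugePair_vectorUp (n := n) w j).lie (gaugePair_vectorUp w k)).lie
    (gaugePair_vectorUp w l)
  rw [triple_vectorUp_one hj hjn hk hkn hl hln] at h
  exact h.eq_zero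

theorem triple_vectorDown (w : ℕ → ℤ → ℂ) {j k l : ℕ} (hj : 1 ≤ j) (hjn : j ≤ n) (hk : 1 ≤ k)
    (hkn : k ≤ n) (hl : 1 ≤ l) (hln : l ≤ n) :
    ⁅⁅vectorDown n w j, vectorDown n w k⁆, vectorDown n w l⁆ = 0 := by
  have h := (((isTranspose_vectorUp (n := n) w k).lie (isTranspose_vectorUp w j)).lie
    (isTranspose_vectorUp w l)).eq_of_eq .zero (triple_vectorUp w hk hkn hj hjn hl hln)
  rw [lie_eq_zero_comm]
  exact h

end

/-! ### The parafermion operators on the space of patterns -/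

section

variable {n : ℕ} {W : Type*} [AddCommGroup W] [Module ℂ W]

/-- The triple relations in terms of the commutator bracket of the ring of operators. -/
theorem tripleRelations_iff (f : ℤˣ → Fin n → Module.End ℂ W) :
    TripleRelations f ↔ ∀ (ξ η ε : ℤˣ) (j k l : Fin n), ⁅⁅f ξ j, f η k⁆, f ε l⁆ =
      ((1 / 2 : ℂ) * (((ε : ℤ) : ℂ) - ((η : ℤ) : ℂ)) ^ 2 * (if k = l then 1 else 0)) • f ξ j
      - ((1 / 2 : ℂ) * (((ε : ℤ) : ℂ) - ((ξ : ℤ) : ℂ)) ^ 2 * (if j = l then 1 else 0)) •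
        f η k := by
  unfold TripleRelations
  simp only [Ring.lie_def]

/-- The definition of a Gelfand–Zetlin family in terms of the commutator bracket of the ring of
operators. -/
theorem isGZFamily_iff (p : ℂ) (f : ℤˣ → Fin n → Module.End ℂ W) (b : GZPattern n → W) :
    IsGZFamily p f b ↔ (∀ (k : Fin n) (m : GZPattern n),
    (1 / 2 : ℂ) • ⁅f 1 k, f (-1) k⁆ (b m) =
      (-(p / 2) + (rowSum m (k + 1) : ℂ) - (rowSum m k : ℂ)) • b m) ∧
  (∀ (k k' : Fin n) (m : GZPattern n), (k' : ℕ) = k + 1 →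
    (1 / 2 : ℂ) • ⁅f 1 k, f (-1) k'⁆ (b m) =
      ∑ i ∈ Finset.Icc 1 (k + 1 : ℕ),
        (gzCoeff m.toInt (k + 1) i : ℂ) • ket b (shiftAt i (k + 1) 1 m.toInt)) ∧
  (∀ (k k' : Fin n) (m : GZPattern n), (k' : ℕ) = k + 1 →
    (1 / 2 : ℂ) • ⁅f 1 k', f (-1) k⁆ (b m) =
      ∑ i ∈ Finset.Icc 1 (k + 1 : ℕ),
        (gzCoeff (shiftAt i (k + 1) (-1) m.toInt) (k + 1) i : ℂ) •
          ket b (shiftAt i (k + 1) (-1) m.toInt)) := by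
  unfold IsGZFamily rowSum
  simp only [Ring.lie_def, Nat.cast_sum]

/-- The parafermion operators with weights `a` and `b` in the top row. -/
def parafermionOp (n : ℕ) (a b : ℕ → ℤ → ℂ) (σ : ℤˣ) (j : Fin n) :
    Module.End ℂ (PatternSpace n) :=
  if σ = 1 then vectorUp n a (j + 1) else vectorDown n b (j + 1)

theorem parafermionOp_one (a b : ℕ → ℤ → ℂ) (j : Fin n) :
    parafermionOp n a b 1 j = vectorUp n a (j + 1) := if_pos rfl

theorem parafermionOp_neg_one (a b : ℕ → ℤ → ℂ) (j : Fin n) :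
    parafermionOp n a b (-1) j = vectorDown n b (j + 1) := if_neg (by decide)

variable {a b : ℕ → ℤ → ℂ} {p : ℂ}

/-- Only the products of the weights of `f⁺` and `f⁻` are prescribed. -/
theorem tripleRelations_parafermionOp (hab : ∀ i x, a i x * b i x = topFactor p i x) :
    TripleRelations (parafermionOp n a b) := by
  rw [tripleRelations_iff]
  rcases Nat.eq_zero_or_pos n with rfl | hn
  · exact fun _ _ _ j => j.elim0
  have h := isVectorPair a b p hn hab
  have hj : ∀ j : Fin n, 1 ≤ (j : ℕ) + 1 ∧ (j : ℕ) + 1 ≤ n := fun j => ⟨by omega, j.2⟩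
  refine @lie_lie_eq_of_units (Module.End ℂ (PatternSpace n)) LieRing.ofAssociativeRing
    LieAlgebra.ofAssociativeAlgebra _ _ (parafermionOp n a b) ?_ ?_ ?_ ?_
  · intro j k l
    rw [parafermionOp_one, parafermionOp_one, parafermionOp_neg_one]
    refine (@IsVectorPair.triple (Module.End ℂ (PatternSpace n)) LieRing.ofAssociativeRing
      LieAlgebra.ofAssociativeAlgebra _ _ _ _ _ _ h _ _ _ (hj j).1 (hj j).2 (hj k).1 (hj k).2
      (hj l).1 (hj l).2).trans (if_congr ?_ rfl rfl)
    rw [Nat.add_right_cancel_iff, Fin.val_inj]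
  · intro j k l
    rw [parafermionOp_one, parafermionOp_neg_one, parafermionOp_neg_one]
    refine (@IsVectorPair.triple_minus (Module.End ℂ (PatternSpace n)) LieRing.ofAssociativeRing
      LieAlgebra.ofAssociativeAlgebra _ _ _ _ _ _ h _ _ _ (hj j).1 (hj j).2 (hj k).1 (hj k).2
      (hj l).1 (hj l).2).trans (if_congr ?_ rfl rfl)
    rw [Nat.add_right_cancel_iff, Fin.val_inj]
  · intro j k l
    simp only [parafermionOp_one]
    exact triple_vectorUp a (hj j).1 (hj j).2 (hj k).1 (hj k).2 (hj l).1 (hj l).2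
  · intro j k l
    simp only [parafermionOp_neg_one]
    exact triple_vectorDown b (hj j).1 (hj j).2 (hj k).1 (hj k).2 (hj l).1 (hj l).2

/-- The operators `½[f_k⁺, f_k⁻]`, `½[f_k⁺, f_{k+1}⁻]` and `½[f_{k+1}⁺, f_k⁻]` are the Chevalley
operators. -/
theorem lie_vectorUp_vectorDown (hab : ∀ i x, a i x * b i x = topFactor p i x) {k : ℕ}
    (hk : 1 ≤ k) (hkn : k ≤ n) : ⁅vectorUp n a k, vectorDown n b k⁆ = (2 : ℂ) • weightOp n p k ∧
      (k < n → ⁅vectorUp n a k, vectorDown n b (k + 1)⁆ = (2 : ℂ) • rowUp n a k ∧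
        ⁅vectorUp n a (k + 1), vectorDown n b k⁆ = (2 : ℂ) • rowDown n b k) := by
  have h := isVectorPair a b p (hk.trans hkn) hab
  refine @IsVectorPair.chevalley (Module.End ℂ (PatternSpace n)) LieRing.ofAssociativeRing
    LieAlgebra.ofAssociativeAlgebra _ _ _ _ _ _ h (weightOp n p) rfl
    (fun k h1 h2 => lie_rowUp_rowDown a b p h1 h2) (fun k h1 h2 => ?_) (fun k h1 h2 => ?_) _ hk hkn
  · refine (lie_weightOp_rowUp a p (k + 1) k).trans ?_
    rw [if_neg (by omega), if_pos (by omega), zero_sub]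
    exact LinearMap.ext fun v => by
      rw [LinearMap.smul_apply, LinearMap.neg_apply, neg_one_smul]
  · have h3 : ⁅weightOp n p (k + 1), rowUp n b k⁆ = -rowUp n b k := by
      refine (lie_weightOp_rowUp b p (k + 1) k).trans ?_
      rw [if_neg (by omega), if_pos (by omega), zero_sub]
      exact LinearMap.ext fun v => by
        rw [LinearMap.smul_apply, LinearMap.neg_apply, neg_one_smul]
    have h4 := ((isTranspose_weightOp p (k + 1)).lie (isTranspose_rowUp b k)).eq_of_eq
      (isTranspose_rowUp b k).neg h3
    refine (neg_lie_comm _ _).trans ?_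
    rw [h4]
    exact neg_neg (G := Module.End ℂ (PatternSpace n)) _

theorem isGZFamily_parafermionOp (hab : ∀ i x, a i x * b i x = topFactor p i x) :
    IsGZFamily p (parafermionOp n a b) patternVec := by
  rw [isGZFamily_iff]
  have half : ∀ v : PatternSpace n, (1 / 2 : ℂ) • (2 : ℂ) • v = v := fun v => by
    rw [smul_smul]
    norm_num
  refine ⟨fun k m => ?_, fun k k' m hk => ?_, fun k k' m hk => ?_⟩
  · rw [parafermionOp_one, parafermionOp_neg_one,
      (lie_vectorUp_vectorDown hab (Nat.le_add_left 1 k) k.2).1, LinearMap.smul_apply, half,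
      weightOp_apply, Nat.add_sub_cancel]
  · have hkn : (k : ℕ) + 1 < n := by omega
    rw [parafermionOp_one, parafermionOp_neg_one, hk,
      ((lie_vectorUp_vectorDown hab (Nat.le_add_left 1 k) k.2).2 hkn).1, LinearMap.smul_apply,
      half, rowUp, shiftOp_apply]
    simp only [rowCoeff, rowRad, hkn, if_true, one_mul, gzCoeff_eq]
  · have hkn : (k : ℕ) + 1 < n := by omega
    rw [parafermionOp_one, parafermionOp_neg_one, hk,
      ((lie_vectorUp_vectorDown hab (Nat.le_add_left 1 k) k.2).2 hkn).2, LinearMap.smul_apply,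
      half, rowDown, shiftOp_apply]
    simp only [rowCoeff, rowRad, hkn, if_true, one_mul, gzCoeff_eq]

/-- The transpose of a raising operator annihilates the vacuum. -/
theorem Raises.transpose_apply {A B : Module.End ℂ (PatternSpace n)} (hA : Raises A)
    (h : IsTranspose A B) : B (patternVec (zeroPattern n)) = 0 := by
  ext m
  rw [← isTranspose_iff.1 h, hA]
  rfl

theorem vectorDown_zeroPattern (b : ℕ → ℤ → ℂ) (j : ℕ) :
    vectorDown n b j (patternVec (zeroPattern n)) = 0 :=
  (raises_vectorUp b j).transpose_apply (isTranspose_vectorUp b j)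

theorem rowDown_zeroPattern (b : ℕ → ℤ → ℂ) (k : ℕ) :
    rowDown n b k (patternVec (zeroPattern n)) = 0 :=
  (raises_rowUp b).transpose_apply (isTranspose_rowUp b k)

theorem rowUp_zeroPattern (a : ℕ → ℤ → ℂ) {k : ℕ} (hk : k < n) :
    rowUp n a k (patternVec (zeroPattern n)) = 0 := by
  rw [rowUp, shiftOp_apply]
  refine Finset.sum_eq_zero fun i hi => ?_
  rw [Finset.mem_Icc] at hi
  rw [ket_of_not_isGZ, smul_zero]
  intro hg
  have := (((zeroPattern n).isGZ.raise_iff hi.1 hi.2 hk.le).1 hg).1 hk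
  simp [GZPattern.toInt, zeroPattern] at this

/-- The operators `½[f_j⁺, f_k⁻]` with `j ≠ k` annihilate the vacuum, since they are commutators of
lowering, respectively raising operators of the rows below the top row, for which `|0)` is a
one-dimensional representation. -/
theorem lie_vectorUp_vectorDown_zeroPattern (hab : ∀ i x, a i x * b i x = topFactor p i x)
    {j k : ℕ} (hj : 1 ≤ j) (hjn : j ≤ n) (hk : 1 ≤ k) (hkn : k ≤ n) :
    ⁅vectorUp n a j, vectorDown n b k⁆ (patternVec (zeroPattern n)) =
      (if j = k then -p else 0) • patternVec (zeroPattern n) := by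
  have h := isVectorPair a b p (hj.trans hjn) hab
  have hself : ∀ k, 1 ≤ k → k ≤ n → ⁅vectorUp n a k, vectorDown n b k⁆
      (patternVec (zeroPattern n)) = (if k = k then -p else 0) • patternVec (zeroPattern n) := by
    intro k hk hkn
    rw [(lie_vectorUp_vectorDown hab hk hkn).1, LinearMap.smul_apply, weightOp_apply, smul_smul,
      if_pos rfl]
    congr 1
    simp [rowSum, zeroPattern]
    ring
  have key : ∀ {X Y : Module.End ℂ (PatternSpace n)} {c : ℂ},
      X (patternVec (zeroPattern n)) = 0 →
      Y (patternVec (zeroPattern n)) = c • patternVec (zeroPattern n) →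
      ⁅X, Y⁆ (patternVec (zeroPattern n)) = 0 := by
    intro X Y c hX hY
    rw [Ring.lie_def, LinearMap.sub_apply, Module.End.mul_apply, Module.End.mul_apply, hX, hY,
      map_smul, hX, map_zero, smul_zero, sub_zero]
  have hlt : ∀ d j k, 1 ≤ j → j + (d + 1) = k → k ≤ n →
      ⁅vectorUp n a j, vectorDown n b k⁆ (patternVec (zeroPattern n)) = 0 := by
    intro d
    induction d with
    | zero =>
      rintro j k hj rfl hk
      rw [@IsVectorPair.lie_raise (Module.End ℂ (PatternSpace n)) LieRing.ofAssociativeRing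
        LieAlgebra.ofAssociativeAlgebra _ _ _ _ _ _ h j (j + (0 + 1)) hj (by omega) (by omega) hk,
        if_neg (by omega), zero_add]
      exact key (rowUp_zeroPattern a (by omega)) (hself (j + 1) (by omega) hk)
    | succ d ih =>
      rintro j k hj rfl hk
      rw [@IsVectorPair.lie_raise (Module.End ℂ (PatternSpace n)) LieRing.ofAssociativeRing
        LieAlgebra.ofAssociativeAlgebra _ _ _ _ _ _ h j _ hj (by omega) (by omega) hk,
        if_neg (by omega), zero_add]
      exact key (c := 0) (rowUp_zeroPattern a (by omega))
        ((ih (j + 1) _ (by omega) (by omega) hk).trans (zero_smul ℂ _).symm)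
  have hgt : ∀ d j k, 1 ≤ k → k + (d + 1) = j → j ≤ n →
      ⁅vectorUp n a j, vectorDown n b k⁆ (patternVec (zeroPattern n)) = 0 := by
    intro d
    induction d with
    | zero =>
      rintro j k hk rfl hj
      rw [@IsVectorPair.lie_lower (Module.End ℂ (PatternSpace n)) LieRing.ofAssociativeRing
        LieAlgebra.ofAssociativeAlgebra _ _ _ _ _ _ h (k + (0 + 1)) k (by omega) hj hk (by omega),
        if_neg (by omega), zero_sub, LinearMap.neg_apply, neg_eq_zero]
      exact key (rowDown_zeroPattern b k) (hself (k + 1) (by omega) hj)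
    | succ d ih =>
      rintro j k hk rfl hj
      rw [@IsVectorPair.lie_lower (Module.End ℂ (PatternSpace n)) LieRing.ofAssociativeRing
        LieAlgebra.ofAssociativeAlgebra _ _ _ _ _ _ h _ k (by omega) hj hk (by omega),
        if_neg (by omega), zero_sub, LinearMap.neg_apply, neg_eq_zero]
      exact key (c := 0) (rowDown_zeroPattern b k)
        ((ih _ (k + 1) (by omega) (by omega) hj).trans (zero_smul ℂ _).symm)
  rcases lt_trichotomy j k with hjk | rfl | hjk
  · rw [if_neg hjk.ne, zero_smul]
    exact hlt (k - j - 1) j k hj (by omega) hkn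
  · exact hself j hj hjn
  · rw [if_neg hjk.ne', zero_smul]
    exact hgt (j - k - 1) j k hk (by omega) hjn

end

/-! ### The reduced matrix elements as square roots -/

/-- The part of `G_k` that depends on `p`, with the principal square root. -/
def sqrtWeight (p : ℂ) (i : ℕ) (x : ℤ) : ℂ := topFactor p i x ^ (1 / 2 : ℂ)

/-- The part of `G_k^*` that depends on `p`: as `sqrtWeight`, except that a vanishing factor is left
out. -/
def regularWeight (p : ℂ) (i : ℕ) (x : ℤ) : ℂ :=
  if topFactor p i x = 0 then 1 else sqrtWeight p i x

theorem cpow_half_mul_self (z : ℂ) : z ^ (1 / 2 : ℂ) * z ^ (1 / 2 : ℂ) = z := by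
  by_cases hz : z = 0
  · subst hz
    rw [Complex.zero_cpow (by norm_num), mul_zero]
  · rw [← Complex.cpow_add _ _ hz, add_halves, Complex.cpow_one]

theorem ofReal_cpow_half {x : ℝ} (hx : 0 ≤ x) : (x : ℂ) ^ (1 / 2 : ℂ) = (Real.sqrt x : ℂ) := by
  rw [Real.sqrt_eq_rpow, Complex.ofReal_cpow hx]
  norm_num

/-- A positive factor can be taken out of the principal square root. -/
theorem mul_ofReal_cpow_half (z : ℂ) {x : ℝ} (hx : 0 < x) :
    (z * (x : ℂ)) ^ (1 / 2 : ℂ) = z ^ (1 / 2 : ℂ) * (Real.sqrt x : ℂ) := by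
  by_cases hz : z = 0
  · subst hz
    rw [zero_mul, Complex.zero_cpow (by norm_num), zero_mul]
  · have hx0 : (x : ℂ) ≠ 0 := by exact_mod_cast hx.ne'
    rw [← ofReal_cpow_half hx.le, Complex.cpow_def_of_ne_zero (mul_ne_zero hz hx0),
      Complex.cpow_def_of_ne_zero hz, Complex.cpow_def_of_ne_zero hx0,
      Complex.log_mul_ofReal x hx z hz, ← Complex.exp_add, Complex.ofReal_log hx.le]
    congr 1
    ring

theorem sqrtWeight_mul_self (p : ℂ) (i : ℕ) (x : ℤ) :
    sqrtWeight p i x * sqrtWeight p i x = topFactor p i x :=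
  cpow_half_mul_self _

theorem regularWeight_mul_sqrtWeight (p : ℂ) (i : ℕ) (x : ℤ) :
    regularWeight p i x * sqrtWeight p i x = topFactor p i x := by
  rw [regularWeight]
  split_ifs with h
  · rw [sqrtWeight, h, Complex.zero_cpow (by norm_num), mul_zero]
  · exact sqrtWeight_mul_self p i x

theorem regularWeight_ne_zero (p : ℂ) (i : ℕ) (x : ℤ) : regularWeight p i x ≠ 0 := by
  rw [regularWeight]
  split_ifs with h
  · exact one_ne_zero
  · intro h0
    rw [← sqrtWeight_mul_self, h0, mul_zero] at h
    exact h rfl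

section

variable {n : ℕ}

theorem hasWeights_reducedG (p : ℂ) : HasWeights n (reducedG n p) (sqrtWeight p) := by
  intro e he i hi hin
  have hpos := redRad_pos he hi hin
  rw [reducedG, sqrtWeight, topFactor]
  split_ifs with h
  · rw [radicandEven_eq n i e h, ofReal_cpow_half hpos.le, Complex.one_cpow, one_mul]
  · rw [radicandOdd_eq n i e (Nat.not_even_iff_odd.1 h), mul_ofReal_cpow_half _ hpos]
    rfl

theorem hasWeights_reducedGRegular (p : ℂ) :
    HasWeights n (reducedGRegular n p) (regularWeight p) := by
  intro e he i hi hin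
  have hpos := redRad_pos he hi hin
  rw [reducedGRegular, regularWeight]
  by_cases h : Even i
  · have h1 : topFactor p i (e i n) = 1 := if_pos h
    rw [if_neg (fun h2 => Nat.not_even_iff_odd.2 h2.1 h), if_neg (by rw [h1]; exact one_ne_zero)]
    exact hasWeights_reducedG p e he i hi hin
  · have h1 : topFactor p i (e i n) = orderFactor p i (fun a => e a n) := if_neg h
    rw [h1]
    by_cases h2 : orderFactor p i (fun a => e a n) = 0
    · rw [if_pos ⟨Nat.not_even_iff_odd.1 h, h2⟩, if_pos h2,
        radicandOdd_eq n i e (Nat.not_even_iff_odd.1 h), ofReal_cpow_half hpos.le, one_mul]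
    · rw [if_neg (fun h3 => h2 h3.2), if_neg h2]
      exact hasWeights_reducedG p e he i hi hin

theorem patternOp_eq (p : ℂ) :
    patternOp n p = parafermionOp n (sqrtWeight p) (sqrtWeight p) := by
  funext σ j
  rcases Int.units_eq_one_or σ with rfl | rfl
  · rw [parafermionOp_one, ← raiseOp_eq_vectorUp (hasWeights_reducedG p) j.2]
    rfl
  · rw [parafermionOp_neg_one, ← lowerOp_eq_vectorDown (hasWeights_reducedG p) j.2]
    rfl

theorem patternOp_lie_zeroPattern (p : ℂ) (j k : Fin n) :
    ⁅patternOp n p (-1) j, patternOp n p 1 k⁆ (patternVec (zeroPattern n)) =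
      (if j = k then p else 0) • patternVec (zeroPattern n) := by
  rw [patternOp_eq, parafermionOp_one, parafermionOp_neg_one, neg_lie_comm, LinearMap.neg_apply,
    lie_vectorUp_vectorDown_zeroPattern (sqrtWeight_mul_self p) (by omega) k.2 (by omega) j.2,
    ← neg_smul]
  by_cases h : j = k
  · rw [if_pos h, if_pos (by rw [h]), neg_neg]
  · rw [if_neg h, if_neg (fun h' => h (Fin.ext (by omega))), neg_zero]

end

/-! ### Growth diagrams -/

/-- The local rule of growth diagrams for partitions `κ ⊆ α, β` (with parts indexed from `0`) and a
natural number `a`. The subtraction does not truncate if `α` or `β` arises from `κ` by adding a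
horizontal strip. -/
def localRule (α β κ : ℕ → ℕ) (a : ℕ) : ℕ → ℕ
  | 0 => max (α 0) (β 0) + a
  | i + 1 => min (α i) (β i) + max (α (i + 1)) (β (i + 1)) - κ i

/-- The sequence `y` arises from `x` by adding a horizontal strip. -/
def IsStrip (x y : ℕ → ℕ) : Prop := ∀ i, x i ≤ y i ∧ y (i + 1) ≤ x i

theorem localRule_comm (α β κ : ℕ → ℕ) (a : ℕ) : localRule α β κ a = localRule β α κ a := by
  funext i
  cases i with
  | zero => rw [localRule, localRule, max_comm]
  | succ i => rw [localRule, localRule, max_comm, min_comm]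

theorem isStrip_localRule {α β κ : ℕ → ℕ} (hα : IsStrip κ α) (hβ : IsStrip κ β) (a : ℕ) :
    IsStrip α (localRule α β κ a) := by
  intro i
  have h1 := hα i
  have h2 := hβ i
  refine ⟨?_, by rw [localRule]; omega⟩
  cases i with
  | zero => rw [localRule]; omega
  | succ i =>
    have h3 := hα i
    have h4 := hβ i
    rw [localRule]
    omega

/-- The local rule is invertible: `α`, `β` and the result determine `κ` and `a`. -/
theorem localRule_injective {α β κ κ' : ℕ → ℕ} {a a' : ℕ} (hα : IsStrip κ α) (hβ : IsStrip κ β)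
    (hα' : IsStrip κ' α) (hβ' : IsStrip κ' β)
    (h : localRule α β κ a = localRule α β κ' a') : κ = κ' ∧ a = a' := by
  constructor
  · funext i
    have h1 := congrFun h (i + 1)
    rw [localRule, localRule] at h1
    have h2 := hα i
    have h3 := hβ i
    have h4 := hα' i
    have h5 := hβ' i
    omega
  · have h1 := congrFun h 0
    rw [localRule, localRule] at h1
    omega

/-- The local rule adds `a` to the sizes: `|λ| + |κ| = a + |α| + |β|`, where `λ` is the result. -/
theorem sum_localRule {α β κ : ℕ → ℕ} (hα : IsStrip κ α) (hβ : IsStrip κ β) (a : ℕ) {N : ℕ}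
    (hN : α N = 0) : ∑ i ∈ Finset.range (N + 1), localRule α β κ a i +
      ∑ i ∈ Finset.range (N + 1), κ i =
      a + ∑ i ∈ Finset.range (N + 1), α i + ∑ i ∈ Finset.range (N + 1), β i := by
  have h1 : ∀ i, localRule α β κ a (i + 1) + κ i =
      min (α i) (β i) + max (α (i + 1)) (β (i + 1)) := by
    intro i
    have h2 := hα i
    have h3 := hβ i
    rw [localRule]
    omega
  have h2 : ∀ i, min (α i) (β i) + max (α i) (β i) = α i + β i := fun i => min_add_max _ _
  have hκ : κ N = 0 := Nat.le_zero.1 (hN ▸ (hα N).1)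
  rw [Finset.sum_range_succ', Finset.sum_range_succ κ, hκ, localRule, add_zero]
  have h3 := Finset.sum_congr rfl fun i (_ : i ∈ Finset.range N) => h1 i
  have h4 := Finset.sum_congr rfl fun i (_ : i ∈ Finset.range (N + 1)) => h2 i
  simp only [Finset.sum_add_distrib] at h3 h4
  rw [Finset.sum_range_succ' (fun i => max (α i) (β i)),
    Finset.sum_range_succ (fun i => min (α i) (β i)), hN, Nat.zero_min, add_zero] at h4
  omega

/-- The growth diagram of the matrix `t`: a partition for each lattice point `(r, s)`, empty on the
axes, and continued across the cell with corners `(r, s)` and `(r + 1, s + 1)` by the local rule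
with the number `t r s`. -/
def growth (t : ℕ → ℕ → ℕ) : ℕ → ℕ → ℕ → ℕ
  | 0, _ => fun _ => 0
  | _ + 1, 0 => fun _ => 0
  | r + 1, s + 1 => localRule (growth t r (s + 1)) (growth t (r + 1) s) (growth t r s) (t r s)

theorem growth_zero_right (t : ℕ → ℕ → ℕ) (r : ℕ) : growth t r 0 = fun _ => 0 := by
  cases r <;> rw [growth]

theorem growth_comm {t : ℕ → ℕ → ℕ} (ht : ∀ r s, t r s = t s r) (r s : ℕ) :
    growth t r s = growth t s r := by
  induction r generalizing s with
  | zero => rw [growth_zero_right, growth]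
  | succ r ihr =>
    induction s with
    | zero => rw [growth_zero_right, growth]
    | succ s ihs => rw [growth, growth, localRule_comm, ihs, ihr, ihr, ht]

theorem isStrip_growth (t : ℕ → ℕ → ℕ) (r s : ℕ) :
    IsStrip (growth t r s) (growth t (r + 1) s) ∧ IsStrip (growth t r s) (growth t r (s + 1)) := by
  induction r generalizing s with
  | zero =>
    refine ⟨?_, fun i => by simp [growth]⟩
    induction s with
    | zero => exact fun i => by simp [growth]
    | succ s ihs =>
      rw [growth.eq_3]
      exact isStrip_localRule (fun i => by simp [growth]) ihs _
  | succ r ihr =>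
    induction s with
    | zero =>
      refine ⟨fun i => by simp [growth], ?_⟩
      rw [growth.eq_3 t r 0, localRule_comm]
      exact isStrip_localRule (ihr 0).1 (ihr 0).2 _
    | succ s ihs =>
      constructor
      · rw [growth.eq_3 t (r + 1) s]
        exact isStrip_localRule ihs.2 ihs.1 _
      · rw [growth.eq_3 t r (s + 1), localRule_comm]
        exact isStrip_localRule (ihr (s + 1)).1 (ihr (s + 1)).2 _

theorem growth_eq_zero (t : ℕ → ℕ → ℕ) {r : ℕ} (s : ℕ) {i : ℕ} (hi : r ≤ i) :
    growth t r s i = 0 := by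
  induction r generalizing i with
  | zero => rw [growth]
  | succ r ih =>
    obtain ⟨i, rfl⟩ : ∃ i', i = i' + 1 := ⟨i - 1, by omega⟩
    have := ((isStrip_growth t r s).1 i).2
    rw [ih (by omega)] at this
    omega

/-- The size of the partition at `(r, s)` is the sum of the matrix entries in the rectangle below.
-/
theorem sum_growth (t : ℕ → ℕ → ℕ) {r N : ℕ} (s : ℕ) (hr : r ≤ N) :
    ∑ i ∈ Finset.range (N + 1), growth t r s i =
      ∑ i ∈ Finset.range r, ∑ j ∈ Finset.range s, t i j := by
  induction r generalizing s with
  | zero => simp [growth]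
  | succ r ihr =>
    induction s with
    | zero => simp [growth]
    | succ s ihs =>
      have h := sum_localRule (isStrip_growth t r s).2 (isStrip_growth t r s).1 (t r s)
        (growth_eq_zero t (s + 1) (by omega : r ≤ N))
      have e : growth t (r + 1) (s + 1) = localRule (growth t r (s + 1)) (growth t (r + 1) s)
        (growth t r s) (t r s) := growth.eq_3 t r s
      rw [← e, ihs, ihr s (by omega), ihr (s + 1) (by omega)] at h
      simp only [Finset.sum_range_succ, Finset.sum_add_distrib] at h ⊢
      omega

/-- The partitions on the outer boundary of the growth diagram determine the matrix. -/
theorem growth_injective {t t' : ℕ → ℕ → ℕ} {n : ℕ}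
    (h1 : ∀ r, r ≤ n → growth t r n = growth t' r n)
    (h2 : ∀ s, s ≤ n → growth t n s = growth t' n s) {r s : ℕ} (hr : r < n) (hs : s < n) :
    t r s = t' r s := by
  have key : ∀ d s, s + d = n → ∀ d' r, r + d' = n → growth t r s = growth t' r s ∧
      (0 < d → 0 < d' → t r s = t' r s) := by
    intro d
    induction d with
    | zero =>
      rintro s rfl d' r _
      exact ⟨h1 r (by omega), fun h => absurd h (lt_irrefl _)⟩
    | succ d ihd =>
      intro s hs d'
      induction d' with
      | zero =>
        rintro r rfl
        exact ⟨h2 s (by omega), fun _ h => absurd h (lt_irrefl _)⟩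
      | succ d' ihd' =>
        intro r hr
        have e1 := (ihd (s + 1) (by omega) d' (r + 1) (by omega)).1
        have e2 := (ihd (s + 1) (by omega) (d' + 1) r (by omega)).1
        have e3 := (ihd' (r + 1) (by omega)).1
        have s1 := isStrip_growth t r s
        have s2 := isStrip_growth t' r s
        rw [growth.eq_3, growth.eq_3, ← e2, ← e3] at e1
        have := localRule_injective s1.2 s1.1 (e2 ▸ s2.2) (e3 ▸ s2.1) e1
        exact ⟨this.1, fun _ _ => this.2⟩
  exact (key (n - s) s (by omega) (n - r) r (by omega)).2 (by omega) (by omega)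

/-- Triangular arrays of natural numbers with `n` columns: the exponents of a monomial in the `f_k⁺`
(on the diagonal) and the `[f_j⁺, f_k⁺]`, where `j < k < n`. -/
def Exponents (n : ℕ) : Type := {t : ℕ → ℕ → ℕ // ∀ j k, ¬ (j ≤ k ∧ k < n) → t j k = 0}

namespace Exponents

variable {n : ℕ}

/-- The symmetric matrix with a given upper triangular part. -/
def symm (t : ℕ → ℕ → ℕ) (i j : ℕ) : ℕ := t (min i j) (max i j)

/-- The pattern of a triangular array: its row `r` is the partition at the point `(r, n)` of the
growth diagram of the symmetric matrix. -/
def toPattern (t : Exponents n) : GZPattern n where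
  entry i r := if 1 ≤ i ∧ i ≤ r ∧ r ≤ n then growth (symm t.1) r n (i - 1) else 0
  zeros i j h := if_neg h
  upper i j h1 h2 h3 := by
    rw [if_pos ⟨h1, h2, h3.le⟩, if_pos ⟨h1, by omega, h3⟩]
    exact ((isStrip_growth _ j n).1 (i - 1)).1
  lower i j h1 h2 h3 := by
    rw [if_pos (by omega : 1 ≤ i + 1 ∧ i + 1 ≤ j + 1 ∧ j + 1 ≤ n), if_pos ⟨h1, h2, h3.le⟩]
    have := ((isStrip_growth (symm t.1) j n).1 (i - 1)).2
    rwa [Nat.sub_add_cancel h1] at this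

/-- By symmetry, the pattern contains the whole outer boundary of the growth diagram. -/
theorem toPattern_injective : Function.Injective (toPattern (n := n)) := by
  intro t t' h
  have hsymm : ∀ t : ℕ → ℕ → ℕ, ∀ r s, symm t r s = symm t s r := fun t r s => by
    rw [symm, symm, min_comm, max_comm]
  have h1 : ∀ r, r ≤ n → growth (symm t.1) r n = growth (symm t'.1) r n := by
    intro r hr
    funext i
    by_cases hi : i < r
    · have := congrFun (congrFun (congrArg GZPattern.entry h) (i + 1)) r
      simpa [toPattern, hr, Nat.succ_le_of_lt hi] using this
    · rw [growth_eq_zero _ _ (not_lt.1 hi), growth_eq_zero _ _ (not_lt.1 hi)]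
  refine Subtype.ext (funext fun i => funext fun k => ?_)
  by_cases hik : i ≤ k ∧ k < n
  · have := growth_injective h1 (fun s hs => by
      rw [growth_comm (hsymm _), h1 s hs, growth_comm (hsymm _)]) (hik.1.trans_lt hik.2) hik.2
    rwa [symm, symm, min_eq_left hik.1, max_eq_right hik.1] at this
  · rw [t.2 i k hik, t'.2 i k hik]

/-- The degree of a monomial in the `f_k⁺`. The commutators, of degree `2`, correspond to the two
entries off the diagonal of the symmetric matrix. -/
def degree (t : Exponents n) : ℕ :=
  ∑ i ∈ Finset.range n, ∑ j ∈ Finset.range n, symm t.1 i j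

theorem rowSum_toPattern (t : Exponents n) : rowSum t.toPattern n = t.degree := by
  have h := sum_growth (symm t.1) n (le_refl n)
  rw [Finset.sum_range_succ, growth_eq_zero _ _ le_rfl, add_zero] at h
  rw [degree, ← h, rowSum, ← Finset.Ico_add_one_right_eq_Icc, Finset.sum_Ico_eq_sum_range]
  refine Finset.sum_congr (by simp) fun i hi => ?_
  rw [Finset.mem_range] at hi
  simp [toPattern, Nat.add_comm 1 i, Nat.succ_le_of_lt hi]

end Exponents

/-! ### Ordered monomials -/

section monomials

variable {R : Type*} [Ring R] (F : ℕ → R)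

/-- The product of the `[f_j, f_k]^{t j k}` with `j < r`. -/
def commProd (t : ℕ → ℕ → ℕ) (k : ℕ) : ℕ → R
  | 0 => 1
  | r + 1 => commProd t k r * ⁅F r, F k⁆ ^ t r k

/-- The ordered monomial in `f_0, …, f_{n-1}` and their commutators, with exponents `t`. -/
def monomial (t : ℕ → ℕ → ℕ) : ℕ → R
  | 0 => 1
  | n + 1 => F n ^ t n n * (commProd F t n n * monomial t n)

theorem commProd_congr {t t' : ℕ → ℕ → ℕ} {k : ℕ} (r : ℕ) (h : ∀ j < r, t j k = t' j k) :
    commProd F t k r = commProd F t' k r := by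
  induction r with
  | zero => rfl
  | succ r ih =>
    rw [commProd, commProd, ih fun j hj => h j (by omega), h r (Nat.lt_succ_self r)]

theorem monomial_congr {t t' : ℕ → ℕ → ℕ} (n : ℕ) (h : ∀ j k, j ≤ k → k < n → t j k = t' j k) :
    monomial F t n = monomial F t' n := by
  induction n with
  | zero => rfl
  | succ n ih =>
    rw [monomial, monomial, ih fun j k hj hk => h j k hj (by omega),
      commProd_congr F n fun j hj => h j n hj.le (by omega), h n n le_rfl (by omega)]

theorem commute_commProd {F : ℕ → R} {c : R} (t : ℕ → ℕ → ℕ) (k : ℕ)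
    (hc : ∀ j, Commute c ⁅F j, F k⁆) (r : ℕ) : Commute c (commProd F t k r) := by
  induction r with
  | zero => exact Commute.one_right _
  | succ r ih => exact ih.mul_right ((hc r).pow_right _)

/-- Commutators that commute with the `f_j` can be collected. -/
theorem lie_mul_commProd {F : ℕ → R} (hF : ∀ j k l, Commute ⁅F j, F k⁆ (F l))
    (t : ℕ → ℕ → ℕ) {l k : ℕ} (r : ℕ) (hl : l < r) : ⁅F l, F k⁆ * commProd F t k r =
      commProd F (fun i j => if i = l ∧ j = k then t i j + 1 else t i j) k r := by
  have hcc : ∀ j k j' k', Commute ⁅F j, F k⁆ ⁅F j', F k'⁆ := fun j k j' k' => by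
    rw [Ring.lie_def (F j')]
    exact ((hF j k j').mul_right (hF j k k')).sub_right ((hF j k k').mul_right (hF j k j'))
  induction r with
  | zero => omega
  | succ r ih =>
    rw [commProd, commProd]
    rcases Nat.lt_succ_iff_lt_or_eq.1 hl with h | rfl
    · rw [← mul_assoc, ih h, if_neg (by omega)]
    · rw [if_pos ⟨rfl, rfl⟩, pow_succ', ← mul_assoc, ← mul_assoc,
        (commute_commProd t k (fun j => hcc l k j k) l).eq]
      congr 2
      exact commProd_congr F l fun j hj => by rw [if_neg (by omega)]

variable [Algebra ℂ R]

/-- The span of the ordered monomials in `f_0, …, f_{n-1}`. -/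
def monomialSpan (n : ℕ) : Submodule ℂ R := Submodule.span ℂ (Set.range fun t => monomial F t n)

theorem mul_mem_monomialSpan (n a : ℕ) (t : ℕ → ℕ → ℕ) {w : R} (hw : w ∈ monomialSpan F n) :
    F n ^ a * (commProd F t n n * w) ∈ monomialSpan F (n + 1) := by
  induction hw using Submodule.span_induction with
  | zero => simp [(monomialSpan F (n + 1)).zero_mem]
  | add x y _ _ hx hy =>
    rw [mul_add, mul_add]
    exact Submodule.add_mem _ hx hy
  | smul c x _ hx =>
    rw [mul_smul_comm, mul_smul_comm]
    exact Submodule.smul_mem _ c hx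
  | mem x hx =>
    obtain ⟨t', rfl⟩ := hx
    refine Submodule.subset_span
      ⟨fun j k => if k < n then t' j k else if j = n then a else t j k, ?_⟩
    dsimp only
    rw [monomial, if_neg (lt_irrefl n), if_pos rfl]
    congr 2
    · refine commProd_congr F n fun j hj => ?_
      rw [if_neg (lt_irrefl n), if_neg hj.ne]
    · exact monomial_congr F n fun j k _ hk => by rw [if_pos hk]

variable {F}

theorem mul_pow_eq (hF : ∀ j k l, Commute ⁅F j, F k⁆ (F l)) (l n a : ℕ) :
    F l * F n ^ a = F n ^ a * F l + (a : ℂ) • (F n ^ (a - 1) * ⁅F l, F n⁆) := by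
  induction a with
  | zero => simp
  | succ a ih =>
    have h1 : F l * F n = F n * F l + ⁅F l, F n⁆ := by
      rw [Ring.lie_def]
      abel
    rw [pow_succ, ← mul_assoc, ih, add_mul, mul_assoc, h1, mul_add, smul_mul_assoc,
      mul_assoc _ _ (F n), (hF l n n).eq, ← mul_assoc _ (F n) ⁅F l, F n⁆, ← mul_assoc,
      Nat.add_sub_cancel, add_assoc]
    congr 1
    rcases Nat.eq_zero_or_pos a with rfl | ha
    · simp
    · rw [← pow_succ, Nat.sub_add_cancel ha]
      push_cast
      rw [add_smul, one_smul, add_comm]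

/-- The span of the ordered monomials is stable under multiplication by the `f_l`. -/
theorem mul_mem_monomialSpan_of_lt (hF : ∀ j k l, Commute ⁅F j, F k⁆ (F l)) {l n : ℕ} (hl : l < n)
    {w : R} (hw : w ∈ monomialSpan F n) : F l * w ∈ monomialSpan F n := by
  induction n generalizing w with
  | zero => omega
  | succ n ih =>
    induction hw using Submodule.span_induction with
    | zero => simp [(monomialSpan F (n + 1)).zero_mem]
    | add x y _ _ hx hy =>
      rw [mul_add]
      exact Submodule.add_mem _ hx hy
    | smul c x _ hx =>
      rw [mul_smul_comm]
      exact Submodule.smul_mem _ c hx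
    | mem x hx =>
      obtain ⟨t, rfl⟩ := hx
      dsimp only
      rw [monomial]
      have hm : monomial F t n ∈ monomialSpan F n := Submodule.subset_span ⟨t, rfl⟩
      rcases Nat.lt_succ_iff_lt_or_eq.1 hl with h | rfl
      · have h1 : F l * commProd F t n n = commProd F t n n * F l :=
          (commute_commProd t n (fun j => (hF j n l).symm) n).eq
        rw [← mul_assoc, mul_pow_eq hF, add_mul, mul_assoc, ← mul_assoc (F l), h1,
          mul_assoc _ (F l), smul_mul_assoc, mul_assoc, ← mul_assoc ⁅F l, F n⁆,
          lie_mul_commProd hF t n h]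
        exact Submodule.add_mem _ (mul_mem_monomialSpan F n _ _ (ih h hm))
          (Submodule.smul_mem _ _ (mul_mem_monomialSpan F n _ _ hm))
      · rw [← mul_assoc, ← pow_succ']
        exact mul_mem_monomialSpan F l _ _ hm

end monomials

section degree

variable {R : Type*} [Ring R]

/-- The element `A` raises the eigenvalues of `D` by `d`. -/
def HasDegree (D A : R) (d : ℕ) : Prop := D * A = A * (D + (d : R))

theorem HasDegree.mul {D A B : R} {d d' : ℕ} (h : HasDegree D A d) (h' : HasDegree D B d') :
    HasDegree D (A * B) (d + d') := by
  unfold HasDegree at *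
  rw [← mul_assoc, h, mul_assoc, add_mul, h', mul_assoc, Nat.cast_comm, ← mul_add]
  push_cast
  rw [add_assoc, add_comm (d' : R)]

theorem HasDegree.one (D : R) : HasDegree D 1 0 := by
  simp [HasDegree]

theorem HasDegree.pow {D A : R} {d : ℕ} (h : HasDegree D A d) (k : ℕ) :
    HasDegree D (A ^ k) (k * d) := by
  induction k with
  | zero => simpa using HasDegree.one D
  | succ k ih => rw [pow_succ, add_mul, one_mul]; exact ih.mul h

theorem HasDegree.lie {D A B : R} {d d' : ℕ} (h : HasDegree D A d) (h' : HasDegree D B d') :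
    HasDegree D ⁅A, B⁆ (d + d') := by
  have h1 := h.mul h'
  have h2 := h'.mul h
  rw [add_comm] at h2
  unfold HasDegree at *
  rw [Ring.lie_def, mul_sub, h1, h2, sub_mul]

theorem HasDegree.monomial {D : R} {F : ℕ → R} (h : ∀ j, HasDegree D (F j) 1) (t : ℕ → ℕ → ℕ)
    (n : ℕ) : HasDegree D (monomial F t n)
      (∑ i ∈ Finset.range n, ∑ j ∈ Finset.range n, Exponents.symm t i j) := by
  have hc : ∀ k r, HasDegree D (commProd F t k r) (2 * ∑ j ∈ Finset.range r, t j k) := by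
    intro k r
    induction r with
    | zero => exact HasDegree.one D
    | succ r ih =>
      rw [Finset.sum_range_succ, mul_add, commProd]
      refine ih.mul ?_
      rw [mul_comm]
      exact ((h r).lie (h k)).pow _
  induction n with
  | zero => exact HasDegree.one D
  | succ n ih =>
    have e : ∑ i ∈ Finset.range (n + 1), ∑ j ∈ Finset.range (n + 1), Exponents.symm t i j =
        t n n * 1 + (2 * ∑ j ∈ Finset.range n, t j n +
          ∑ i ∈ Finset.range n, ∑ j ∈ Finset.range n, Exponents.symm t i j) := by
      have e1 : ∀ j ∈ Finset.range n, Exponents.symm t j n = t j n := fun j hj => by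
        have := (Finset.mem_range.1 hj).le
        rw [Exponents.symm, min_eq_left this, max_eq_right this]
      have e2 : ∀ j ∈ Finset.range n, Exponents.symm t n j = t j n := fun j hj => by
        have := (Finset.mem_range.1 hj).le
        rw [Exponents.symm, min_eq_right this, max_eq_left this]
      have e3 : Exponents.symm t n n = t n n := by simp [Exponents.symm]
      simp only [Finset.sum_range_succ, Finset.sum_add_distrib]
      rw [Finset.sum_congr rfl e1, Finset.sum_congr rfl e2, e3]
      ring
    rw [e, Parafermion.monomial]
    exact ((h n).pow _).mul ((hc n n).mul ih)

end degree

/-! ### A dimension count -/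

/-- A surjective graded linear map is injective, if its source is spanned by homogeneous vectors
`v i` that can be matched with different homogeneous basis vectors of the target of the same degree.
-/
theorem injective_of_degree {ι κ V : Type*} [AddCommGroup V] [Module ℂ V] (v : ι → V)
    (hv : Submodule.span ℂ (Set.range v) = ⊤) (Φ : V →ₗ[ℂ] κ →₀ ℂ) (hΦ : Function.Surjective Φ)
    (dι : ι → ℕ) (dκ : κ → ℕ) (hhom : ∀ i m, Φ (v i) m ≠ 0 → dκ m = dι i) (g : ι → κ)
    (hg : Function.Injective g) (hgd : ∀ i, dκ (g i) = dι i)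
    (hfin : ∀ N, {m | dκ m ≤ N}.Finite) : Function.Injective Φ := by
  classical
  rw [injective_iff_map_eq_zero]
  intro x hx
  have hcomb : ∀ y : V, ∃ c : ι →₀ ℂ, Finsupp.linearCombination ℂ v c = y := fun y => by
    have : y ∈ Submodule.span ℂ (Set.range v) := by rw [hv]; trivial
    exact (Finsupp.mem_span_range_iff_exists_finsupp.1 this)
  have hΦc : ∀ (c : ι →₀ ℂ) (m : κ), Φ (Finsupp.linearCombination ℂ v c) m =
      ∑ i ∈ c.support, c i * Φ (v i) m := fun c m => by
    rw [Finsupp.linearCombination_apply, Finsupp.sum, map_sum, Finsupp.finsetSum_apply]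
    simp
  obtain ⟨c, rfl⟩ := hcomb x
  set N := c.support.sup dι with hN
  have hcN : ∀ i, c i ≠ 0 → dι i ≤ N := fun i hi =>
    Finset.le_sup (f := dι) (Finsupp.mem_support_iff.2 hi)
  -- it suffices to consider degrees up to `N`, where source and target become finite
  let K := {m // dκ m ≤ N}
  let I := {i // dι i ≤ N}
  have : Fintype K := (hfin N).fintype
  have hIK : Function.Injective (fun i : I => (⟨g i.1, (hgd i.1).trans_le i.2⟩ : K)) := by
    intro i j hij
    exact Subtype.ext (hg (congrArg Subtype.val hij))
  have : Fintype I := Fintype.ofInjective _ hIK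
  let u : I → K → ℂ := fun i m => Φ (v i.1) m.1
  have hsum : ∀ (d : ι →₀ ℂ) (m : K), ∑ i ∈ d.support, d i * Φ (v i) m.1 =
      ∑ i : I, d i.1 * u i m := by
    intro d m
    refine Eq.trans ?_ (Finset.sum_map Finset.univ
      (Function.Embedding.subtype fun i => dι i ≤ N) (fun i => d i * Φ (v i) m.1))
    refine Finset.sum_congr_of_eq_on_inter (fun i _ hi => ?_) (fun i _ hi => ?_) fun _ _ _ => rfl
    · by_contra h
      refine hi (Finset.mem_map.2 ⟨⟨i, ?_⟩, Finset.mem_univ _, rfl⟩)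
      rw [← hhom i m.1 (right_ne_zero_of_mul h)]
      exact m.2
    · rw [Finsupp.notMem_support_iff.1 hi, zero_mul]
  have huspan : ⊤ ≤ Submodule.span ℂ (Set.range u) := by
    intro y _
    obtain ⟨z, hz⟩ := hΦ (∑ m : K, Finsupp.single m.1 (y m))
    obtain ⟨d, rfl⟩ := hcomb z
    have hy : y = ∑ i : I, d i.1 • u i := by
      funext m
      have h1 : (∑ m : K, Finsupp.single m.1 (y m)) m.1 = y m := by
        rw [Finsupp.finsetSum_apply, Finset.sum_eq_single m]
        · simp
        · intro m' _ hm'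
          exact Finsupp.single_eq_of_ne (fun h => hm' (Subtype.ext h.symm))
        · simp
      rw [← h1, ← hz, hΦc, hsum]
      simp
    rw [hy]
    exact Submodule.sum_mem _ fun i _ => Submodule.smul_mem _ _ (Submodule.subset_span ⟨i, rfl⟩)
  -- at most as many vectors as the dimension, which span, are independent
  have hli : LinearIndependent ℂ u := by
    refine linearIndependent_of_top_le_span_of_card_eq_finrank huspan ?_
    refine le_antisymm ?_ ?_
    · rw [Module.finrank_fintype_fun_eq_card]
      exact Fintype.card_le_of_injective _ hIK
    · rw [← finrank_top, ← top_le_iff.1 huspan]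
      exact finrank_range_le_card u
  have hzero : ∑ i : I, c i.1 • u i = 0 := by
    funext m
    have h1 := hΦc c m.1
    rw [hx, hsum] at h1
    simpa using h1.symm
  have h0 := Fintype.linearIndependent_iff.1 hli (fun i => c i.1) hzero
  have hc0 : c = 0 := by
    ext i
    by_contra hi
    exact hi (h0 ⟨i, hcN i hi⟩)
  rw [hc0, map_zero]

/-! ### Representations of `so(2n+1)` from parafermion operators -/

/-- A linear map that respects the brackets of a set of elements `f i` is a homomorphism of Lie
algebras, if the `f i` and their brackets span and the double brackets obey the same relations on
both sides. -/
theorem map_lie_of_double_lie {ι L A : Type*} [LieRing L] [LieAlgebra ℂ L] [LieRing A]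
    [LieAlgebra ℂ A] {f : ι → L} {F : ι → A} (c d : ι → ι → ι → ℂ)
    (hf : ∀ i j k, ⁅⁅f i, f j⁆, f k⁆ = c i j k • f i - d i j k • f j)
    (hF : ∀ i j k, ⁅⁅F i, F j⁆, F k⁆ = c i j k • F i - d i j k • F j)
    (hspan : Submodule.span ℂ (Set.range f ∪ Set.range fun q : ι × ι => ⁅f q.1, f q.2⁆) = ⊤)
    (ρ : L →ₗ[ℂ] A) (h1 : ∀ i, ρ (f i) = F i) (h2 : ∀ i j, ρ ⁅f i, f j⁆ = ⁅F i, F j⁆) (x y : L) :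
    ρ ⁅x, y⁆ = ⁅ρ x, ρ y⁆ := by
  have key : ∀ x k, ρ ⁅x, f k⁆ = ⁅ρ x, F k⁆ := by
    intro x k
    have hx : x ∈ Submodule.span ℂ (Set.range f ∪ Set.range fun q : ι × ι => ⁅f q.1, f q.2⁆) := by
      rw [hspan]
      trivial
    induction hx using Submodule.span_induction with
    | zero => simp
    | add x y _ _ hx hy => rw [add_lie, map_add, map_add, add_lie, hx, hy]
    | smul a x _ hx => rw [smul_lie, map_smul, map_smul, smul_lie, hx]
    | mem x hx =>
      rcases hx with ⟨i, rfl⟩ | ⟨⟨i, j⟩, rfl⟩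
      · rw [h2, h1]
      · dsimp only
        rw [hf, map_sub, map_smul, map_smul, h1, h1, h2, hF]
  have hy : y ∈ Submodule.span ℂ (Set.range f ∪ Set.range fun q : ι × ι => ⁅f q.1, f q.2⁆) := by
    rw [hspan]
    trivial
  induction hy using Submodule.span_induction with
  | zero => simp
  | add y z _ _ hy hz => rw [lie_add, map_add, map_add, lie_add, hy, hz]
  | smul a y _ hy => rw [lie_smul, map_smul, map_smul, lie_smul, hy]
  | mem y hy =>
    rcases hy with ⟨i, rfl⟩ | ⟨⟨i, j⟩, rfl⟩
    · rw [key, h1]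
    · dsimp only
      rw [leibniz_lie, map_add, ← lie_skew (f i), map_neg, key, key, key, key, h2, leibniz_lie,
        ← lie_skew (F i)]

variable {n : ℕ}

theorem soGen_one (n : ℕ) (j : Fin n) : (soGen n 1 j).1 = fPlusMat n j := by
  simp [soGen]

theorem soGen_neg_one (n : ℕ) (j : Fin n) : (soGen n (-1) j).1 = fMinusMat n j := by
  simp [soGen]

/-- `[f_j^+, f_k^+] = -2 (e_{j,n+k} - e_{k,n+j})`. -/
theorem lie_plus_plus (n : ℕ) (j k : Fin n) : (⁅soGen n 1 j, soGen n 1 k⁆ : so n).1 =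
    (-2 : ℂ) • (Matrix.single (.inl (.inl j)) (.inl (.inr k)) 1
      - Matrix.single (.inl (.inl k)) (.inl (.inr j)) 1) := by
  have e : (⁅soGen n 1 j, soGen n 1 k⁆ : so n).1 =
      fPlusMat n j * fPlusMat n k - fPlusMat n k * fPlusMat n j := by
    rw [← soGen_one, ← soGen_one]
    rfl
  rw [e]
  simp only [fPlusMat, Matrix.smul_mul, Matrix.mul_smul, smul_smul, sqrt_two_mul_sqrt_two]
  rw [← smul_sub, neg_smul, ← smul_neg]
  congr 1
  simp [mul_sub, sub_mul]
  abel

/-- `[f_j^-, f_k^-] = -2 (e_{n+j,k} - e_{n+k,j})`. -/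
theorem lie_minus_minus (n : ℕ) (j k : Fin n) : (⁅soGen n (-1) j, soGen n (-1) k⁆ : so n).1 =
    (-2 : ℂ) • (Matrix.single (.inl (.inr j)) (.inl (.inl k)) 1
      - Matrix.single (.inl (.inr k)) (.inl (.inl j)) 1) := by
  have e : (⁅soGen n (-1) j, soGen n (-1) k⁆ : so n).1 =
      fMinusMat n j * fMinusMat n k - fMinusMat n k * fMinusMat n j := by
    rw [← soGen_neg_one, ← soGen_neg_one]
    rfl
  rw [e]
  simp only [fMinusMat, Matrix.smul_mul, Matrix.mul_smul, smul_smul, sqrt_two_mul_sqrt_two]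
  rw [← smul_sub, neg_smul, ← smul_neg]
  congr 1
  simp [mul_sub, sub_mul]
  abel

/-- The generators of `so(2n+1)` satisfy the triple relations. -/
theorem lie_lie_soGen (n : ℕ) (ξ η ε : ℤˣ) (j k l : Fin n) :
    ⁅⁅soGen n ξ j, soGen n η k⁆, soGen n ε l⁆ =
      ((1 / 2 : ℂ) * (((ε : ℤ) : ℂ) - ((η : ℤ) : ℂ)) ^ 2 * (if k = l then 1 else 0)) • soGen n ξ j
      - ((1 / 2 : ℂ) * (((ε : ℤ) : ℂ) - ((ξ : ℤ) : ℂ)) ^ 2 * (if j = l then 1 else 0)) •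
        soGen n η k := by
  have hl : ∀ X Y : so n, (⁅X, Y⁆ : so n).1 = X.1 * Y.1 - Y.1 * X.1 := fun _ _ => rfl
  refine lie_lie_eq_of_units (g := soGen n) ?_ ?_ ?_ ?_ ξ η ε j k l
  · intro j k l
    apply Subtype.ext
    rw [hl, lie_plus_minus, soGen_one, fPlusMat]
    rcases eq_or_ne k l with rfl | h
    · rw [if_pos rfl]
      change _ = (2 : ℂ) • (soGen n 1 j).1
      rw [soGen_one, fPlusMat]
      simp [mul_sub, sub_mul, smul_sub, mul_comm]
    · rw [if_neg h]
      simp [mul_sub, sub_mul, h, h.symm]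
  · intro j k l
    apply Subtype.ext
    rw [hl, lie_plus_minus, soGen_neg_one, fMinusMat]
    rcases eq_or_ne j l with rfl | h
    · rw [if_pos rfl]
      change _ = -(2 : ℂ) • (soGen n (-1) k).1
      rw [soGen_neg_one, fMinusMat]
      simp [mul_sub, sub_mul, smul_sub, mul_comm, neg_add_eq_sub]
    · rw [if_neg h]
      simp [mul_sub, sub_mul, h, h.symm]
  · intro j k l
    apply Subtype.ext
    rw [hl, lie_plus_plus, soGen_one, fPlusMat]
    simp [mul_sub, sub_mul]
  · intro j k l
    apply Subtype.ext
    rw [hl, lie_minus_minus, soGen_neg_one, fMinusMat]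
    simp [mul_sub, sub_mul]

section

variable {A : Type*} [LieRing A] [LieAlgebra ℂ A]

/-- The linear map on `so(2n+1)` that extends `f_j^ξ ↦ f ξ j` and `[f_j^ξ, f_k^η] ↦ [f ξ j, f η k]`,
in terms of the entries of a matrix. The coefficients `1/4` of the sums over all `j`, `k` take
account of the fact that `[f j, f k]` occurs twice. -/
def soMap (f : ℤˣ → Fin n → A) : so n →ₗ[ℂ] A where
  toFun X := (∑ j, (X.1 (.inl (.inl j)) (.inr ()) / (Real.sqrt 2 : ℂ)) • f 1 j)
    + (∑ j, (X.1 (.inr ()) (.inl (.inl j)) / (Real.sqrt 2 : ℂ)) • f (-1) j)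
    + (∑ j, ∑ k, (X.1 (.inl (.inl j)) (.inl (.inl k)) / 2) • ⁅f 1 j, f (-1) k⁆)
    + (∑ j, ∑ k, (-X.1 (.inl (.inl j)) (.inl (.inr k)) / 4) • ⁅f 1 j, f 1 k⁆)
    + (∑ j, ∑ k, (-X.1 (.inl (.inr j)) (.inl (.inl k)) / 4) • ⁅f (-1) j, f (-1) k⁆)
  map_add' X Y := by
    change (∑ j, ((X.1 + Y.1) (.inl (.inl j)) (.inr ()) / (Real.sqrt 2 : ℂ)) • f 1 j)
      + (∑ j, ((X.1 + Y.1) (.inr ()) (.inl (.inl j)) / (Real.sqrt 2 : ℂ)) • f (-1) j)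
      + (∑ j, ∑ k, ((X.1 + Y.1) (.inl (.inl j)) (.inl (.inl k)) / 2) • ⁅f 1 j, f (-1) k⁆)
      + (∑ j, ∑ k, (-(X.1 + Y.1) (.inl (.inl j)) (.inl (.inr k)) / 4) • ⁅f 1 j, f 1 k⁆)
      + (∑ j, ∑ k, (-(X.1 + Y.1) (.inl (.inr j)) (.inl (.inl k)) / 4) • ⁅f (-1) j, f (-1) k⁆) = _
    simp only [Matrix.add_apply, neg_add, add_div, add_smul, Finset.sum_add_distrib]
    abel
  map_smul' c X := by
    change (∑ j, ((c • X.1) (.inl (.inl j)) (.inr ()) / (Real.sqrt 2 : ℂ)) • f 1 j)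
      + (∑ j, ((c • X.1) (.inr ()) (.inl (.inl j)) / (Real.sqrt 2 : ℂ)) • f (-1) j)
      + (∑ j, ∑ k, ((c • X.1) (.inl (.inl j)) (.inl (.inl k)) / 2) • ⁅f 1 j, f (-1) k⁆)
      + (∑ j, ∑ k, (-(c • X.1) (.inl (.inl j)) (.inl (.inr k)) / 4) • ⁅f 1 j, f 1 k⁆)
      + (∑ j, ∑ k, (-(c • X.1) (.inl (.inr j)) (.inl (.inl k)) / 4) • ⁅f (-1) j, f (-1) k⁆) = _
    simp only [Matrix.smul_apply, smul_eq_mul, ← mul_neg, mul_div_assoc, mul_smul, smul_add,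
      Finset.smul_sum, RingHom.id_apply]

theorem soMap_apply (f : ℤˣ → Fin n → A) (X : so n) : soMap f X =
    (∑ j, (X.1 (.inl (.inl j)) (.inr ()) / (Real.sqrt 2 : ℂ)) • f 1 j)
    + (∑ j, (X.1 (.inr ()) (.inl (.inl j)) / (Real.sqrt 2 : ℂ)) • f (-1) j)
    + (∑ j, ∑ k, (X.1 (.inl (.inl j)) (.inl (.inl k)) / 2) • ⁅f 1 j, f (-1) k⁆)
    + (∑ j, ∑ k, (-X.1 (.inl (.inl j)) (.inl (.inr k)) / 4) • ⁅f 1 j, f 1 k⁆)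
    + (∑ j, ∑ k, (-X.1 (.inl (.inr j)) (.inl (.inl k)) / 4) • ⁅f (-1) j, f (-1) k⁆) :=
  rfl

theorem soMap_soGen (f : ℤˣ → Fin n → A) (ξ : ℤˣ) (j : Fin n) : soMap f (soGen n ξ j) = f ξ j := by
  have hs0 : (Real.sqrt 2 : ℂ) ≠ 0 := by
    intro h
    have := sqrt_two_mul_sqrt_two
    simp [h] at this
  rw [soMap_apply]
  rcases Int.units_eq_one_or ξ with rfl | rfl
  · rw [soGen_one, fPlusMat]
    simp [Matrix.single_apply, hs0, ite_smul, ite_div]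
  · rw [soGen_neg_one, fMinusMat]
    simp [Matrix.single_apply, hs0, ite_smul, ite_div]

theorem soMap_lie (f : ℤˣ → Fin n → A) (ξ η : ℤˣ) (j k : Fin n) :
    soMap f ⁅soGen n ξ j, soGen n η k⁆ = ⁅f ξ j, f η k⁆ := by
  have h4 : ∀ x y : A, (2⁻¹ : ℂ) • ⁅x, y⁆ - (2⁻¹ : ℂ) • ⁅y, x⁆ = ⁅x, y⁆ := fun x y => by
    rw [← lie_skew y x, smul_neg, sub_neg_eq_add, ← add_smul]
    norm_num
  have hpm : ∀ j k, soMap f ⁅soGen n 1 j, soGen n (-1) k⁆ = ⁅f 1 j, f (-1) k⁆ := by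
    intro j k
    rw [soMap_apply, lie_plus_minus]
    simp [Matrix.single_apply, ite_smul, ite_and, ite_div]
  rcases Int.units_eq_one_or ξ with rfl | rfl <;> rcases Int.units_eq_one_or η with rfl | rfl
  · rw [soMap_apply, lie_plus_plus]
    have hc : ∀ a b c d : Fin n, -((-2 : ℂ) • (Matrix.single (.inl (.inl a)) (.inl (.inr b)) 1
        - Matrix.single (.inl (.inl b)) (.inl (.inr a)) 1) : Matrix (Idx n) (Idx n) ℂ)
          (.inl (.inl c)) (.inl (.inr d)) / 4 =
        (if a = c then if b = d then 1 / 2 else 0 else 0) -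
          if b = c then if a = d then 1 / 2 else 0 else 0 := by
      intro a b c d
      simp only [Matrix.smul_apply, Matrix.sub_apply, Matrix.single_apply, Sum.inl.injEq,
        Sum.inr.injEq, ite_and, smul_eq_mul]
      split_ifs <;> norm_num
    simp only [hc]
    simp [sub_smul, ite_smul, Finset.sum_sub_distrib, h4]
  · exact hpm j k
  · rw [← lie_skew, map_neg, hpm, lie_skew]
  · rw [soMap_apply, lie_minus_minus]
    have hc : ∀ a b c d : Fin n, -((-2 : ℂ) • (Matrix.single (.inl (.inr a)) (.inl (.inl b)) 1
        - Matrix.single (.inl (.inr b)) (.inl (.inl a)) 1) : Matrix (Idx n) (Idx n) ℂ)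
          (.inl (.inr c)) (.inl (.inl d)) / 4 =
        (if a = c then if b = d then 1 / 2 else 0 else 0) -
          if b = c then if a = d then 1 / 2 else 0 else 0 := by
      intro a b c d
      simp only [Matrix.smul_apply, Matrix.sub_apply, Matrix.single_apply, Sum.inl.injEq,
        Sum.inr.injEq, ite_and, smul_eq_mul]
      split_ifs <;> norm_num
    simp only [hc]
    simp [sub_smul, ite_smul, Finset.sum_sub_distrib, h4]

end

section

attribute [local instance 100] LieRing.ofAssociativeRing

theorem soMap_self (X : so n) : soMap (soGen n) X = X := by
  have hs0 : (Real.sqrt 2 : ℂ) ≠ 0 := by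
    intro h
    have := sqrt_two_mul_sqrt_two
    simp [h] at this
  obtain ⟨h1, h2, h3, h4, h5, h6⟩ := (mem_so_iff n X.1).1 X.2
  have e : ∀ Y : Fin n → Fin n → ℂ, (∀ j k, Y j k = -Y k j) → ∀ x y, -∑ j, ∑ k, -Y j k / 4 *
      (2 * ((if j = x then if k = y then 1 else 0 else 0) -
        if k = x then if j = y then 1 else 0 else 0)) = Y x y := by
    intro Y hY x y
    simp only [mul_sub, Finset.sum_sub_distrib, mul_ite, mul_one, mul_zero,
      Finset.sum_ite_irrel, Finset.sum_const_zero, Finset.sum_ite_eq', Finset.mem_univ, if_true]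
    linear_combination (-1 / 2 : ℂ) * hY x y
  apply Subtype.ext
  have hsub : ∀ Y : so n, (so n).toSubmodule.subtype Y = Y.1 :=
    fun _ => rfl
  rw [← hsub, ← hsub, soMap_apply]
  simp only [map_add, map_sum, map_smul]
  simp only [hsub, lie_plus_minus, lie_plus_plus, lie_minus_minus, soGen_one, soGen_neg_one]
  ext x y
  rcases x with (x | x) | x <;> rcases y with (y | y) | y <;>
    simp [Matrix.add_apply, Matrix.sum_apply, Matrix.single_apply, fPlusMat, fMinusMat, ite_and,
      hs0]
  · exact e (fun j k => X.1 (.inl (.inl j)) (.inl (.inr k))) h2 x y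
  · exact e (fun j k => X.1 (.inl (.inr j)) (.inl (.inl k))) h3 x y
  · exact (h1 x y).symm
  · rw [h4 x, neg_neg]
  · exact (h5 y).symm
  · exact h6.symm

/-- `so(2n+1)` is spanned by the generators and their brackets. -/
theorem span_soGen (n : ℕ) : Submodule.span ℂ (Set.range (fun i : ℤˣ × Fin n => soGen n i.1 i.2) ∪
    Set.range fun q : (ℤˣ × Fin n) × (ℤˣ × Fin n) =>
      ⁅soGen n q.1.1 q.1.2, soGen n q.2.1 q.2.2⁆) = ⊤ := by
  rw [eq_top_iff]
  rintro X -
  rw [← soMap_self X, soMap_apply]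
  have h1 : ∀ (c : ℂ) ξ j, c • soGen n ξ j ∈ Submodule.span ℂ
      (Set.range (fun i : ℤˣ × Fin n => soGen n i.1 i.2) ∪ Set.range
        fun q : (ℤˣ × Fin n) × (ℤˣ × Fin n) => ⁅soGen n q.1.1 q.1.2, soGen n q.2.1 q.2.2⁆) :=
    fun c ξ j => Submodule.smul_mem _ _ (Submodule.subset_span (Or.inl ⟨(ξ, j), rfl⟩))
  have h2 : ∀ (c : ℂ) ξ j η k, c • ⁅soGen n ξ j, soGen n η k⁆ ∈ Submodule.span ℂ
      (Set.range (fun i : ℤˣ × Fin n => soGen n i.1 i.2) ∪ Set.range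
        fun q : (ℤˣ × Fin n) × (ℤˣ × Fin n) => ⁅soGen n q.1.1 q.1.2, soGen n q.2.1 q.2.2⁆) :=
    fun c ξ j η k => Submodule.smul_mem _ _
      (Submodule.subset_span (Or.inr ⟨((ξ, j), (η, k)), rfl⟩))
  exact Submodule.add_mem _ (Submodule.add_mem _ (Submodule.add_mem _ (Submodule.add_mem _
    (Submodule.sum_mem _ fun j _ => h1 _ _ _) (Submodule.sum_mem _ fun j _ => h1 _ _ _))
    (Submodule.sum_mem _ fun j _ => Submodule.sum_mem _ fun k _ => h2 _ _ _ _ _))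
    (Submodule.sum_mem _ fun j _ => Submodule.sum_mem _ fun k _ => h2 _ _ _ _ _))
    (Submodule.sum_mem _ fun j _ => Submodule.sum_mem _ fun k _ => h2 _ _ _ _ _)

end

/-! ### The universal property of the induced module -/

section

attribute [local instance 100] LieRing.ofAssociativeRing

variable {n : ℕ} {p : ℂ} {W : Type*} [AddCommGroup W] [Module ℂ W]

/-- Operators that satisfy the triple relations give a representation of `so(2n+1)`. -/
def soRep (f : ℤˣ → Fin n → Module.End ℂ W) (hf : TripleRelations f) :
    so n →ₗ⁅ℂ⁆ Module.End ℂ W :=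
  { soMap f with
    map_lie' := fun {x y} => map_lie_of_double_lie (A := Module.End ℂ W)
      (f := fun i : ℤˣ × Fin n => soGen n i.1 i.2) (F := fun i : ℤˣ × Fin n => f i.1 i.2) _ _
      (fun i j k => lie_lie_soGen n i.1 j.1 k.1 i.2 j.2 k.2)
      (fun i j k => hf i.1 j.1 k.1 i.2 j.2 k.2) (span_soGen n) (soMap f)
      (fun i => soMap_soGen f i.1 i.2) (fun i j => soMap_lie f i.1 j.1 i.2 j.2) x y }

theorem soRep_soGen (f : ℤˣ → Fin n → Module.End ℂ W) (hf : TripleRelations f) (ξ : ℤˣ)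
    (j : Fin n) : soRep f hf (soGen n ξ j) = f ξ j :=
  soMap_soGen f ξ j

/-- A vacuum vector spans a copy of the one-dimensional representation of the parabolic
subalgebra. -/
theorem soRep_parabolic (f : ℤˣ → Fin n → Module.End ℂ W) (hf : TripleRelations f) {w : W}
    (hw : ∀ j, f (-1) j w = 0)
    (hw' : ∀ j k, ⁅f 1 j, f (-1) k⁆ w = (if j = k then -p else 0) • w) (x : parabolic n) :
    soRep f hf (x : so n) w = vacuumChar n p x • w := by
  have hx := (mem_span_parabolicSet n x.1).1 x.2
  have hmm : ∀ j k, ⁅f (-1) j, f (-1) k⁆ w = 0 := fun j k => by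
    rw [LieRing.of_associative_ring_bracket, LinearMap.sub_apply, Module.End.mul_apply,
      Module.End.mul_apply, hw, hw, map_zero, map_zero, sub_zero]
  change soMap f x.1 w = (-(p / 2) * ∑ j : Fin n, x.1.1 (.inl (.inl j)) (.inl (.inl j))) • w
  rw [soMap_apply]
  simp only [hx.1, hx.2, LinearMap.add_apply, LinearMap.sum_apply, LinearMap.smul_apply, hw, hw',
    hmm, smul_zero, zero_div, zero_smul, neg_zero, Finset.sum_const_zero, zero_add, add_zero,
    ite_smul, smul_ite, smul_smul, Finset.sum_ite_eq, Finset.mem_univ, if_true]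
  rw [← Finset.sum_smul, Finset.mul_sum]
  congr 1
  exact Finset.sum_congr rfl fun j _ => by ring

/-- The map from the induced module to a module with a vacuum vector `w`, which takes the class of
an element `u` of the enveloping algebra to `u w`. -/
def inducedLift (f : ℤˣ → Fin n → Module.End ℂ W) (hf : TripleRelations f) {w : W}
    (hw : ∀ j, f (-1) j w = 0)
    (hw' : ∀ j k, ⁅f 1 j, f (-1) k⁆ w = (if j = k then -p else 0) • w) : WBar n p →ₗ[ℂ] W :=
  (((inducedIdeal n p).restrictScalars ℂ).liftQ
    ((LinearMap.applyₗ w).comp (UniversalEnvelopingAlgebra.lift ℂ (soRep f hf)).toLinearMap)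
    (by
      intro u hu
      change UniversalEnvelopingAlgebra.lift ℂ (soRep f hf) u w = 0
      induction (show u ∈ inducedIdeal n p from hu) using Submodule.span_induction with
      | zero => rw [map_zero, LinearMap.zero_apply]
      | add x y hx' hy' hx hy => rw [map_add, LinearMap.add_apply, hx hx', hy hy', add_zero]
      | smul c x hx' hx => rw [smul_eq_mul, map_mul, Module.End.mul_apply, hx hx', map_zero]
      | mem x hx =>
        obtain ⟨x, rfl⟩ := hx
        rw [map_sub, UniversalEnvelopingAlgebra.lift_ι_apply, AlgHom.commutes,
          LinearMap.sub_apply, soRep_parabolic f hf hw hw', Module.algebraMap_end_apply,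
          sub_self])).comp
    (Submodule.Quotient.restrictScalarsEquiv ℂ (inducedIdeal n p)).symm.toLinearMap

theorem inducedLift_mk (f : ℤˣ → Fin n → Module.End ℂ W) (hf : TripleRelations f) {w : W}
    (hw : ∀ j, f (-1) j w = 0)
    (hw' : ∀ j k, ⁅f 1 j, f (-1) k⁆ w = (if j = k then -p else 0) • w)
    (u : UniversalEnvelopingAlgebra ℂ (so n)) :
    inducedLift f hf hw hw' (Submodule.Quotient.mk u) =
      UniversalEnvelopingAlgebra.lift ℂ (soRep f hf) u w :=
  rfl

theorem inducedLift_vacuum (f : ℤˣ → Fin n → Module.End ℂ W) (hf : TripleRelations f) {w : W}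
    (hw : ∀ j, f (-1) j w = 0)
    (hw' : ∀ j k, ⁅f 1 j, f (-1) k⁆ w = (if j = k then -p else 0) • w) :
    inducedLift f hf hw hw' (vacuum n p) = w := by
  rw [vacuum, inducedLift_mk, map_one, Module.End.one_apply]

theorem inducedLift_inducedOp (f : ℤˣ → Fin n → Module.End ℂ W) (hf : TripleRelations f) {w : W}
    (hw : ∀ j, f (-1) j w = 0)
    (hw' : ∀ j k, ⁅f 1 j, f (-1) k⁆ w = (if j = k then -p else 0) • w) (ξ : ℤˣ) (j : Fin n)
    (x : WBar n p) : inducedLift f hf hw hw' (inducedOp n p ξ j x) =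
      f ξ j (inducedLift f hf hw hw' x) := by
  obtain ⟨u, rfl⟩ := Submodule.Quotient.mk_surjective _ x
  change inducedLift f hf hw hw' (Submodule.Quotient.mk
    (UniversalEnvelopingAlgebra.ι ℂ (soGen n ξ j) * u)) = _
  rw [inducedLift_mk, inducedLift_mk, map_mul, Module.End.mul_apply,
    UniversalEnvelopingAlgebra.lift_ι_apply, soRep_soGen]

/-! ### The induced module is spanned by ordered monomials -/

/-- The action of `so(2n+1)` on the induced module. -/
def inducedRep (n : ℕ) (p : ℂ) : so n →ₗ⁅ℂ⁆ Module.End ℂ (WBar n p) :=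
  (Algebra.lsmul ℂ ℂ (WBar n p) : UniversalEnvelopingAlgebra ℂ (so n) →ₐ[ℂ] _).toLieHom.comp
    (UniversalEnvelopingAlgebra.ι ℂ)

theorem tripleRelations_inducedOp (n : ℕ) (p : ℂ) : TripleRelations (inducedOp n p) := by
  intro ξ η ε j k l
  have h := congrArg (inducedRep n p) (lie_lie_soGen n ξ η ε j k l)
  rw [map_sub, map_smul, map_smul, LieHom.map_lie, LieHom.map_lie] at h
  exact h

theorem inducedRep_vacuum (x : parabolic n) :
    inducedRep n p (x : so n) (vacuum n p) = vacuumChar n p x • vacuum n p := by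
  change Submodule.Quotient.mk (UniversalEnvelopingAlgebra.ι ℂ (x : so n) * 1) =
    vacuumChar n p x • Submodule.Quotient.mk 1
  rw [mul_one, ← Submodule.Quotient.mk_smul, Submodule.Quotient.eq,
    ← Algebra.algebraMap_eq_smul_one]
  exact Submodule.subset_span ⟨x, rfl⟩

theorem inducedOp_vacuum (j : Fin n) : inducedOp n p (-1) j (vacuum n p) = 0 := by
  have h := inducedRep_vacuum (p := p) ⟨soGen n (-1) j, soGen_minus_mem n j⟩
  rw [vacuumChar_minus, zero_smul] at h
  exact h

theorem lie_inducedOp_vacuum (j k : Fin n) :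
    ⁅inducedOp n p 1 j, inducedOp n p (-1) k⁆ (vacuum n p) =
      (if j = k then -p else 0) • vacuum n p := by
  have h := inducedRep_vacuum (p := p) ⟨⁅soGen n (-1) k, soGen n 1 j⁆, lie_mem_parabolic n k j⟩
  rw [vacuumChar_lie] at h
  change inducedRep n p ⁅soGen n (-1) k, soGen n 1 j⁆ (vacuum n p) = _ at h
  rw [← lie_skew, map_neg, LinearMap.neg_apply, LieHom.map_lie, neg_eq_iff_eq_neg,
    ← neg_smul] at h
  refine h.trans ?_
  by_cases hjk : j = k
  · rw [if_pos hjk, if_pos hjk.symm]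
  · rw [if_neg hjk, if_neg (Ne.symm hjk), neg_zero]

/-- A subspace of the induced module that contains the vacuum and is stable under the generators is
the whole space. -/
theorem eq_top_of_inducedOp_mem {S : Submodule ℂ (WBar n p)} (h0 : vacuum n p ∈ S)
    (h : ∀ ξ j, ∀ x ∈ S, inducedOp n p ξ j x ∈ S) : S = ⊤ := by
  have hso : ∀ X : so n, ∀ x ∈ S, inducedRep n p X x ∈ S := by
    intro X x hx
    have hX := Submodule.eq_top_iff'.1 (span_soGen n) X
    induction hX using Submodule.span_induction with
    | zero =>
      rw [map_zero, LinearMap.zero_apply]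
      exact S.zero_mem
    | add X Y _ _ hX hY =>
      rw [map_add, LinearMap.add_apply]
      exact S.add_mem hX hY
    | smul c X _ hX =>
      rw [map_smul, LinearMap.smul_apply]
      exact S.smul_mem c hX
    | mem X hX =>
      rcases hX with ⟨i, rfl⟩ | ⟨q, rfl⟩
      · exact h _ _ x hx
      · dsimp only
        rw [LieHom.map_lie, LieRing.of_associative_ring_bracket, LinearMap.sub_apply]
        exact S.sub_mem (h _ _ _ (h _ _ x hx)) (h _ _ _ (h _ _ x hx))
  have hU : ∀ u : UniversalEnvelopingAlgebra ℂ (so n), ∀ x ∈ S, u • x ∈ S := by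
    intro u
    have hsurj : Function.Surjective (UniversalEnvelopingAlgebra.mkAlgHom ℂ (so n)) :=
      RingCon.mkₐ_surjective _
    obtain ⟨t, rfl⟩ := hsurj u
    induction t using TensorAlgebra.induction with
    | algebraMap r =>
      intro x hx
      rw [AlgHom.commutes, algebraMap_smul]
      exact S.smul_mem r hx
    | ι X => exact hso X
    | mul a b ha hb =>
      intro x hx
      rw [map_mul, mul_smul]
      exact ha _ (hb x hx)
    | add a b ha hb =>
      intro x hx
      rw [map_add, add_smul]
      exact S.add_mem (ha x hx) (hb x hx)
  rw [eq_top_iff]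
  rintro x -
  obtain ⟨u, rfl⟩ := Submodule.Quotient.mk_surjective _ x
  have := hU u _ h0
  rwa [vacuum, ← Submodule.Quotient.mk_smul, smul_eq_mul, mul_one] at this

end

/-! ### The induced module is the space of patterns -/

section words

attribute [local instance 100] LieRing.ofAssociativeRing

variable {n : ℕ} {W : Type*} [AddCommGroup W] [Module ℂ W]

/-- The words in the raising operators, applied to `w`. -/
def raisingWord (f : ℤˣ → Fin n → Module.End ℂ W) (w : W) (l : List (Fin n)) : W :=
  l.foldr (fun j x => f 1 j x) w

/-- The span of the words in the raising operators applied to a vacuum vector is stable under all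
generators. -/
theorem mem_span_raisingWord {p : ℂ} {f : ℤˣ → Fin n → Module.End ℂ W} (hf : TripleRelations f)
    {w : W} (hw : ∀ j, f (-1) j w = 0)
    (hw' : ∀ j k, ⁅f 1 j, f (-1) k⁆ w = (if j = k then -p else 0) • w) (ξ : ℤˣ) (j : Fin n) {x : W}
    (hx : x ∈ Submodule.span ℂ (Set.range (raisingWord f w))) :
    f ξ j x ∈ Submodule.span ℂ (Set.range (raisingWord f w)) := by
  set T := Submodule.span ℂ (Set.range (raisingWord f w)) with hT
  have hspan : ∀ A : Module.End ℂ W, (∀ l, A (raisingWord f w l) ∈ T) → ∀ x ∈ T, A x ∈ T := by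
    intro A hA x hx
    have : T ≤ T.comap A := Submodule.span_le.2 (by rintro _ ⟨l, rfl⟩; exact hA l)
    exact this hx
  have hword : ∀ l, raisingWord f w l ∈ T := fun l => Submodule.subset_span ⟨l, rfl⟩
  have hup : ∀ j, ∀ x ∈ T, f 1 j x ∈ T := fun j =>
    hspan _ fun l => hword (j :: l)
  have hlie : ∀ j k, ∀ x ∈ T, ⁅f 1 j, f (-1) k⁆ x ∈ T := by
    intro j k
    refine hspan _ fun l => ?_
    induction l with
    | nil =>
      change ⁅f 1 j, f (-1) k⁆ w ∈ T
      rw [hw']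
      exact T.smul_mem _ (hword [])
    | cons i l ih =>
      have h1 : ⁅f 1 j, f (-1) k⁆ (f 1 i (raisingWord f w l)) =
          f 1 i (⁅f 1 j, f (-1) k⁆ (raisingWord f w l)) +
            ⁅⁅f 1 j, f (-1) k⁆, f 1 i⁆ (raisingWord f w l) := by
        rw [LieRing.of_associative_ring_bracket ⁅f 1 j, f (-1) k⁆, LinearMap.sub_apply,
          Module.End.mul_apply, Module.End.mul_apply, add_sub_cancel]
      change ⁅f 1 j, f (-1) k⁆ (f 1 i (raisingWord f w l)) ∈ T
      rw [h1, hf 1 (-1) 1 j k i, sub_self]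
      refine T.add_mem (hup _ _ ih) ?_
      rw [LinearMap.sub_apply, LinearMap.smul_apply, LinearMap.smul_apply]
      refine T.sub_mem (T.smul_mem _ (hup _ _ (hword l))) ?_
      rw [show (1 / 2 : ℂ) * 0 ^ 2 * (if j = i then 1 else 0) = 0 by ring, zero_smul]
      exact T.zero_mem
  have hdown : ∀ k, ∀ x ∈ T, f (-1) k x ∈ T := by
    intro k
    refine hspan _ fun l => ?_
    induction l with
    | nil =>
      change f (-1) k w ∈ T
      rw [hw]
      exact T.zero_mem
    | cons i l ih =>
      have h1 : f (-1) k (f 1 i (raisingWord f w l)) =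
          f 1 i (f (-1) k (raisingWord f w l)) - ⁅f 1 i, f (-1) k⁆ (raisingWord f w l) := by
        rw [LieRing.of_associative_ring_bracket, LinearMap.sub_apply, Module.End.mul_apply,
          Module.End.mul_apply, sub_sub_cancel]
      change f (-1) k (f 1 i (raisingWord f w l)) ∈ T
      rw [h1]
      exact T.sub_mem (hup _ _ ih) (hlie _ _ _ (hword l))
  rcases Int.units_eq_one_or ξ with rfl | rfl
  · exact hup j x hx
  · exact hdown j x hx

/-- The raising operators as a sequence, with value `0` beyond the index `n - 1`. -/
def raisingSeq (f : ℤˣ → Fin n → Module.End ℂ W) (j : ℕ) : Module.End ℂ W :=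
  if h : j < n then f 1 ⟨j, h⟩ else 0

/-- The relation `[[f_j⁺, f_k⁺], f_l⁺] = 0` as commutation in the ring of operators. -/
theorem commute_raisingSeq {f : ℤˣ → Fin n → Module.End ℂ W} (hf : TripleRelations f)
    (j k l : ℕ) : Commute (Ring.instBracket.bracket (raisingSeq f j) (raisingSeq f k))
      (raisingSeq f l) := by
  unfold raisingSeq
  by_cases hj : j < n <;> by_cases hk : k < n <;> by_cases hl : l < n <;>
    simp only [hj, hk, hl, dif_pos, dif_neg, not_false_iff, Ring.lie_def, zero_mul, mul_zero,
      sub_zero, Commute.zero_left, Commute.zero_right]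
  have h := hf 1 1 1 ⟨j, hj⟩ ⟨k, hk⟩ ⟨l, hl⟩
  rw [sub_self, zero_pow two_ne_zero, mul_zero, zero_mul, zero_mul, zero_smul, zero_smul,
    sub_zero] at h
  exact sub_eq_zero.1 h

end words

section intertwine

variable {V W : Type*} [AddCommGroup V] [Module ℂ V] [AddCommGroup W] [Module ℂ W]

theorem map_commProd_apply (Φ : V →ₗ[ℂ] W) {F : ℕ → Module.End ℂ V} {G : ℕ → Module.End ℂ W}
    (h : ∀ j x, Φ (F j x) = G j (Φ x)) (t : ℕ → ℕ → ℕ) (k r : ℕ) (x : V) :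
    Φ (commProd F t k r x) = commProd G t k r (Φ x) := by
  have hlie : ∀ j k x, Φ (⁅F j, F k⁆ x) = ⁅G j, G k⁆ (Φ x) := fun j k x => by
    simp only [Ring.lie_def, LinearMap.sub_apply, Module.End.mul_apply, map_sub, h]
  have hpow : ∀ j k a x, Φ ((⁅F j, F k⁆ ^ a) x) = (⁅G j, G k⁆ ^ a) (Φ x) := by
    intro j k a
    induction a with
    | zero => exact fun _ => rfl
    | succ a ih =>
      intro x
      rw [pow_succ, pow_succ, Module.End.mul_apply, Module.End.mul_apply, ih, hlie]
  induction r generalizing x with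
  | zero => rfl
  | succ r ih => rw [commProd, commProd, Module.End.mul_apply, Module.End.mul_apply, ih, hpow]

theorem map_monomial_apply (Φ : V →ₗ[ℂ] W) {F : ℕ → Module.End ℂ V} {G : ℕ → Module.End ℂ W}
    (h : ∀ j x, Φ (F j x) = G j (Φ x)) (t : ℕ → ℕ → ℕ) (n : ℕ) (x : V) :
    Φ (monomial F t n x) = monomial G t n (Φ x) := by
  have hpow : ∀ j a x, Φ ((F j ^ a) x) = (G j ^ a) (Φ x) := by
    intro j a
    induction a with
    | zero => exact fun _ => rfl
    | succ a ih =>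
      intro x
      rw [pow_succ, pow_succ, Module.End.mul_apply, Module.End.mul_apply, ih, h]
  induction n generalizing x with
  | zero => rfl
  | succ n ih =>
    simp only [monomial, Module.End.mul_apply]
    rw [hpow, map_commProd_apply Φ h, ih]

end intertwine

variable {n : ℕ}

/-- The ordered monomials in the raising operators span the induced module. -/
theorem span_monomial_vacuum (n : ℕ) (p : ℂ) :
    Submodule.span ℂ (Set.range fun t : Exponents n =>
      monomial (raisingSeq (inducedOp n p)) t.1 n (vacuum n p)) = ⊤ := by
  set F := raisingSeq (inducedOp n p) with hF
  set S := Submodule.span ℂ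
    (Set.range fun t : Exponents n => monomial F t.1 n (vacuum n p)) with hS
  have hmem : ∀ t : ℕ → ℕ → ℕ, monomial F t n (vacuum n p) ∈ S := by
    intro t
    refine Submodule.subset_span ⟨⟨fun j k => if j ≤ k ∧ k < n then t j k else 0,
      fun j k h => if_neg h⟩, ?_⟩
    dsimp only
    rw [monomial_congr F n fun j k hj hk => if_pos ⟨hj, hk⟩]
  have hmem' : ∀ A ∈ monomialSpan F n, A (vacuum n p) ∈ S := by
    intro A hA
    have : monomialSpan F n ≤ S.comap (LinearMap.applyₗ (vacuum n p)) :=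
      Submodule.span_le.2 (by rintro _ ⟨t, rfl⟩; exact hmem t)
    exact this hA
  have hup : ∀ l, ∃ A ∈ monomialSpan F n, A (vacuum n p) =
      raisingWord (inducedOp n p) (vacuum n p) l := by
    intro l
    induction l with
    | nil =>
      refine ⟨1, Submodule.subset_span ⟨fun _ _ => 0, ?_⟩, rfl⟩
      have hc : ∀ k r, commProd F (fun _ _ => 0) k r = 1 := fun k r => by
        induction r with
        | zero => rfl
        | succ r ih => rw [commProd, ih, pow_zero, mul_one]
      dsimp only
      have hm : ∀ r, monomial F (fun _ _ => 0) r = 1 := fun r => by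
        induction r with
        | zero => rfl
        | succ r ih => rw [monomial, ih, hc, pow_zero, mul_one, mul_one]
      exact hm n
    | cons j l ih =>
      obtain ⟨A, hA, hAl⟩ := ih
      refine ⟨F j * A, mul_mem_monomialSpan_of_lt
        (commute_raisingSeq (tripleRelations_inducedOp n p)) j.2 hA, ?_⟩
      rw [Module.End.mul_apply, hAl, hF, raisingSeq, dif_pos j.2]
      rfl
  have hT : Submodule.span ℂ (Set.range (raisingWord (inducedOp n p) (vacuum n p))) = ⊤ :=
    eq_top_of_inducedOp_mem (Submodule.subset_span ⟨[], rfl⟩) fun ξ j x hx =>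
      mem_span_raisingWord (tripleRelations_inducedOp n p) inducedOp_vacuum lie_inducedOp_vacuum
        ξ j hx
  rw [eq_top_iff, ← hT]
  refine Submodule.span_le.2 ?_
  rintro _ ⟨l, rfl⟩
  obtain ⟨A, hA, hAl⟩ := hup l
  rw [← hAl]
  exact hmem' A hA

/-- The grading operator, with eigenvalue the sum of the top row. -/
def gradingOp (n : ℕ) : Module.End ℂ (PatternSpace n) := ∑ r ∈ Finset.Icc 1 n, weightOp n 0 r

theorem gradingOp_apply (v : PatternSpace n) (m : GZPattern n) :
    gradingOp n v m = (rowSum m n : ℂ) * v m := by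
  have h : ∀ m : GZPattern n, gradingOp n (patternVec m) = (rowSum m n : ℂ) • patternVec m := by
    intro m
    rw [gradingOp, LinearMap.sum_apply]
    simp only [weightOp_apply]
    rw [← Finset.sum_smul]
    congr 1
    have : ∀ k, ∑ r ∈ Finset.Icc 1 k, (-((0 : ℂ) / 2) + (rowSum m r : ℂ) - (rowSum m (r - 1) : ℂ)) =
        rowSum m k := by
      intro k
      induction k with
      | zero => simp [rowSum]
      | succ k ih =>
        rw [Finset.sum_Icc_succ_top (by omega), ih, Nat.add_sub_cancel]
        ring
    exact this n
  induction v using Finsupp.induction_linear with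
  | zero => simp
  | add v w hv hw => rw [map_add, Finsupp.add_apply, hv, hw, Finsupp.add_apply, mul_add]
  | single m' c =>
    have h1 : (Finsupp.single m' c : PatternSpace n) = c • patternVec m' := by
      simp [patternVec]
    rw [h1, map_smul, h, Finsupp.smul_apply, Finsupp.smul_apply, Finsupp.smul_apply, patternVec]
    by_cases hm : m' = m
    · subst hm
      simp [mul_comm]
    · simp [Finsupp.single_eq_of_ne (Ne.symm hm)]

theorem hasDegree_raisingSeq (a b : ℕ → ℤ → ℂ) (j : ℕ) :
    HasDegree (gradingOp n) (raisingSeq (parafermionOp n a b) j) 1 := by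
  rw [raisingSeq]
  split_ifs with hj
  · have h : ⁅gradingOp n, vectorUp n a (j + 1)⁆ = vectorUp n a (j + 1) := by
      have h1 : ⁅gradingOp n, vectorUp n a (j + 1)⁆ =
          ∑ r ∈ Finset.Icc 1 n, ⁅weightOp n 0 r, vectorUp n a (j + 1)⁆ := by
        simp only [gradingOp, Ring.lie_def, Finset.sum_mul, Finset.mul_sum]
        exact (Finset.sum_sub_distrib (G := Module.End ℂ (PatternSpace n)) ..).symm
      rw [h1, Finset.sum_congr rfl fun r hr => lie_weightOp_vectorUp a 0 (Finset.mem_Icc.1 hr).1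
        (Finset.mem_Icc.1 hr).2 (Nat.le_add_left 1 j) hj]
      refine LinearMap.ext fun v => ?_
      rw [LinearMap.sum_apply, Finset.sum_eq_single (j + 1)]
      · rw [if_pos rfl, LinearMap.smul_apply, one_smul]
      · intro r _ hr
        rw [if_neg hr, LinearMap.smul_apply, zero_smul]
      · exact fun h => absurd (Finset.mem_Icc.2 ⟨Nat.le_add_left 1 j, hj⟩) h
    rw [parafermionOp_one, HasDegree, Nat.cast_one, mul_add, mul_one]
    rw [Ring.lie_def] at h
    exact eq_add_of_sub_eq' h
  · simp [HasDegree]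

theorem finite_rowSum_le (N : ℕ) : {m : GZPattern n | rowSum m n ≤ N}.Finite := by
  have hle : ∀ m : GZPattern n, ∀ i j, m.entry i j ≤ rowSum m n := by
    intro m i j
    by_cases h : 1 ≤ i ∧ i ≤ j ∧ j ≤ n
    · have h1 : m.entry i j ≤ m.entry i n := by
        obtain ⟨hi, hij, hjn⟩ := h
        induction hjn using Nat.decreasingInduction with
        | self => exact le_rfl
        | of_succ j hj ih => exact (m.upper i j hi hij hj).trans (ih (by omega))
      exact h1.trans (Finset.single_le_sum (f := fun i => m.entry i n) (fun _ _ => Nat.zero_le _)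
        (Finset.mem_Icc.2 ⟨h.1, h.2.1.trans h.2.2⟩))
    · rw [m.zeros i j h]
      exact Nat.zero_le _
  let r : GZPattern n → Fin (n + 1) → Fin (n + 1) → ℕ := fun m i j => m.entry i j
  refine Set.Finite.of_finite_image (f := r)
    ((Set.finite_Icc (0 : Fin (n + 1) → Fin (n + 1) → ℕ) fun _ _ => N).subset ?_) ?_
  · rintro _ ⟨m, hm, rfl⟩
    exact ⟨fun _ _ => Nat.zero_le _, fun i j => (hle m i j).trans hm⟩
  · intro m _ m' _ h
    ext i j
    by_cases hij : 1 ≤ i ∧ i ≤ j ∧ j ≤ n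
    · exact congrFun (congrFun h ⟨i, by omega⟩) ⟨j, by omega⟩
    · rw [m.zeros i j hij, m'.zeros i j hij]

section

variable (n) (p : ℂ)

/-- The homomorphism from the induced module to the space of patterns. -/
def toPatternSpace : WBar n p →ₗ[ℂ] PatternSpace n :=
  inducedLift (parafermionOp n (regularWeight p) (sqrtWeight p))
    (tripleRelations_parafermionOp (regularWeight_mul_sqrtWeight p))
    (w := patternVec (zeroPattern n))
    (fun j => by rw [parafermionOp_neg_one]; exact vectorDown_zeroPattern _ _)
    (fun j k => by
      rw [parafermionOp_one, parafermionOp_neg_one]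
      refine (lie_vectorUp_vectorDown_zeroPattern (regularWeight_mul_sqrtWeight p)
        (Nat.le_add_left 1 j) j.2 (Nat.le_add_left 1 k) k.2).trans ?_
      simp only [Nat.add_right_cancel_iff, Fin.val_inj])

theorem toPatternSpace_vacuum : toPatternSpace n p (vacuum n p) = patternVec (zeroPattern n) :=
  inducedLift_vacuum ..

theorem toPatternSpace_inducedOp (ξ : ℤˣ) (j : Fin n) (x : WBar n p) :
    toPatternSpace n p (inducedOp n p ξ j x) =
      parafermionOp n (regularWeight p) (sqrtWeight p) ξ j (toPatternSpace n p x) :=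
  inducedLift_inducedOp ..

/-- The weights of `f_j⁺` were chosen without zeros, so that all patterns are reached from `|0)` by
the operators `f_n⁺` and `½[f_k⁺, f_{k+1}⁻]`, `k < n`. -/
theorem toPatternSpace_surjective : Function.Surjective (toPatternSpace n p) := by
  rw [← LinearMap.range_eq_top]
  set S := LinearMap.range (toPatternSpace n p)
  have hS : ∀ ξ j, ∀ v ∈ S, parafermionOp n (regularWeight p) (sqrtWeight p) ξ j v ∈ S := by
    rintro ξ j _ ⟨x, rfl⟩
    exact ⟨inducedOp n p ξ j x, toPatternSpace_inducedOp n p ξ j x⟩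
  have hup : ∀ k, k < n → ∀ v ∈ S, vectorUp n (regularWeight p) (k + 1) v ∈ S := by
    intro k hk v hv
    have := hS 1 ⟨k, hk⟩ v hv
    rwa [parafermionOp_one] at this
  have hdown : ∀ k, k < n → ∀ v ∈ S, vectorDown n (sqrtWeight p) (k + 1) v ∈ S := by
    intro k hk v hv
    have := hS (-1) ⟨k, hk⟩ v hv
    rwa [parafermionOp_neg_one] at this
  refine eq_top_of_rowUp_mem (w := regularWeight p) (regularWeight_ne_zero p)
    ⟨vacuum n p, toPatternSpace_vacuum n p⟩ fun k hk hkn v hv => ?_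
  obtain ⟨k, rfl⟩ := Nat.exists_eq_add_of_le' hk
  rcases hkn.eq_or_lt with hkn | hkn
  · subst hkn
    rw [← vectorUp_top]
    exact hup k (Nat.lt_succ_self k) v hv
  · have h := ((lie_vectorUp_vectorDown (regularWeight_mul_sqrtWeight p) hk hkn.le).2 hkn).1
    have h2 : rowUp n (regularWeight p) (k + 1) v = (1 / 2 : ℂ) •
        ⁅vectorUp n (regularWeight p) (k + 1), vectorDown n (sqrtWeight p) (k + 1 + 1)⁆ v := by
      rw [h, LinearMap.smul_apply, smul_smul]
      norm_num
    rw [h2, Ring.lie_def, LinearMap.sub_apply, Module.End.mul_apply, Module.End.mul_apply]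
    exact S.smul_mem _ (S.sub_mem (hup k (by omega) _ (hdown (k + 1) hkn _ hv))
      (hdown (k + 1) hkn _ (hup k (by omega) _ hv)))

/-- There are no more ordered monomials of a given degree than patterns whose top row has that sum.
-/
theorem toPatternSpace_injective : Function.Injective (toPatternSpace n p) := by
  refine injective_of_degree _ (span_monomial_vacuum n p) _ (toPatternSpace_surjective n p)
    Exponents.degree (fun m => rowSum m n) (fun t m hm => ?_) Exponents.toPattern
    Exponents.toPattern_injective Exponents.rowSum_toPattern finite_rowSum_le
  have h1 : ∀ j x, toPatternSpace n p (raisingSeq (inducedOp n p) j x) =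
      raisingSeq (parafermionOp n (regularWeight p) (sqrtWeight p)) j (toPatternSpace n p x) := by
    intro j x
    unfold raisingSeq
    split_ifs with hj
    · exact toPatternSpace_inducedOp n p 1 ⟨j, hj⟩ x
    · rw [LinearMap.zero_apply, LinearMap.zero_apply, map_zero]
  rw [map_monomial_apply _ h1, toPatternSpace_vacuum] at hm
  set M := monomial (raisingSeq (parafermionOp n (regularWeight p) (sqrtWeight p))) t.1 n
  have h2 : HasDegree (gradingOp n) M t.degree :=
    HasDegree.monomial (hasDegree_raisingSeq _ _) t.1 n
  have h0 : gradingOp n (patternVec (zeroPattern n)) = 0 := by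
    ext m
    rw [gradingOp_apply, patternVec, Finsupp.zero_apply]
    by_cases h : m = zeroPattern n
    · rw [h]
      simp [rowSum, zeroPattern]
    · rw [Finsupp.single_eq_of_ne h, mul_zero]
  have h3 := LinearMap.congr_fun h2 (patternVec (zeroPattern n))
  rw [Module.End.mul_apply, Module.End.mul_apply, LinearMap.add_apply, h0, zero_add] at h3
  have h4 := DFunLike.congr_fun h3 m
  have h5 : ((t.degree : ℕ) : Module.End ℂ (PatternSpace n)) (patternVec (zeroPattern n)) =
      (t.degree : ℂ) • patternVec (zeroPattern n) := by
    rw [Nat.cast_smul_eq_nsmul, Module.End.natCast_apply]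
  rw [gradingOp_apply, h5, map_smul, Finsupp.smul_apply, smul_eq_mul] at h4
  exact_mod_cast mul_right_cancel₀ hm h4

/-- The induced module is isomorphic to the space of patterns. -/
def patternEquiv : WBar n p ≃ₗ[ℂ] PatternSpace n :=
  LinearEquiv.ofBijective (toPatternSpace n p)
    ⟨toPatternSpace_injective n p, toPatternSpace_surjective n p⟩

/-- The basis of the induced module that corresponds to the vectors `|m)`. -/
def inducedBasis : Module.Basis (GZPattern n) ℂ (WBar n p) := .ofRepr (patternEquiv n p)

variable {n p}

theorem inducedBasis_apply (m : GZPattern n) :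
    inducedBasis n p m = (patternEquiv n p).symm (patternVec m) := by
  rw [inducedBasis, Module.Basis.coe_ofRepr]
  rfl

theorem inducedBasis_zeroPattern : inducedBasis n p (zeroPattern n) = vacuum n p := by
  rw [inducedBasis_apply, LinearEquiv.symm_apply_eq]
  exact (toPatternSpace_vacuum n p).symm

theorem ket_inducedBasis (e : ℕ → ℕ → ℤ) :
    ket (inducedBasis n p) e = (patternEquiv n p).symm (ket patternVec e) := by
  unfold ket
  split_ifs with h
  · exact inducedBasis_apply _
  · rw [map_zero]

theorem inducedOp_symm_apply (ξ : ℤˣ) (j : Fin n) (v : PatternSpace n) :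
    inducedOp n p ξ j ((patternEquiv n p).symm v) = (patternEquiv n p).symm
      (parafermionOp n (regularWeight p) (sqrtWeight p) ξ j v) := by
  rw [LinearEquiv.eq_symm_apply]
  refine (toPatternSpace_inducedOp n p ξ j _).trans ?_
  congr 1
  exact (patternEquiv n p).apply_symm_apply v

theorem isGZFamily_inducedBasis : IsGZFamily p (inducedOp n p) (inducedBasis n p) := by
  have h := isGZFamily_parafermionOp (n := n) (regularWeight_mul_sqrtWeight p)
  rw [isGZFamily_iff] at h ⊢
  have hlie : ∀ (j k : Fin n) (m : GZPattern n),
      (1 / 2 : ℂ) • ⁅inducedOp n p 1 j, inducedOp n p (-1) k⁆ (inducedBasis n p m) =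
        (patternEquiv n p).symm ((1 / 2 : ℂ) •
          ⁅parafermionOp n (regularWeight p) (sqrtWeight p) 1 j,
            parafermionOp n (regularWeight p) (sqrtWeight p) (-1) k⁆ (patternVec m)) := by
    intro j k m
    rw [inducedBasis_apply, map_smul]
    simp only [Ring.lie_def, LinearMap.sub_apply, Module.End.mul_apply, inducedOp_symm_apply,
      map_sub]
  refine ⟨fun k m => ?_, fun k k' m hk => ?_, fun k k' m hk => ?_⟩
  · rw [hlie, h.1, map_smul, inducedBasis_apply]
  · rw [hlie, h.2.1 k k' m hk, map_sum]
    simp only [map_smul, ket_inducedBasis]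
  · rw [hlie, h.2.2 k k' m hk, map_sum]
    simp only [map_smul, ket_inducedBasis]

theorem inducedOp_one_inducedBasis (j : Fin n) (m : GZPattern n) :
    inducedOp n p 1 j (inducedBasis n p m) =
      raiseVec (reducedGRegular n p) (inducedBasis n p) (j + 1) m := by
  rw [inducedBasis_apply, inducedOp_symm_apply, parafermionOp_one,
    ← raiseOp_eq_vectorUp (hasWeights_reducedGRegular p) j.2, raiseOp, shiftOp_apply, raiseVec,
    map_sum]
  simp only [map_smul, ket_inducedBasis]

theorem inducedOp_neg_one_inducedBasis (j : Fin n) (m : GZPattern n) :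
    inducedOp n p (-1) j (inducedBasis n p m) =
      lowerVec (reducedG n p) (inducedBasis n p) (j + 1) m := by
  rw [inducedBasis_apply, inducedOp_symm_apply, parafermionOp_neg_one,
    ← lowerOp_eq_vectorDown (hasWeights_reducedG p) j.2, lowerOp, shiftOp_apply, lowerVec,
    map_sum]
  simp only [map_smul, ket_inducedBasis]

end

end Parafermion

end

theorem mainTheorem2 (n : ℕ) (p : ℂ) :
    -- apart from the factor `p - m_{kn} + k - 1`, all radicands of the `G_k` are positive
    (∀ (m : Parafermion.GZPattern n) (k : ℕ), 1 ≤ k → k ≤ n →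
      (Even k → 0 < Parafermion.radicandEven n k (fun i => m.toInt i n)) ∧
      (Odd k → 0 < Parafermion.radicandOdd n k (fun i => m.toInt i n))) ∧
    -- the operators given by the `G_k` on the span of all `|m)`
    (Parafermion.TripleRelations (Parafermion.patternOp n p) ∧
      (∀ j : Fin n, Parafermion.patternOp n p (-1) j
        (Parafermion.patternVec (Parafermion.zeroPattern n)) = 0) ∧
      (∀ j k : Fin n, ⁅Parafermion.patternOp n p (-1) j, Parafermion.patternOp n p 1 k⁆
          (Parafermion.patternVec (Parafermion.zeroPattern n)) =
        (if j = k then p else 0) • Parafermion.patternVec (Parafermion.zeroPattern n)) ∧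
      Parafermion.IsGZFamily p (Parafermion.patternOp n p) Parafermion.patternVec) ∧
    -- the action on a Gelfand–Zetlin basis of the induced module
    (∃ b : Module.Basis (Parafermion.GZPattern n) ℂ (Parafermion.WBar n p),
      b (Parafermion.zeroPattern n) = Parafermion.vacuum n p ∧
      Parafermion.IsGZFamily p (Parafermion.inducedOp n p) b ∧
      ∀ (j : Fin n) (m : Parafermion.GZPattern n),
        Parafermion.inducedOp n p 1 j (b m) =
          Parafermion.raiseVec (Parafermion.reducedGRegular n p) b (j + 1) m ∧
        Parafermion.inducedOp n p (-1) j (b m) =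
          Parafermion.lowerVec (Parafermion.reducedG n p) b (j + 1) m) := by
  refine ⟨fun m k hk hkn => ⟨fun h => ?_, fun h => ?_⟩, ⟨?_, fun j => ?_, fun j k => ?_, ?_⟩, ?_⟩
  · rw [Parafermion.radicandEven_eq n k m.toInt h]
    exact Parafermion.redRad_pos m.isGZ hk hkn
  · rw [Parafermion.radicandOdd_eq n k m.toInt h]
    exact Parafermion.redRad_pos m.isGZ hk hkn
  · rw [Parafermion.patternOp_eq]
    exact Parafermion.tripleRelations_parafermionOp (Parafermion.sqrtWeight_mul_self p)
  · rw [Parafermion.patternOp_eq, Parafermion.parafermionOp_neg_one]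
    exact Parafermion.vectorDown_zeroPattern _ _
  · exact Parafermion.patternOp_lie_zeroPattern p j k
  · rw [Parafermion.patternOp_eq]
    exact Parafermion.isGZFamily_parafermionOp (Parafermion.sqrtWeight_mul_self p)
  · exact ⟨Parafermion.inducedBasis n p, Parafermion.inducedBasis_zeroPattern,
      Parafermion.isGZFamily_inducedBasis, fun j m =>
        ⟨Parafermion.inducedOp_one_inducedBasis j m,
          Parafermion.inducedOp_neg_one_inducedBasis j m⟩⟩
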